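/- Let $P\subset\mathbb R^2$ be a polygonal domain (bounded, open, connected, with boundary a simple closed polygonal curve) of perimeter one, and let $f$ be a contracting reflection law: a $C^2$ embedding of $[-\pi/2,\pi/2]$ into itself with $f(0)=0$, $f'>0$ on $(-\pi/2,\pi/2)$ and $\lambda(f)=\sup_{(-\pi/2,\pi/2)}|f'|<1$. Let $M=S^1\times[-\pi/2,\pi/2]$ be the set of unit vectors $x=(s,\theta)$ attached to $\partial P$, where $s\in S^1=\mathbb R/\mathbb Z$ is the arclength parameter of the base point along the positively oriented boundary and $\theta$ is the angle from the inner normal towards the tangent. Let $N^+=V\cup S\cup\partial M$, where $V$ is the set of $(s,\theta)$ based at a vertex with $|\theta|<\pi/2$, and $S$ is the set of vectors whose trajectory hits a vertex of $P$ at its first collision with $\partial P$. Let $\Phi=\Phi_{f,P}\colon M\setminus N^+\to M$, $\Phi(x)=(\bar s_1,f(\bar\theta_1))$, where $(\bar s_1,\bar\theta_1)$ is the image of $x$ under the billiard map of $P$ with specular reflection. For $n\ge1$ put $N_n^+=N^+\cup\Phi^{-1}(N^+)\cup\dots\cup\Phi^{-n+1}(N^+)$. Suppose that $P$ has no parallel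 sides facing each other, i.e. the endpoints of every straight segment that is contained inside $P$ and joins orthogonally two sides of $P$ are vertices of $P$. Then for every $\vartheta<\pi/2$ there is $n_0$ such that for every $n\ge n_0$ $$\liminf_{\delta\to0^+}\ \sup_{\Gamma\in\mathcal H_\vartheta(\delta)}\ \sum_{\gamma\in\pi_0(\Gamma\setminus N_n^+)}\frac1{a_n(\gamma)}<1,\qquad a_n(\gamma)=\inf_{x\in\gamma}\|D_x\Phi^n(1,0)\|,$$ where $\mathcal H_\vartheta(\delta)$ is the set of horizontal open segments (segments with $\theta$ constant) of $M$ that have length at most $\delta$ and lie in the strip $|\theta|\le\vartheta$, and $\pi_0$ denotes the set of connected components. In particular (take $\vartheta=\lambda(f)\pi/2$), for all sufficiently large $n$ the map $\Phi$ satisfies the $n$-step expansion condition for the horizontal segments contained in the strip $|\theta|\le\lambda(f)\pi/2$, which contains the image of $\Phi$. -/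

import Mathlib

open Set Filter Topology

noncomputable section

/-- A polygonal domain of the plane `ℂ = ℝ²` with `d` sides and perimeter one, whose boundary is a
simple closed curve, together with the positively oriented arclength parametrization of its
boundary. The arclength parameter is a real number read modulo `1`; the vertices are at the
parameters `0 = corner 0 < ⋯ < corner (d - 1) < 1`, and `corner d = 1` is the first vertex again. -/
structure PolygonalTable (d : ℕ) where
  /-- the polygonal domain itself -/
  domain : Set ℂ
  /-- arclength parametrization of its boundary -/
  bdry : ℝ → ℂ
  /-- arclength parameters of the vertices -/
  corner : Fin (d + 1) → ℝ
  /-- unit tangent vectors of the sides -/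
  dir : Fin d → ℂ
  isOpen_domain : IsOpen domain
  isConnected_domain : IsConnected domain
  isBounded_domain : Bornology.IsBounded domain
  frontier_domain : frontier domain = range bdry
  corner_zero : corner 0 = 0
  corner_last : corner (Fin.last d) = 1
  corner_strictMono : StrictMono corner
  bdry_periodic : Function.Periodic bdry 1
  bdry_injOn : InjOn bdry (Ico 0 1)
  norm_dir : ∀ i, ‖dir i‖ = 1
  /-- the `i`-th side is a straight segment, parametrized by arclength -/
  bdry_side : ∀ i : Fin d, ∀ s ∈ Icc (corner i.castSucc) (corner i.succ),
    bdry s = bdry (corner i.castSucc) + ((s - corner i.castSucc : ℝ) : ℂ) * dir i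
  /-- two consecutive sides are not collinear -/
  dir_ne : ∀ i j : Fin d, bdry (corner i.succ) = bdry (corner j.castSucc) → dir i ≠ dir j
  /-- positive orientation: the domain lies on the left of each side -/
  left_mem : ∀ i : Fin d, ∀ s ∈ Ioo (corner i.castSucc) (corner i.succ),
    ∀ᶠ t : ℝ in 𝓝[>] 0, bdry s + (t : ℂ) * (Complex.I * dir i) ∈ domain

namespace PolygonalTable

variable {d : ℕ} (P : PolygonalTable d)

/-- The vertices of the polygon. -/
def vertices : Set ℂ := range fun i => P.bdry (P.corner i)

/-- The `i`-th (closed) side of the polygon. -/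
def side (i : Fin d) : Set ℂ := P.bdry '' Icc (P.corner i.castSucc) (P.corner i.succ)

/-- The endpoints of every straight segment contained inside the polygon and joining orthogonally
two of its sides are vertices. -/
def NoParallelSidesFacing : Prop :=
  ∀ i j : Fin d, ∀ a ∈ P.side i, ∀ b ∈ P.side j, a ≠ b → openSegment ℝ a b ⊆ P.domain →
    inner ℝ (b - a) (P.dir i) = 0 → inner ℝ (b - a) (P.dir j) = 0 →
      a ∈ P.vertices ∧ b ∈ P.vertices

/- Points of the phase space `M = S¹ × [-π/2, π/2]` are written `(s, θ)` with `s` a real number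
read modulo `1`: the subsets of `M` below are given as subsets of `ℝ × ℝ` that are `1`-periodic
in `s`, and the billiard map returns its arclength coordinate in `[0, 1)`. -/

/-- The unit vector at the boundary point of parameter `s` that makes the angle `θ` with the inner
normal, measured towards the positively oriented tangent. -/
def velocity (x : ℝ × ℝ) : ℂ :=
  ((Real.sin x.2 : ℂ) + (Real.cos x.2 : ℂ) * Complex.I) * deriv P.bdry x.1

/-- The length of the free flight until the first collision with the boundary. -/
def flightTime (x : ℝ × ℝ) : ℝ :=
  sInf {t : ℝ | 0 < t ∧ P.bdry x.1 + (t : ℂ) * P.velocity x ∈ frontier P.domain}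

/-- The point of the first collision. -/
def hitPoint (x : ℝ × ℝ) : ℂ := P.bdry x.1 + (P.flightTime x : ℂ) * P.velocity x

/-- The arclength parameter in `[0, 1)` of the point of the first collision. -/
def hitParam (x : ℝ × ℝ) : ℝ := Function.invFunOn P.bdry (Ico 0 1) (P.hitPoint x)

/-- The billiard map with the specular reflection law. Specular reflection preserves the
component of the velocity along the tangent at the collision point, and this component is the
sine of the angle that the outgoing vector makes with the inner normal. -/
def specularMap (x : ℝ × ℝ) : ℝ × ℝ :=
  (P.hitParam x, Real.arcsin (inner ℝ (P.velocity x) (deriv P.bdry (P.hitParam x))))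

/-- The billiard map with the reflection law `f`. Only its values outside `singularSet`
are meaningful. -/
def billiardMap (f : ℝ → ℝ) (x : ℝ × ℝ) : ℝ × ℝ :=
  ((P.specularMap x).1, f (P.specularMap x).2)

/-- The set `V` of the vectors based at a vertex. -/
def vertexSet : Set (ℝ × ℝ) :=
  {x | P.bdry x.1 ∈ P.vertices ∧ x.2 ∈ Ioo (-(Real.pi / 2)) (Real.pi / 2)}

/-- The set `S` of the vectors whose trajectory hits a vertex at the first collision (those based
at a vertex belong to `V`, the tangent ones to `∂M`). -/
def hitVertexSet : Set (ℝ × ℝ) :=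
  {x | P.bdry x.1 ∉ P.vertices ∧ x.2 ∈ Ioo (-(Real.pi / 2)) (Real.pi / 2) ∧
    P.hitPoint x ∈ P.vertices}

/-- The boundary `∂M` of the phase space. -/
def phaseBoundary : Set (ℝ × ℝ) := {x | x.2 = -(Real.pi / 2) ∨ x.2 = Real.pi / 2}

/-- The singular set `N⁺ = V ∪ S ∪ ∂M` of the billiard map. -/
def singularSet : Set (ℝ × ℝ) := P.vertexSet ∪ P.hitVertexSet ∪ phaseBoundary

/-- The set `N⁺ₙ = N⁺ ∪ Φ⁻¹(N⁺) ∪ ⋯ ∪ Φ⁻ⁿ⁺¹(N⁺)`. The values of the map on the singular set are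
irrelevant here: the points at which an iterate is undefined lie in an earlier member. -/
def singularSetIter (f : ℝ → ℝ) (n : ℕ) : Set (ℝ × ℝ) :=
  ⋃ k < n, (P.billiardMap f)^[k] ⁻¹' P.singularSet

/-- The expansion coefficient `‖D_x Φⁿ (1, 0)‖` along the horizontal direction, in the
Euclidean norm. -/
def expansion (f : ℝ → ℝ) (n : ℕ) (x : ℝ × ℝ) : ENNReal :=
  ‖WithLp.toLp 2 (fderiv ℝ (P.billiardMap f)^[n] x (1, 0))‖ₑ

/-- The least expansion coefficient of `Φⁿ` along the horizontal direction on a set. -/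
def leastExpansion (f : ℝ → ℝ) (n : ℕ) (γ : Set (ℝ × ℝ)) : ENNReal :=
  ⨅ x ∈ γ, P.expansion f n x

end PolygonalTable

/-- The set of the connected components of a subset `A` of a topological space. -/
def componentsOf {X : Type*} [TopologicalSpace X] (A : Set X) : Set (Set X) :=
  connectedComponentIn A '' A

/-- The horizontal open segments of length at most `δ` in the strip `|θ| ≤ ϑ`
of the phase space. -/
def hCurves (ϑ δ : ℝ) : Set (Set (ℝ × ℝ)) :=
  {Γ | ∃ a b θ : ℝ, a < b ∧ b - a ≤ δ ∧ |θ| ≤ ϑ ∧ Γ = Ioo a b ×ˢ {θ}}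

/-- The quantity `β(Φ)` of the `n`-step expansion condition, for the `h`-curves in the strip
`|θ| ≤ ϑ`. -/
def PolygonalTable.stepExpansion {d : ℕ} (P : PolygonalTable d) (f : ℝ → ℝ) (ϑ : ℝ) (n : ℕ) :
    ENNReal :=
  liminf (fun δ : ℝ => ⨆ Γ ∈ hCurves ϑ δ,
    ∑' γ : componentsOf (Γ \ P.singularSetIter f n), (P.leastExpansion f n γ)⁻¹) (𝓝[>] 0)

/-- Contracting reflection laws: `C²` embeddings of `[-π/2, π/2]` into itself with `f 0 = 0`,
positive derivative on the open interval, and `λ(f) = sup |f'| < 1`. -/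
structure IsContractingLaw (f : ℝ → ℝ) : Prop where
  mapsTo : MapsTo f (Icc (-(Real.pi / 2)) (Real.pi / 2)) (Icc (-(Real.pi / 2)) (Real.pi / 2))
  contDiffOn : ContDiffOn ℝ 2 f (Icc (-(Real.pi / 2)) (Real.pi / 2))
  injOn : InjOn f (Icc (-(Real.pi / 2)) (Real.pi / 2))
  derivWithin_ne_zero : ∀ θ ∈ Icc (-(Real.pi / 2)) (Real.pi / 2),
    derivWithin f (Icc (-(Real.pi / 2)) (Real.pi / 2)) θ ≠ 0
  contracting : sSup ((fun θ => |deriv f θ|) '' Ioo (-(Real.pi / 2)) (Real.pi / 2)) < 1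
  map_zero : f 0 = 0
  deriv_pos : ∀ θ ∈ Ioo (-(Real.pi / 2)) (Real.pi / 2), 0 < deriv f θ

end

/-! The angle after a collision depends only on the incoming angle and on the two sides, so
horizontal vectors are mapped to horizontal vectors. Along an orbit the horizontal expansion is the
product of the ratios of the cosine of the outgoing angle to that of the next specular angle.
Regrouped, it equals the cosine of the initial angle, times one factor cos(f θ̄) / cos θ̄ per
collision, times the inverse cosine of the final angle (`growth`, `expansion_eq`). Since |f θ̄| ≤
l|θ̄| with l < 1, every factor is at least 1. It is at least some σ > 1 once |θ̄| ≥ κ, and at least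
c/η when the collision is grazing, cos θ̄ < η.

Growth. If two consecutive specular angles are small, the flight between them joins two sides that
are almost parallel, hence parallel, as there are finitely many sides. When no parallel sides face
each other, two such flights cannot follow one another (`eventually_not_parallel`). So among three
consecutive collisions one is far from orthogonal (`exists_uniform_angle`), and the expansion is at
least cos ϑ · σ^(n/3) (`exists_pow_le_growth`).

Complexity. Near a reference vector, the nearby vectors of a given angle split in two kinds. Those
that diverge from the reference never meet a singularity within the given time
(`eventually_diverging_notMem`); after crossing the reference trajectory a vector becomes diverging,
so only those that have not crossed it can be singular later. These all hit the same side
(`eventually_same_side`), and induction on time shows that at most d of them become singular at a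
given time, as long as no collision is grazing (`exists_nhds_encard_firstSingular_le`). By
compactness, the number of pieces of a short segment that contain a nongrazing vector is at most
linear in n.

Balance. The pieces without nongrazing vectors are at most exponentially many in n, by a bound that
does not involve η, while each contributes at most a constant times η. Taking n large makes the
first family contribute less than 1/2. Then η is chosen so that the second contributes at most 1/2,
and finally δ is taken small (`exists_tsum_inv_leastExpansion_le`). -/

noncomputable section

/-! ### Sides, frames, and half discs at an interior point of a side -/

namespace PolygonalTable

variable {d : ℕ} (P : PolygonalTable d)

/-- Parameters of the interior points of the `i`-th side. -/
def openSide (i : Fin d) : Set ℝ := Ioo (P.corner i.castSucc) (P.corner i.succ)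

/-- The arclength parametrization of the line that carries the `i`-th side. -/
def sidePoint (i : Fin d) (s : ℝ) : ℂ :=
  P.bdry (P.corner i.castSucc) + ((s - P.corner i.castSucc : ℝ) : ℂ) * P.dir i

/-- The complex coordinate in which the `i`-th side lies on the real axis and the coordinate of
its points is the arclength parameter. -/
def frame (i : Fin d) (q : ℂ) : ℂ :=
  P.corner i.castSucc + (starRingEnd ℂ) (P.dir i) * (q - P.bdry (P.corner i.castSucc))

lemma conj_dir_mul_dir (i : Fin d) : (starRingEnd ℂ) (P.dir i) * P.dir i = 1 := by
  rw [mul_comm, Complex.mul_conj, Complex.normSq_eq_norm_sq, P.norm_dir]; simp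

lemma corner_castSucc_lt_succ (i : Fin d) : P.corner i.castSucc < P.corner i.succ :=
  P.corner_strictMono Fin.castSucc_lt_succ

lemma corner_nonneg (k : Fin (d + 1)) : 0 ≤ P.corner k := by
  rw [← P.corner_zero]; exact P.corner_strictMono.monotone (Fin.zero_le k)

lemma corner_le_one (k : Fin (d + 1)) : P.corner k ≤ 1 := by
  rw [← P.corner_last]; exact P.corner_strictMono.monotone (Fin.le_last k)

lemma corner_castSucc_mem (i : Fin d) : P.corner i.castSucc ∈ Ico (0 : ℝ) 1 :=
  ⟨P.corner_nonneg _, (P.corner_castSucc_lt_succ i).trans_le (P.corner_le_one _)⟩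

lemma corner_succ_mem (i : Fin d) : P.corner i.succ ∈ Ioc (0 : ℝ) 1 :=
  ⟨(P.corner_nonneg _).trans_lt (P.corner_castSucc_lt_succ i), P.corner_le_one _⟩

lemma openSide_subset (i : Fin d) : P.openSide i ⊆ Ioo (0 : ℝ) 1 := fun _ hs =>
  ⟨(P.corner_nonneg _).trans_lt hs.1, hs.2.trans_le (P.corner_le_one _)⟩

lemma openSide_subset_Ico (i : Fin d) : P.openSide i ⊆ Ico (0 : ℝ) 1 := fun _ hs =>
  Ioo_subset_Ico_self (P.openSide_subset i hs)

lemma bdry_eq_sidePoint {i : Fin d} {s : ℝ}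
    (hs : s ∈ Icc (P.corner i.castSucc) (P.corner i.succ)) : P.bdry s = P.sidePoint i s :=
  P.bdry_side i s hs

lemma bdry_eq_of_mem_openSide {i : Fin d} {s : ℝ} (hs : s ∈ P.openSide i) :
    P.bdry s = P.sidePoint i s :=
  P.bdry_eq_sidePoint (Ioo_subset_Icc_self hs)

lemma exists_mem_Ico {s : ℝ} (hs : s ∈ Ico (0 : ℝ) 1) :
    ∃ i : Fin d, s ∈ Ico (P.corner i.castSucc) (P.corner i.succ) := by
  have key : ∀ k : Fin (d + 1), s < P.corner k →
      ∃ i : Fin d, s ∈ Ico (P.corner i.castSucc) (P.corner i.succ) := by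
    intro k
    induction k using Fin.induction with
    | zero => intro h; rw [P.corner_zero] at h; exact absurd h (not_lt.2 hs.1)
    | succ i ih =>
      intro h
      by_cases h' : s < P.corner i.castSucc
      · exact ih h'
      · exact ⟨i, not_lt.1 h', h⟩
  exact key (Fin.last d) (by rw [P.corner_last]; exact hs.2)

lemma openSide_unique {i j : Fin d} {s : ℝ} (hi : s ∈ P.openSide i) (hj : s ∈ P.openSide j) :
    i = j := by
  by_contra hne
  rcases lt_or_gt_of_ne hne with h | h
  · have : P.corner i.succ ≤ P.corner j.castSucc :=
      P.corner_strictMono.monotone (Fin.succ_le_castSucc_iff.2 h)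
    linarith [hi.2, hj.1]
  · have : P.corner j.succ ≤ P.corner i.castSucc :=
      P.corner_strictMono.monotone (Fin.succ_le_castSucc_iff.2 h)
    linarith [hj.2, hi.1]

lemma corner_notMem_openSide (k : Fin (d + 1)) (i : Fin d) : P.corner k ∉ P.openSide i := by
  intro h
  have h1 := P.corner_strictMono.lt_iff_lt.1 h.1
  have h2 := P.corner_strictMono.lt_iff_lt.1 h.2
  have h3 : (i.castSucc : Fin (d + 1)).val < k.val := h1
  have h4 : k.val < (i.succ : Fin (d + 1)).val := h2
  rw [Fin.val_castSucc] at h3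
  rw [Fin.val_succ] at h4
  omega

lemma bdry_one : P.bdry 1 = P.bdry 0 := by
  rw [← zero_add (1 : ℝ)]; exact P.bdry_periodic 0

lemma exists_eq_corner_of_mem_vertices {q : ℂ} (hq : q ∈ P.vertices) :
    ∃ k : Fin d, q = P.bdry (P.corner k.castSucc) := by
  obtain ⟨k, rfl⟩ := hq
  induction k using Fin.lastCases with
  | last =>
    have hd : d ≠ 0 := by
      rintro rfl
      have h0 := P.corner_zero
      have h1 := P.corner_last
      have : (Fin.last 0 : Fin 1) = 0 := rfl
      rw [this] at h1
      linarith
    refine ⟨⟨0, Nat.pos_of_ne_zero hd⟩, ?_⟩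
    have h0 : (Fin.castSucc ⟨0, Nat.pos_of_ne_zero hd⟩ : Fin (d + 1)) = 0 := by ext; simp
    simp only [P.corner_last, h0, P.corner_zero, P.bdry_one]
  | cast k => exact ⟨k, rfl⟩

lemma bdry_notMem_vertices {i : Fin d} {s : ℝ} (hs : s ∈ P.openSide i) :
    P.bdry s ∉ P.vertices := by
  intro h
  obtain ⟨k, hk⟩ := P.exists_eq_corner_of_mem_vertices h
  have := P.bdry_injOn (P.openSide_subset_Ico i hs) (P.corner_castSucc_mem k) hk
  exact P.corner_notMem_openSide _ i (this ▸ hs)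

lemma sidePoint_notMem_vertices {i : Fin d} {s : ℝ} (hs : s ∈ P.openSide i) :
    P.sidePoint i s ∉ P.vertices := by
  rw [← P.bdry_eq_of_mem_openSide hs]; exact P.bdry_notMem_vertices hs

lemma bdry_fract (s : ℝ) : P.bdry (Int.fract s) = P.bdry s := by
  have := P.bdry_periodic.sub_int_mul_eq ⌊s⌋ (x := s)
  rwa [mul_one] at this

lemma sidePoint_mem_frontier {i : Fin d} {s : ℝ}
    (hs : s ∈ Icc (P.corner i.castSucc) (P.corner i.succ)) :
    P.sidePoint i s ∈ frontier P.domain := by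
  rw [P.frontier_domain, ← P.bdry_eq_sidePoint hs]; exact mem_range_self _

lemma mem_frontier_cases {q : ℂ} (hq : q ∈ frontier P.domain) :
    q ∈ P.vertices ∨ ∃ j, ∃ s ∈ P.openSide j, q = P.sidePoint j s := by
  rw [P.frontier_domain] at hq
  obtain ⟨s, rfl⟩ := hq
  rw [← P.bdry_fract]
  obtain ⟨i, hi⟩ := P.exists_mem_Ico ⟨Int.fract_nonneg s, Int.fract_lt_one s⟩
  rcases hi.1.eq_or_lt with h | h
  · left; rw [← h]; exact ⟨_, rfl⟩
  · right
    exact ⟨i, _, ⟨h, hi.2⟩, P.bdry_eq_of_mem_openSide ⟨h, hi.2⟩⟩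

lemma vertices_subset_frontier : P.vertices ⊆ frontier P.domain := by
  rintro _ ⟨k, rfl⟩
  rw [P.frontier_domain]; exact mem_range_self _

lemma finite_vertices : P.vertices.Finite := finite_range _

lemma notMem_domain_of_mem_frontier {q : ℂ} (hq : q ∈ frontier P.domain) : q ∉ P.domain :=
  fun h => (P.isOpen_domain.frontier_eq ▸ hq).2 h

lemma sidePoint_unique {i j : Fin d} {s t : ℝ} (hs : s ∈ P.openSide i) (ht : t ∈ P.openSide j)
    (h : P.sidePoint i s = P.sidePoint j t) : i = j ∧ s = t := by
  rw [← P.bdry_eq_of_mem_openSide hs, ← P.bdry_eq_of_mem_openSide ht] at h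
  have := P.bdry_injOn (P.openSide_subset_Ico i hs) (P.openSide_subset_Ico j ht) h
  exact ⟨P.openSide_unique hs (this ▸ ht), this⟩

lemma frame_sidePoint_add (i : Fin d) (s : ℝ) (w : ℂ) :
    P.frame i (P.sidePoint i s + w * P.dir i) = s + w := by
  have := P.conj_dir_mul_dir i
  simp only [frame, sidePoint]
  push_cast
  linear_combination (((s : ℂ) - P.corner i.castSucc) + w) * this

lemma frame_sidePoint (i : Fin d) (s : ℝ) : P.frame i (P.sidePoint i s) = s := by
  have := P.frame_sidePoint_add i s 0
  simpa using this

lemma eq_sidePoint_add (i : Fin d) (s : ℝ) (q : ℂ) :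
    q = P.sidePoint i s + (P.frame i q - s) * P.dir i := by
  have := P.conj_dir_mul_dir i
  simp only [frame, sidePoint]
  push_cast
  linear_combination (-(q - P.bdry (P.corner i.castSucc))) * this

lemma eq_sidePoint_of_im_eq_zero {i : Fin d} {q : ℂ} (h : (P.frame i q).im = 0) :
    q = P.sidePoint i (P.frame i q).re := by
  have e := P.eq_sidePoint_add i (P.frame i q).re q
  have : P.frame i q - ((P.frame i q).re : ℂ) = 0 := by
    apply Complex.ext <;> simp [h]
  rwa [this, zero_mul, add_zero] at e

lemma norm_frame_sub (i : Fin d) (p q : ℂ) : ‖P.frame i p - P.frame i q‖ = ‖p - q‖ := by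
  have : P.frame i p - P.frame i q = (starRingEnd ℂ) (P.dir i) * (p - q) := by
    simp only [frame]; ring
  rw [this, norm_mul, RCLike.norm_conj, P.norm_dir, one_mul]

lemma continuous_sidePoint (i : Fin d) : Continuous (P.sidePoint i) := by
  unfold sidePoint; fun_prop

lemma isClosed_side (i : Fin d) : IsClosed (P.side i) := by
  have : P.side i = P.sidePoint i '' Icc (P.corner i.castSucc) (P.corner i.succ) :=
    image_congr fun s hs => P.bdry_eq_sidePoint hs
  rw [this]
  exact (isCompact_Icc.image (P.continuous_sidePoint i)).isClosed

lemma exists_mem_side {q : ℂ} (hq : q ∈ frontier P.domain) : ∃ i, q ∈ P.side i := by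
  rw [P.frontier_domain] at hq
  obtain ⟨s, rfl⟩ := hq
  rw [← P.bdry_fract]
  obtain ⟨i, hi⟩ := P.exists_mem_Ico ⟨Int.fract_nonneg s, Int.fract_lt_one s⟩
  exact ⟨i, _, Ico_subset_Icc_self hi, rfl⟩

lemma mem_side_cases {q : ℂ} {i : Fin d} (hq : q ∈ P.side i) :
    q = P.bdry (P.corner i.castSucc) ∨ q = P.bdry (P.corner i.succ) ∨
      ∃ s ∈ P.openSide i, q = P.sidePoint i s := by
  obtain ⟨s, hs, rfl⟩ := hq
  rcases hs.1.eq_or_lt with h | h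
  · left; rw [h]
  rcases hs.2.eq_or_lt with h' | h'
  · right; left; rw [h']
  · right; right; exact ⟨s, ⟨h, h'⟩, P.bdry_eq_sidePoint hs⟩

/-- Near an interior point of a side the boundary consists of that side. -/
lemma exists_ball_frontier_openSide {i : Fin d} {s : ℝ} (hs : s ∈ P.openSide i) :
    ∃ r > 0, ∀ q, ‖q - P.sidePoint i s‖ < r → q ∈ frontier P.domain →
      ∃ s' ∈ P.openSide i, q = P.sidePoint i s' := by
  -- K is closed and contains every boundary point outside the open side i; it misses the given
  -- point because the curve is simple.
  set K : Set ℂ := P.vertices ∪ ⋃ j ∈ {j : Fin d | j ≠ i}, P.side j with hK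
  have hKc : IsClosed K := P.finite_vertices.isClosed.union
    ((Set.toFinite _).isClosed_biUnion fun j _ => P.isClosed_side j)
  have hsK : P.sidePoint i s ∉ K := by
    rintro (h | h)
    · exact P.sidePoint_notMem_vertices hs h
    · simp only [mem_iUnion, mem_ofPred_eq] at h
      obtain ⟨j, hj, h⟩ := h
      rcases P.mem_side_cases h with h | h | ⟨t, ht, h⟩
      · exact P.sidePoint_notMem_vertices hs (h ▸ ⟨_, rfl⟩)
      · exact P.sidePoint_notMem_vertices hs (h ▸ ⟨_, rfl⟩)
      · exact hj (P.sidePoint_unique hs ht h).1.symm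
  obtain ⟨r, hr, hball⟩ := Metric.isOpen_iff.1 hKc.isOpen_compl _ hsK
  refine ⟨r, hr, fun q hq hqf => ?_⟩
  have hqK : q ∉ K := hball (by rwa [Metric.mem_ball, dist_eq_norm])
  rcases P.mem_frontier_cases hqf with h | ⟨j, t, ht, h⟩
  · exact absurd (Or.inl h) hqK
  · by_cases hj : j = i
    · subst hj; exact ⟨t, ht, h⟩
    · refine absurd (Or.inr ?_) hqK
      simp only [mem_iUnion, mem_ofPred_eq]
      refine ⟨j, hj, t, Ioo_subset_Icc_self ht, ?_⟩
      rw [P.bdry_eq_of_mem_openSide ht, h]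

/-- Off the boundary the plane is the disjoint union of two open sets, the domain and the complement
of its closure. This is how points are later shown to lie in the domain: by joining them to a known
one without meeting the boundary. -/
lemma subset_domain_of_isPreconnected {S : Set ℂ} (hS : IsPreconnected S)
    (hd : ∀ q ∈ S, q ∉ frontier P.domain) {q : ℂ} (hq : q ∈ S) (hq' : q ∈ P.domain) :
    S ⊆ P.domain := by
  refine hS.subset_left_of_subset_union P.isOpen_domain (isClosed_closure (s := P.domain)).isOpen_compl
    ?_ ?_ ⟨q, hq, hq'⟩
  · exact disjoint_compl_right.mono_left subset_closure
  · intro p hp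
    by_cases h : p ∈ P.domain
    · exact Or.inl h
    · refine Or.inr fun hc => hd p hp ?_
      rw [P.isOpen_domain.frontier_eq]; exact ⟨hc, h⟩

lemma isPreconnected_halfDisc (i : Fin d) (s r σ : ℝ) :
    IsPreconnected {q : ℂ | ‖q - P.sidePoint i s‖ < r ∧ 0 < σ * (P.frame i q).im} := by
  have h1 : {q : ℂ | ‖q - P.sidePoint i s‖ < r ∧ 0 < σ * (P.frame i q).im} =
      Metric.ball (P.sidePoint i s) r ∩ {q : ℂ | 0 < σ * (P.frame i q).im} := by
    ext q; simp [dist_eq_norm]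
  rw [h1]
  refine (Convex.inter (convex_ball _ _) ?_).isPreconnected
  intro p hp q hq a b ha hb hab
  have : (P.frame i (a • p + b • q)).im = a * (P.frame i p).im + b * (P.frame i q).im := by
    have hb' : (b : ℂ) = 1 - a := by rw [← Complex.ofReal_one, ← hab]; push_cast; ring
    have : P.frame i (a • p + b • q) = a * P.frame i p + b * P.frame i q := by
      simp only [frame, Complex.real_smul, hb']; ring
    rw [this]; simp
  simp only [mem_ofPred_eq] at hp hq ⊢
  rw [this]
  have e : σ * (a * (P.frame i p).im + b * (P.frame i q).im) =
    a * (σ * (P.frame i p).im) + b * (σ * (P.frame i q).im) := by ring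
  rw [e]
  rcases ha.eq_or_lt with h | h
  · subst h; have : b = 1 := by linarith
    subst this; simpa using hq
  · have := mul_pos h hp
    have := mul_nonneg hb hq.le
    linarith

/-- The left half disc misses the boundary and meets the domain by `left_mem`, hence lies inside.
Nothing is claimed about the right half disc: that the domain does not lie on both sides is a global
fact, `not_twoSided`. -/
lemma exists_halfDisc {i : Fin d} {s : ℝ} (hs : s ∈ P.openSide i) :
    ∃ r > 0, (∀ q, ‖q - P.sidePoint i s‖ < r → 0 < (P.frame i q).im → q ∈ P.domain) ∧
      (∀ q, ‖q - P.sidePoint i s‖ < r → (P.frame i q).im = 0 → q ∈ frontier P.domain) ∧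
      (∀ q, ‖q - P.sidePoint i s‖ < r → (P.frame i q).im ≠ 0 → q ∉ frontier P.domain) := by
  obtain ⟨r₁, hr₁, h₁⟩ := P.exists_ball_frontier_openSide hs
  obtain ⟨r₂, hr₂, h₂⟩ := Metric.isOpen_iff.1 isOpen_Ioo s hs
  have hF : ∀ q, ‖q - P.sidePoint i s‖ < min r₁ r₂ → (P.frame i q).im ≠ 0 →
      q ∉ frontier P.domain := by
    intro q hq him hf
    obtain ⟨s', -, rfl⟩ := h₁ q (hq.trans_le (min_le_left _ _)) hf
    rw [P.frame_sidePoint] at him; simp at him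
  refine ⟨min r₁ r₂, lt_min hr₁ hr₂, ?_, ?_, hF⟩
  · intro q hq him
    set S := {q : ℂ | ‖q - P.sidePoint i s‖ < min r₁ r₂ ∧ 0 < (1 : ℝ) * (P.frame i q).im}
    have hqS : q ∈ S := ⟨hq, by simpa using him⟩
    have ev := P.left_mem i s hs
    have ev2 : ∀ᶠ t : ℝ in 𝓝[>] 0, t ∈ Ioo 0 (min r₁ r₂) :=
      Ioo_mem_nhdsGT (lt_min hr₁ hr₂)
    obtain ⟨t, ht1, ht2⟩ := (ev.and ev2).exists
    rw [P.bdry_eq_of_mem_openSide hs, ← mul_assoc] at ht1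
    refine P.subset_domain_of_isPreconnected (P.isPreconnected_halfDisc i s _ 1) ?_
      (q := P.sidePoint i s + t * Complex.I * P.dir i) ⟨?_, ?_⟩ ht1 hqS
    · rintro p ⟨hp1, hp2⟩
      exact hF p hp1 (by rw [one_mul] at hp2; exact hp2.ne')
    · simp [P.norm_dir, abs_of_pos ht2.1, lt_min_iff.1 ht2.2]
    · rw [P.frame_sidePoint_add]; simp [ht2.1]
  · intro q hq him
    have hq' := P.eq_sidePoint_of_im_eq_zero him
    rw [hq']
    refine P.sidePoint_mem_frontier (Ioo_subset_Icc_self (h₂ ?_))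
    rw [Metric.mem_ball, Real.dist_eq]
    have h3 : ‖P.frame i q - P.frame i (P.sidePoint i s)‖ < r₂ := by
      rw [P.norm_frame_sub]; exact hq.trans_le (min_le_right _ _)
    rw [P.frame_sidePoint] at h3
    have h4 := Complex.abs_re_le_norm (P.frame i q - s)
    simp only [Complex.sub_re, Complex.ofReal_re] at h4
    exact h4.trans_lt h3

end PolygonalTable

/-! ### The closure of the domain near a side and near a vertex -/

namespace PolygonalTable

variable {d : ℕ} (P : PolygonalTable d)

lemma exists_angle {w : ℂ} (hw : ‖w‖ = 1) :
    ∃ φ ∈ Ico (0 : ℝ) (2 * Real.pi), w = Complex.exp (φ * Complex.I) := by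
  have h1 := Complex.norm_mul_exp_arg_mul_I w
  rw [hw, Complex.ofReal_one, one_mul] at h1
  have hπ := Real.pi_pos
  rcases le_or_gt 0 w.arg with h | h
  · exact ⟨w.arg, ⟨h, (Complex.arg_le_pi w).trans_lt (by linarith)⟩, h1.symm⟩
  · refine ⟨w.arg + 2 * Real.pi, ⟨by linarith [Complex.neg_pi_lt_arg w], by linarith⟩, ?_⟩
    push_cast
    rw [add_mul, Complex.exp_add, Complex.exp_two_pi_mul_I, mul_one, h1]

lemma exp_mul_I_inj {a b : ℝ} (h : Complex.exp (a * Complex.I) = Complex.exp (b * Complex.I))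
    (h1 : a - b < 2 * Real.pi) (h2 : b - a < 2 * Real.pi) : a = b := by
  obtain ⟨n, hn⟩ := Complex.exp_eq_exp_iff_exists_int.1 h
  have h3 : (a : ℂ) = b + n * (2 * Real.pi) := by
    have : (a : ℂ) * Complex.I = (b + n * (2 * Real.pi)) * Complex.I := by
      rw [hn]; ring
    exact mul_right_cancel₀ Complex.I_ne_zero this
  have h4 : a = b + n * (2 * Real.pi) := by exact_mod_cast h3
  have hπ := Real.pi_pos
  have h5 : (n : ℝ) < 1 := by
    by_contra hc
    nlinarith [not_lt.1 hc]
  have h6 : (-1 : ℝ) < n := by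
    by_contra hc
    nlinarith [not_lt.1 hc]
  have h7 : n < 1 := by exact_mod_cast h5
  have h8 : -1 < n := by exact_mod_cast h6
  have : n = 0 := by omega
  rw [h4, this]; simp

/-- If the boundary near `v` consists of two radii and the closure of the domain is a neighborhood
of the points of one of them, then it is a neighborhood of `v`. -/
lemma mem_interior_closure_of_radius {v a b : ℂ} (ha : ‖a‖ = 1) (hb : ‖b‖ = 1) (hab : a ≠ b)
    {r : ℝ} (hr : 0 < r) (hv : v ∈ frontier P.domain)
    (hloc : ∀ q, ‖q - v‖ < r → q ∈ frontier P.domain →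
      ∃ t : ℝ, 0 ≤ t ∧ (q = v + t * a ∨ q = v + t * b))
    (hbf : ∀ t : ℝ, 0 < t → t < r → v + t * b ∈ frontier P.domain)
    (hU : ∀ t : ℝ, 0 < t → t < r → v + t * a ∈ interior (closure P.domain)) :
    v ∈ interior (closure P.domain) := by
  have ha0 : a ≠ 0 := by rintro rfl; simp at ha
  have hπ := Real.pi_pos
  refine mem_interior.2 ⟨Metric.ball v r, ?_, Metric.isOpen_ball, Metric.mem_ball_self hr⟩
  intro z hz
  rw [Metric.mem_ball, dist_eq_norm] at hz
  by_cases hzf : z ∈ frontier P.domain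
  · exact frontier_subset_closure hzf
  have hzv : z - v ≠ 0 := by
    intro h; rw [sub_eq_zero.1 h] at hzf; exact hzf hv
  set ρ := ‖z - v‖ with hρ
  have hρ0 : 0 < ρ := norm_pos_iff.2 hzv
  have hρC : (ρ : ℂ) ≠ 0 := by exact_mod_cast hρ0.ne'
  obtain ⟨φ, hφ, hφe⟩ := exists_angle (w := (z - v) / (ρ * a)) (by
    rw [norm_div, norm_mul, ha, mul_one, Complex.norm_real, Real.norm_of_nonneg hρ0.le, ← hρ,
      div_self hρ0.ne'])
  obtain ⟨β, hβ, hβe⟩ := exists_angle (w := b / a) (by rw [norm_div, ha, hb, div_one])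
  have hbe : b = a * Complex.exp (β * Complex.I) := by rw [← hβe]; field_simp
  have hβ0 : β ≠ 0 := by
    rintro rfl; apply hab; rw [hbe]; simp
  -- The circle about v through z = g φ, with angles counted from the radius a; the radius b is at
  -- the angle β. One of the two arcs from z to a avoids b, so it meets the boundary at most at its
  -- end on a, and near that end it runs in the domain.
  set g : ℝ → ℂ := fun ψ => v + ρ * a * Complex.exp (ψ * Complex.I) with hg
  have hgc : Continuous g := by rw [hg]; fun_prop
  have hgz : g φ = z := by
    simp only [hg]; rw [← hφe]; field_simp; ring
  have hgn : ∀ ψ, ‖g ψ - v‖ = ρ := by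
    intro ψ
    simp only [hg, add_sub_cancel_left, norm_mul, ha, Complex.norm_exp_ofReal_mul_I, mul_one,
      Complex.norm_real, Real.norm_of_nonneg hρ0.le]
  have hgf : ∀ ψ ∈ Ioo 0 (2 * Real.pi), ψ ≠ β → g ψ ∉ frontier P.domain := by
    intro ψ hψ hψβ hf
    obtain ⟨t, ht, h⟩ := hloc _ (by rw [hgn]; exact hz) hf
    have htρ : t = ρ := by
      have h1 := hgn ψ
      rcases h with h | h <;>
      · rw [h, add_sub_cancel_left, norm_mul, Complex.norm_real, Real.norm_of_nonneg ht] at h1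
        first | rwa [ha, mul_one] at h1 | rwa [hb, mul_one] at h1
    subst htρ
    rcases h with h | h
    · have h2 : Complex.exp (ψ * Complex.I) = Complex.exp ((0 : ℝ) * Complex.I) := by
        have h3 : (ρ : ℂ) * a * Complex.exp (ψ * Complex.I) = ρ * a * 1 := by
          have := add_left_cancel h; rw [this]; ring
        rw [mul_left_cancel₀ (mul_ne_zero hρC ha0) h3]; simp
      exact hψ.1.ne' (exp_mul_I_inj h2 (by linarith [hψ.2]) (by linarith [hψ.1]))
    · have h2 : Complex.exp (ψ * Complex.I) = Complex.exp (β * Complex.I) := by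
        have h3 : (ρ : ℂ) * a * Complex.exp (ψ * Complex.I) =
            ρ * a * Complex.exp (β * Complex.I) := by
          have := add_left_cancel h; rw [this, hbe]; ring
        exact mul_left_cancel₀ (mul_ne_zero hρC ha0) h3
      exact hψβ (exp_mul_I_inj h2 (by linarith [hψ.2, hβ.1]) (by linarith [hψ.1, hβ.2]))
  have hg0 : g 0 ∈ interior (closure P.domain) := by
    simp only [hg]; simpa using hU ρ hρ0 hz
  have hg2 : g (2 * Real.pi) ∈ interior (closure P.domain) := by
    have : g (2 * Real.pi) = g 0 := by
      simp only [hg]; push_cast; rw [Complex.exp_two_pi_mul_I]; simp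
    rw [this]; exact hg0
  have hdom : ∀ ψ, g ψ ∈ interior (closure P.domain) → g ψ ∉ frontier P.domain →
      g ψ ∈ P.domain := by
    intro ψ h1 h2
    by_contra h3
    exact h2 (by rw [P.isOpen_domain.frontier_eq]; exact ⟨interior_subset h1, h3⟩)
  have hφ0 : φ ≠ 0 ∨ z ∈ closure P.domain := by
    by_cases h : φ = 0
    · right; rw [← hgz, h]; exact interior_subset hg0
    · exact Or.inl h
  rcases hφ0 with hφ0 | h
  swap
  · exact h
  have hφpos : 0 < φ := lt_of_le_of_ne hφ.1 (Ne.symm hφ0)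
  rcases lt_trichotomy φ β with h | h | h
  · have ev : ∀ᶠ ψ in 𝓝[>] (0 : ℝ), g ψ ∈ interior (closure P.domain) :=
      (hgc.continuousAt.eventually (isOpen_interior.mem_nhds hg0)).filter_mono nhdsWithin_le_nhds
    obtain ⟨ψ, h1, h2⟩ := (ev.and (Ioo_mem_nhdsGT hφpos)).exists
    have hS : ∀ q ∈ g '' Ioc 0 φ, q ∉ frontier P.domain := by
      rintro _ ⟨ψ', hψ', rfl⟩
      exact hgf ψ' ⟨hψ'.1, hψ'.2.trans_lt hφ.2⟩ (hψ'.2.trans_lt h).ne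
    have hψm : g ψ ∈ g '' Ioc 0 φ := ⟨ψ, ⟨h2.1, h2.2.le⟩, rfl⟩
    have := P.subset_domain_of_isPreconnected (isPreconnected_Ioc.image g hgc.continuousOn) hS
      hψm (hdom ψ h1 (hS _ hψm))
    rw [← hgz]
    exact subset_closure (this ⟨φ, ⟨hφpos, le_rfl⟩, rfl⟩)
  · refine absurd ?_ hzf
    rw [← hgz, h]
    have := hbf ρ hρ0 hz
    rw [hbe, ← mul_assoc] at this
    exact this
  · have ev : ∀ᶠ ψ in 𝓝[<] (2 * Real.pi), g ψ ∈ interior (closure P.domain) :=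
      (hgc.continuousAt.eventually (isOpen_interior.mem_nhds hg2)).filter_mono nhdsWithin_le_nhds
    obtain ⟨ψ, h1, h2⟩ := (ev.and (Ioo_mem_nhdsLT hφ.2)).exists
    have hS : ∀ q ∈ g '' Ico φ (2 * Real.pi), q ∉ frontier P.domain := by
      rintro _ ⟨ψ', hψ', rfl⟩
      exact hgf ψ' ⟨hφpos.trans_le hψ'.1, hψ'.2⟩ (h.trans_le hψ'.1).ne'
    have hψm : g ψ ∈ g '' Ico φ (2 * Real.pi) := ⟨ψ, ⟨h2.1.le, h2.2⟩, rfl⟩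
    have := P.subset_domain_of_isPreconnected (isPreconnected_Ico.image g hgc.continuousOn) hS
      hψm (hdom ψ h1 (hS _ hψm))
    rw [← hgz]
    exact subset_closure (this ⟨φ, ⟨le_rfl, hφ.2⟩, rfl⟩)

lemma bdry_injOn_Ioc : InjOn P.bdry (Ioc 0 1) := by
  have key : ∀ s ∈ Ioc (0 : ℝ) 1, s = 1 ∨ s ∈ Ioo (0 : ℝ) 1 := fun s hs =>
    hs.2.eq_or_lt.imp id fun h => ⟨hs.1, h⟩
  intro s hs t ht h
  rcases key s hs with h1 | h1 <;> rcases key t ht with h2 | h2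
  · rw [h1, h2]
  · rw [h1, P.bdry_one] at h
    have := P.bdry_injOn ⟨le_rfl, one_pos⟩ (Ioo_subset_Ico_self h2) h
    exact absurd this h2.1.ne
  · rw [h2, P.bdry_one] at h
    have := P.bdry_injOn (Ioo_subset_Ico_self h1) ⟨le_rfl, one_pos⟩ h
    exact absurd this h1.1.ne'
  · exact P.bdry_injOn (Ioo_subset_Ico_self h1) (Ioo_subset_Ico_self h2) h

/-- The closure of the domain is a neighborhood of the interior points of the `i`-th side. -/
def TwoSided (i : Fin d) : Prop :=
  ∀ s ∈ P.openSide i, P.sidePoint i s ∈ interior (closure P.domain)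

/-- The right half disc misses the boundary, so it is either inside the domain or disjoint from it.
The right-hand side does not involve s', so being interior to the closure is a locally constant
property along the side. -/
lemma eventually_mem_interior_closure_iff {i : Fin d} {s : ℝ} (hs : s ∈ P.openSide i) :
    ∃ r > 0, ∀ s', |s' - s| < r → (P.sidePoint i s' ∈ interior (closure P.domain) ↔
      ∃ q, ‖q - P.sidePoint i s‖ < r ∧ (P.frame i q).im < 0 ∧ q ∈ P.domain) := by
  obtain ⟨r, hr, h1, h2, h3⟩ := P.exists_halfDisc hs
  have hdist : ∀ s', ‖P.sidePoint i s' - P.sidePoint i s‖ = |s' - s| := by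
    intro s'
    rw [← P.norm_frame_sub i, P.frame_sidePoint, P.frame_sidePoint, ← Complex.ofReal_sub,
      Complex.norm_real, Real.norm_eq_abs]
  refine ⟨r, hr, fun s' hs' => ⟨fun h => ?_, ?_⟩⟩
  · rw [mem_interior_iff_mem_nhds] at h
    have hcont : Continuous fun t : ℝ => P.sidePoint i s' + (-t * Complex.I) * P.dir i := by
      fun_prop
    have ev1 : ∀ᶠ t : ℝ in 𝓝[>] 0,
        P.sidePoint i s' + (-t * Complex.I) * P.dir i ∈ closure P.domain := by
      refine (hcont.continuousAt (x := 0)).eventually ?_ |>.filter_mono nhdsWithin_le_nhds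
      simpa using h
    have ev2 : ∀ᶠ t : ℝ in 𝓝[>] 0,
        ‖P.sidePoint i s' + (-t * Complex.I) * P.dir i - P.sidePoint i s‖ < r := by
      refine (hcont.continuousAt (x := 0)).eventually
        (p := fun q => ‖q - P.sidePoint i s‖ < r) ?_ |>.filter_mono nhdsWithin_le_nhds
      refine (isOpen_lt (by fun_prop) continuous_const).mem_nhds ?_
      simp [hdist, hs']
    obtain ⟨t, ⟨ht1, ht2⟩, ht3⟩ := ((ev1.and ev2).and self_mem_nhdsWithin).exists
    have him : (P.frame i (P.sidePoint i s' + (-t * Complex.I) * P.dir i)).im < 0 := by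
      rw [P.frame_sidePoint_add]; simpa using ht3
    refine ⟨_, ht2, him, ?_⟩
    by_contra hc
    exact h3 _ ht2 him.ne (by rw [P.isOpen_domain.frontier_eq]; exact ⟨ht1, hc⟩)
  · rintro ⟨q, hq1, hq2, hq3⟩
    refine mem_interior.2 ⟨Metric.ball (P.sidePoint i s) r, ?_, Metric.isOpen_ball, ?_⟩
    · intro z hz
      rw [Metric.mem_ball, dist_eq_norm] at hz
      rcases lt_trichotomy (P.frame i z).im 0 with h | h | h
      · refine subset_closure (P.subset_domain_of_isPreconnected
          (P.isPreconnected_halfDisc i s r (-1)) ?_ (q := q) ⟨hq1, by linarith⟩ hq3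
            ⟨hz, by linarith⟩)
        rintro p ⟨hp1, hp2⟩
        exact h3 p hp1 (by intro h0; rw [h0] at hp2; simp at hp2)
      · exact frontier_subset_closure (h2 z hz h)
      · exact subset_closure (h1 z hz h)
    · rw [Metric.mem_ball, dist_eq_norm, hdist]; exact hs'

lemma twoSided_of_mem {i : Fin d} {s : ℝ} (hs : s ∈ P.openSide i)
    (h : P.sidePoint i s ∈ interior (closure P.domain)) : P.TwoSided i := by
  intro t ht
  have := (isPreconnected_Ioo (a := P.corner i.castSucc) (b := P.corner i.succ)).induction₂
    (fun x y => P.sidePoint i x ∈ interior (closure P.domain) ↔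
      P.sidePoint i y ∈ interior (closure P.domain)) ?_ (fun _ _ _ _ _ _ h1 h2 => h1.trans h2)
      (fun _ _ _ _ h => h.symm) hs ht
  · exact this.1 h
  · intro x hx
    obtain ⟨r, hr, hiff⟩ := P.eventually_mem_interior_closure_iff hx
    refine Filter.Eventually.filter_mono nhdsWithin_le_nhds ?_
    filter_upwards [Metric.ball_mem_nhds x hr] with y hy
    rw [Metric.mem_ball, Real.dist_eq] at hy
    rw [hiff x (by simpa using hr), hiff y hy]

end PolygonalTable

/-! ### The domain lies on one side only of its boundary -/

namespace PolygonalTable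

variable {d : ℕ} (P : PolygonalTable d)

lemma exists_prev (j : Fin d) :
    ∃ i : Fin d, P.bdry (P.corner i.succ) = P.bdry (P.corner j.castSucc) := by
  obtain ⟨j, hj⟩ := j
  rcases j with _ | j
  · refine ⟨⟨d - 1, by omega⟩, ?_⟩
    have h1 : (Fin.succ ⟨d - 1, by omega⟩ : Fin (d + 1)) = Fin.last d := by
      ext; simp; omega
    have h2 : (Fin.castSucc ⟨0, hj⟩ : Fin (d + 1)) = 0 := by ext; simp
    rw [h1, h2, P.corner_last, P.corner_zero, P.bdry_one]
  · exact ⟨⟨j, by omega⟩, rfl⟩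

lemma sidePoint_corner_succ (i : Fin d) :
    P.sidePoint i (P.corner i.succ) = P.bdry (P.corner i.succ) :=
  (P.bdry_eq_sidePoint ⟨(P.corner_castSucc_lt_succ i).le, le_rfl⟩).symm

lemma sidePoint_succ_sub (i : Fin d) (t : ℝ) :
    P.sidePoint i (P.corner i.succ - t) = P.bdry (P.corner i.succ) + t * -P.dir i := by
  rw [← sidePoint_corner_succ]; simp only [sidePoint]; push_cast; ring

lemma sidePoint_castSucc_add (i : Fin d) (t : ℝ) :
    P.sidePoint i (P.corner i.castSucc + t) = P.bdry (P.corner i.castSucc) + t * P.dir i := by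
  simp only [sidePoint]; push_cast; ring

/-- A vertex belongs to no sides but the two that end there, and the others are closed. The bounds
of r by the lengths of the two sides ensure that the radii of length less than r are part of the
boundary. -/
lemma exists_ball_frontier_vertex {i j : Fin d}
    (h : P.bdry (P.corner i.succ) = P.bdry (P.corner j.castSucc)) :
    ∃ r > 0, r ≤ P.corner i.succ - P.corner i.castSucc ∧
      r ≤ P.corner j.succ - P.corner j.castSucc ∧
      ∀ q, ‖q - P.bdry (P.corner i.succ)‖ < r → q ∈ frontier P.domain →
        ∃ t : ℝ, 0 ≤ t ∧ (q = P.bdry (P.corner i.succ) + t * -P.dir i ∨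
          q = P.bdry (P.corner i.succ) + t * P.dir j) := by
  set K : Set ℂ := ⋃ k ∈ {k : Fin d | k ≠ i ∧ k ≠ j}, P.side k with hK
  have hKc : IsClosed K := (Set.toFinite _).isClosed_biUnion fun j _ => P.isClosed_side j
  have hvK : P.bdry (P.corner i.succ) ∉ K := by
    intro hv
    simp only [hK, mem_iUnion, mem_ofPred_eq] at hv
    obtain ⟨k, ⟨hki, hkj⟩, hv⟩ := hv
    rcases P.mem_side_cases hv with hv | hv | ⟨s, hs, hv⟩
    · rw [h] at hv
      have := P.bdry_injOn (P.corner_castSucc_mem _) (P.corner_castSucc_mem _) hv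
      exact hkj (Fin.castSucc_injective _ (P.corner_strictMono.injective this)).symm
    · have := P.bdry_injOn_Ioc (P.corner_succ_mem _) (P.corner_succ_mem _) hv
      exact hki (Fin.succ_injective _ (P.corner_strictMono.injective this)).symm
    · exact P.sidePoint_notMem_vertices hs (hv ▸ ⟨_, rfl⟩)
  obtain ⟨r, hr, hball⟩ := Metric.isOpen_iff.1 hKc.isOpen_compl _ hvK
  have hi := P.corner_castSucc_lt_succ i
  have hj := P.corner_castSucc_lt_succ j
  refine ⟨min r (min (P.corner i.succ - P.corner i.castSucc)
    (P.corner j.succ - P.corner j.castSucc)), by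
      simp only [gt_iff_lt, lt_min_iff]; exact ⟨hr, by linarith, by linarith⟩,
      (min_le_right _ _).trans (min_le_left _ _), (min_le_right _ _).trans (min_le_right _ _),
      fun q hq hqf => ?_⟩
  have hqK : q ∉ K := hball (by
    rw [Metric.mem_ball, dist_eq_norm]; exact hq.trans_le (min_le_left _ _))
  obtain ⟨k, s, hs, rfl⟩ := P.exists_mem_side hqf
  have hk : k = i ∨ k = j := by
    by_contra hc
    push Not at hc
    refine hqK ?_
    simp only [hK, mem_iUnion, mem_ofPred_eq]
    exact ⟨k, hc, s, hs, rfl⟩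
  rw [P.bdry_eq_sidePoint hs]
  rcases hk with rfl | rfl
  · refine ⟨P.corner k.succ - s, by linarith [hs.2], Or.inl ?_⟩
    rw [← sidePoint_succ_sub, sub_sub_cancel]
  · refine ⟨s - P.corner k.castSucc, by linarith [hs.1], Or.inr ?_⟩
    rw [h, ← sidePoint_castSucc_add, add_sub_cancel]

lemma neg_dir_ne_dir {i j : Fin d}
    (h : P.bdry (P.corner i.succ) = P.bdry (P.corner j.castSucc)) : -P.dir i ≠ P.dir j := by
  intro hd
  obtain ⟨r, hr, hri, hrj, -⟩ := P.exists_ball_frontier_vertex h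
  have key : ∀ t : ℝ, 0 < t → t < r → i = j ∧ P.corner i.succ - t = P.corner j.castSucc + t := by
    intro t ht0 htr
    refine P.sidePoint_unique ⟨by linarith, by linarith⟩ ⟨by linarith, by linarith⟩ ?_
    rw [sidePoint_succ_sub, sidePoint_castSucc_add, h, hd]
  have h1 := (key (r / 2) (by linarith) (by linarith)).2
  have h2 := (key (r / 3) (by linarith) (by linarith)).2
  linarith

lemma mem_interior_closure_of_twoSided {i j : Fin d}
    (h : P.bdry (P.corner i.succ) = P.bdry (P.corner j.castSucc))
    (hij : P.TwoSided i ∨ P.TwoSided j) :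
    P.bdry (P.corner i.succ) ∈ interior (closure P.domain) := by
  obtain ⟨r, hr, hri, hrj, hloc⟩ := P.exists_ball_frontier_vertex h
  have hv : P.bdry (P.corner i.succ) ∈ frontier P.domain :=
    P.vertices_subset_frontier ⟨_, rfl⟩
  have hi : ∀ t : ℝ, 0 < t → t < r → P.corner i.succ - t ∈ P.openSide i := fun t h0 h1 =>
    ⟨by linarith, by linarith⟩
  have hj : ∀ t : ℝ, 0 < t → t < r → P.corner j.castSucc + t ∈ P.openSide j := fun t h0 h1 =>
    ⟨by linarith, by linarith⟩
  rcases hij with hT | hT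
  · refine P.mem_interior_closure_of_radius (a := -P.dir i) (b := P.dir j) (by simp [P.norm_dir])
      (P.norm_dir j) (P.neg_dir_ne_dir h) hr hv hloc ?_ ?_
    · intro t h0 h1
      rw [h, ← sidePoint_castSucc_add]
      exact P.sidePoint_mem_frontier (Ioo_subset_Icc_self (hj t h0 h1))
    · intro t h0 h1
      rw [← sidePoint_succ_sub]
      exact hT _ (hi t h0 h1)
  · refine P.mem_interior_closure_of_radius (a := P.dir j) (b := -P.dir i) (P.norm_dir j)
      (by simp [P.norm_dir]) (P.neg_dir_ne_dir h).symm hr hv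
      (fun q h1 h2 => (hloc q h1 h2).imp fun t ht => ⟨ht.1, ht.2.symm⟩) ?_ ?_
    · intro t h0 h1
      rw [← sidePoint_succ_sub]
      exact P.sidePoint_mem_frontier (Ioo_subset_Icc_self (hi t h0 h1))
    · intro t h0 h1
      rw [h, ← sidePoint_castSucc_add]
      exact hT _ (hj t h0 h1)

/-- Two-sidedness passes from a side to its end vertex by turning around it, and any neighborhood of
the vertex contains interior points of the other side. -/
lemma twoSided_iff_of_adjacent {i j : Fin d}
    (h : P.bdry (P.corner i.succ) = P.bdry (P.corner j.castSucc)) :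
    P.TwoSided i ↔ P.TwoSided j := by
  obtain ⟨r, hr, hri, hrj, -⟩ := P.exists_ball_frontier_vertex h
  have h1 : Continuous fun t : ℝ => P.bdry (P.corner i.succ) + t * -P.dir i := by fun_prop
  have h2 : Continuous fun t : ℝ => P.bdry (P.corner i.succ) + t * P.dir j := by fun_prop
  have hr' : ∀ᶠ t : ℝ in 𝓝[>] 0, t ∈ Ioo 0 r := Ioo_mem_nhdsGT hr
  constructor
  · intro hT
    have hv := P.mem_interior_closure_of_twoSided h (Or.inl hT)
    have ev := ((h2.continuousAt (x := 0)).eventually (isOpen_interior.mem_nhds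
      (by simpa using hv))).filter_mono (nhdsWithin_le_nhds (s := Ioi 0))
    obtain ⟨t, ht1, ht2⟩ := (ev.and hr').exists
    refine P.twoSided_of_mem (s := P.corner j.castSucc + t)
      ⟨by linarith [ht2.1], by linarith [ht2.2]⟩ ?_
    rw [sidePoint_castSucc_add, ← h]; exact ht1
  · intro hT
    have hv := P.mem_interior_closure_of_twoSided h (Or.inr hT)
    have ev := ((h1.continuousAt (x := 0)).eventually (isOpen_interior.mem_nhds
      (by simpa using hv))).filter_mono (nhdsWithin_le_nhds (s := Ioi 0))
    obtain ⟨t, ht1, ht2⟩ := (ev.and hr').exists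
    refine P.twoSided_of_mem (s := P.corner i.succ - t)
      ⟨by linarith [ht2.2], by linarith [ht2.1]⟩ ?_
    rw [sidePoint_succ_sub]; exact ht1

lemma twoSided_iff (i j : Fin d) : P.TwoSided i ↔ P.TwoSided j := by
  have key : ∀ n (hn : n < d) (h0 : 0 < d), P.TwoSided ⟨n, hn⟩ ↔ P.TwoSided ⟨0, h0⟩ := by
    intro n
    induction n with
    | zero => intros; rfl
    | succ n ih =>
      intro hn h0
      rw [← ih (by omega) h0]
      exact (P.twoSided_iff_of_adjacent rfl).symm
  rw [key i i.2 (by have := i.2; omega), key j j.2]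

/-- The domain lies only on the left of each side. -/
lemma not_twoSided (i : Fin d) : ¬ P.TwoSided i := by
  intro hT
  have hall : ∀ j, P.TwoSided j := fun j => (P.twoSided_iff i j).1 hT
  have hfr : frontier P.domain ⊆ interior (closure P.domain) := by
    intro q hq
    rcases P.mem_frontier_cases hq with h | ⟨j, s, hs, rfl⟩
    · obtain ⟨k, rfl⟩ := P.exists_eq_corner_of_mem_vertices h
      obtain ⟨l, hl⟩ := P.exists_prev k
      rw [← hl]
      exact P.mem_interior_closure_of_twoSided hl (Or.inl (hall l))
    · exact hall j s hs
  -- If all sides are two-sided, the closure is open and closed, hence the whole plane, against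
  -- boundedness. This takes the place of the Jordan curve theorem.
  have hopen : IsOpen (closure P.domain) := by
    rw [← interior_eq_iff_isOpen]
    refine Subset.antisymm interior_subset ?_
    rw [closure_eq_self_union_frontier]
    refine union_subset ?_ ?_
    · rw [← closure_eq_self_union_frontier]
      exact interior_maximal subset_closure P.isOpen_domain
    · rw [← closure_eq_self_union_frontier]; exact hfr
  have huniv : closure P.domain = univ :=
    IsClopen.eq_univ ⟨isClosed_closure, hopen⟩ P.isConnected_domain.nonempty.closure
  have hb := P.isBounded_domain.closure
  rw [huniv] at hb
  exact NormedSpace.unbounded_univ ℝ ℂ hb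

/-- Near an interior point of a side, the domain is the half plane on the left of the side. -/
lemma exists_ball_mem_domain_iff {i : Fin d} {s : ℝ} (hs : s ∈ P.openSide i) :
    ∃ r > 0, ∀ q, ‖q - P.sidePoint i s‖ < r → (q ∈ P.domain ↔ 0 < (P.frame i q).im) := by
  obtain ⟨r₁, hr₁, h1, h2, h3⟩ := P.exists_halfDisc hs
  obtain ⟨r₂, hr₂, h4⟩ := P.eventually_mem_interior_closure_iff hs
  refine ⟨min r₁ r₂, lt_min hr₁ hr₂, fun q hq => ⟨fun hqd => ?_, fun h => h1 q ?_ h⟩⟩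
  · by_contra hc
    rcases (not_lt.1 hc).eq_or_lt with h | h
    · exact P.notMem_domain_of_mem_frontier (h2 q (hq.trans_le (min_le_left _ _)) h) hqd
    · have := (h4 s (by simpa using hr₂)).2 ⟨q, hq.trans_le (min_le_right _ _), h, hqd⟩
      exact P.not_twoSided i (P.twoSided_of_mem hs this)
  · exact hq.trans_le (min_le_left _ _)

end PolygonalTable

/-! ### Flights, first collisions, and the billiard map along them -/

namespace PolygonalTable

variable {d : ℕ} (P : PolygonalTable d)

/-- The ray that leaves the point of parameter `s` of the `i`-th side at the angle `θ`. -/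
def ray (i : Fin d) (s θ t : ℝ) : ℂ :=
  P.sidePoint i s + (t * (Real.sin θ + Real.cos θ * Complex.I)) * P.dir i

/-- The direction of the `j`-th side in the frame of the `i`-th one. -/
def relDir (i j : Fin d) : ℂ := (starRingEnd ℂ) (P.dir i) * P.dir j

/-- The position of the `j`-th side in the frame of the `i`-th one. -/
def relBase (i j : Fin d) : ℂ := P.frame i (P.sidePoint j 0)

/-- The vector of base parameter `s` and angle `θ` on the `i`-th side hits the interior of the
`j`-th side at the parameter `s'`. -/
def HitsSide (i : Fin d) (s θ : ℝ) (j : Fin d) (s' : ℝ) : Prop :=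
  s ∈ P.openSide i ∧ θ ∈ Ioo (-(Real.pi / 2)) (Real.pi / 2) ∧ s' ∈ P.openSide j ∧
    ∃ t > 0, P.ray i s θ t = P.sidePoint j s' ∧ ∀ t' ∈ Ioo 0 t, P.ray i s θ t' ∈ P.domain

/-- The vector of base parameter `s` and angle `θ` on the `i`-th side hits the vertex `w`. -/
def HitsVertex (i : Fin d) (s θ : ℝ) (w : ℂ) : Prop :=
  w ∈ P.vertices ∧ ∃ t > 0, P.ray i s θ t = w ∧ ∀ t' ∈ Ioo 0 t, P.ray i s θ t' ∈ P.domain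

/-- The specular angle after a collision with the `j`-th side. -/
def outAngle (i j : Fin d) (θ : ℝ) : ℝ :=
  Real.arcsin ((P.relDir i j).re * Real.sin θ + (P.relDir i j).im * Real.cos θ)

/-- The parameter of the point of the line of the `j`-th side that is hit. -/
def hitCoord (i j : Fin d) (s θ : ℝ) : ℝ :=
  (s - (P.relBase i j).re + (P.relBase i j).im * Real.tan θ) /
    ((P.relDir i j).re - (P.relDir i j).im * Real.tan θ)

lemma frame_ray (i : Fin d) (s θ t : ℝ) :
    P.frame i (P.ray i s θ t) = s + t * (Real.sin θ + Real.cos θ * Complex.I) :=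
  P.frame_sidePoint_add i s _

lemma frame_ray_re (i : Fin d) (s θ t : ℝ) :
    (P.frame i (P.ray i s θ t)).re = s + t * Real.sin θ := by
  rw [frame_ray]
  simp [-Complex.ofReal_sin, -Complex.ofReal_cos]

lemma frame_ray_im (i : Fin d) (s θ t : ℝ) :
    (P.frame i (P.ray i s θ t)).im = t * Real.cos θ := by
  rw [frame_ray]
  simp [-Complex.ofReal_sin, -Complex.ofReal_cos]

lemma frame_sidePoint' (i j : Fin d) (s : ℝ) :
    P.frame i (P.sidePoint j s) = P.relBase i j + s * P.relDir i j := by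
  simp only [frame, sidePoint, relBase, relDir]; push_cast; ring

lemma frame_sidePoint_re (i j : Fin d) (s : ℝ) :
    (P.frame i (P.sidePoint j s)).re = (P.relBase i j).re + s * (P.relDir i j).re := by
  rw [frame_sidePoint']; simp

lemma frame_sidePoint_im (i j : Fin d) (s : ℝ) :
    (P.frame i (P.sidePoint j s)).im = (P.relBase i j).im + s * (P.relDir i j).im := by
  rw [frame_sidePoint']; simp

lemma frame_injective (i : Fin d) : Function.Injective (P.frame i) := by
  intro p q h
  rw [P.eq_sidePoint_add i 0 p, P.eq_sidePoint_add i 0 q, h]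

lemma norm_relDir (i j : Fin d) : ‖P.relDir i j‖ = 1 := by
  rw [relDir, norm_mul, RCLike.norm_conj, P.norm_dir, P.norm_dir, one_mul]

lemma relDir_sq (i j : Fin d) : (P.relDir i j).re ^ 2 + (P.relDir i j).im ^ 2 = 1 := by
  have h := Complex.normSq_eq_norm_sq (P.relDir i j)
  rw [P.norm_relDir, Complex.normSq_apply] at h
  linarith

lemma relDir_symm (i j : Fin d) : P.relDir j i = (starRingEnd ℂ) (P.relDir i j) := by
  simp [relDir, mul_comm]

lemma continuous_ray (i : Fin d) : Continuous fun x : ℝ × ℝ × ℝ => P.ray i x.1 x.2.1 x.2.2 := by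
  unfold ray sidePoint; fun_prop

lemma norm_ray_sub (i : Fin d) (s θ t : ℝ) : ‖P.ray i s θ t - P.sidePoint i s‖ = |t| := by
  have h : ‖(Real.sin θ + Real.cos θ * Complex.I : ℂ)‖ = 1 := by
    have := Complex.normSq_eq_norm_sq (Real.sin θ + Real.cos θ * Complex.I)
    rw [Complex.normSq_add_mul_I, Real.sin_sq_add_cos_sq] at this
    nlinarith [norm_nonneg (Real.sin θ + Real.cos θ * Complex.I : ℂ)]
  rw [ray, add_sub_cancel_left, norm_mul, norm_mul, h, P.norm_dir, Complex.norm_real]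
  simp

lemma ray_eq_of_hit {i j : Fin d} {s θ T σ : ℝ} (h : P.ray i s θ T = P.sidePoint j σ) (t : ℝ) :
    P.ray i s θ t = P.sidePoint j σ +
      (-(T - t) * (Real.sin θ + Real.cos θ * Complex.I) * P.relDir j i) * P.dir j := by
  have hi : P.relDir j i * P.dir j = P.dir i := by
    rw [relDir, mul_comm (starRingEnd ℂ _), mul_assoc, P.conj_dir_mul_dir, mul_one]
  rw [← h, ray, ray, mul_assoc _ _ (P.dir j), hi]; push_cast; ring

/-- The height above the line of the side that is hit is linear in the remaining time T - t. Its
sign just before the collision yields transversality, and conversely shows that the end of a nearby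
transversal flight is inside. -/
lemma frame_ray_im_of_hit {i j : Fin d} {s θ T σ : ℝ} (h : P.ray i s θ T = P.sidePoint j σ)
    (t : ℝ) : (P.frame j (P.ray i s θ t)).im =
      (T - t) * -((P.relDir i j).re * Real.cos θ - (P.relDir i j).im * Real.sin θ) := by
  rw [P.ray_eq_of_hit h t, P.frame_sidePoint_add, relDir_symm]
  simp [-Complex.ofReal_sin, -Complex.ofReal_cos]
  ring

lemma cos_pos_of_mem {θ : ℝ} (h : θ ∈ Ioo (-(Real.pi / 2)) (Real.pi / 2)) : 0 < Real.cos θ :=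
  Real.cos_pos_of_mem_Ioo h

lemma exists_ray_mem_domain {i : Fin d} {s : ℝ} (hs : s ∈ P.openSide i) :
    ∃ r > 0, ∀ s', |s' - s| < r → ∀ θ ∈ Ioo (-(Real.pi / 2)) (Real.pi / 2), ∀ t ∈ Ioo 0 r,
      P.ray i s' θ t ∈ P.domain := by
  obtain ⟨r, hr, h⟩ := P.exists_ball_mem_domain_iff hs
  refine ⟨r / 2, by linarith, fun s' hs' θ hθ t ht => ?_⟩
  refine (h _ ?_).2 ?_
  · calc ‖P.ray i s' θ t - P.sidePoint i s‖
        ≤ ‖P.ray i s' θ t - P.sidePoint i s'‖ + ‖P.sidePoint i s' - P.sidePoint i s‖ :=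
          norm_sub_le_norm_sub_add_norm_sub _ _ _
      _ < r / 2 + r / 2 := by
          refine add_lt_add ?_ ?_
          · rw [norm_ray_sub, abs_of_pos ht.1]; exact ht.2
          · rwa [← P.norm_frame_sub i, P.frame_sidePoint, P.frame_sidePoint, ← Complex.ofReal_sub,
              Complex.norm_real, Real.norm_eq_abs]
      _ = r := by ring
  · rw [frame_ray_im]; exact mul_pos ht.1 (cos_pos_of_mem hθ)

lemma exists_first_hit {i : Fin d} {s θ : ℝ} (hs : s ∈ P.openSide i)
    (hθ : θ ∈ Ioo (-(Real.pi / 2)) (Real.pi / 2)) :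
    ∃ t > 0, P.ray i s θ t ∈ frontier P.domain ∧ ∀ t' ∈ Ioo 0 t, P.ray i s θ t' ∈ P.domain := by
  obtain ⟨r, hr, hstart⟩ := P.exists_ray_mem_domain hs
  replace hstart := hstart s (by simpa using hr) θ hθ
  have hcont : Continuous (P.ray i s θ) :=
    (P.continuous_ray i).comp (by fun_prop : Continuous fun t : ℝ => (s, θ, t))
  -- The bound r / 2 removes t = 0, where the ray is on the boundary, and keeps S closed. No
  -- positive collision time is lost, since the ray is inside for 0 < t < r.
  set S : Set ℝ := {t | r / 2 ≤ t ∧ P.ray i s θ t ∈ frontier P.domain} with hS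
  have hSc : IsClosed S := isClosed_Ici.inter (isClosed_frontier.preimage hcont)
  have hsmall : ∀ t, 0 < t → P.ray i s θ t ∈ frontier P.domain → t ∈ S := by
    intro t ht hf
    refine ⟨?_, hf⟩
    by_contra hc
    exact P.notMem_domain_of_mem_frontier hf (hstart t ⟨ht, by linarith [not_le.1 hc]⟩)
  have hSb : BddBelow S := ⟨r / 2, fun t ht => ht.1⟩
  have hmid : P.ray i s θ (r / 2) ∈ P.domain := hstart _ ⟨by linarith, by linarith⟩
  have hSn : S.Nonempty := by
    by_contra hne
    rw [not_nonempty_iff_eq_empty] at hne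
    have hsub : P.ray i s θ '' Ioi 0 ⊆ P.domain := by
      refine P.subset_domain_of_isPreconnected (isPreconnected_Ioi.image _ hcont.continuousOn) ?_
        (q := P.ray i s θ (r / 2)) ⟨r / 2, mem_Ioi.2 (by linarith), rfl⟩ hmid
      rintro _ ⟨t, ht, rfl⟩ hf
      have := hsmall t ht hf
      rw [hne] at this; exact this
    obtain ⟨R, hR⟩ := P.isBounded_domain.exists_norm_le
    have h1 := hR _ (hsub ⟨|R| + ‖P.sidePoint i s‖ + 1, by
      rw [mem_Ioi]; positivity, rfl⟩)
    have h2 := P.norm_ray_sub i s θ (|R| + ‖P.sidePoint i s‖ + 1)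
    have h3 := norm_sub_le (P.ray i s θ (|R| + ‖P.sidePoint i s‖ + 1)) (P.sidePoint i s)
    rw [h2, abs_of_nonneg (by positivity)] at h3
    linarith [le_abs_self R]
  have hmem := hSc.csInf_mem hSn hSb
  have hpos : 0 < sInf S := lt_of_lt_of_le (by linarith) hmem.1
  refine ⟨sInf S, hpos, hmem.2, fun t' ht' => ?_⟩
  have hlt : r / 2 < sInf S := by
    refine lt_of_le_of_ne hmem.1 fun h => ?_
    have := hmem.2
    rw [← h] at this
    exact P.notMem_domain_of_mem_frontier this hmid
  refine P.subset_domain_of_isPreconnected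
    (isPreconnected_Ioo (a := 0) (b := sInf S) |>.image _ hcont.continuousOn) ?_
      ⟨r / 2, ⟨by linarith, hlt⟩, rfl⟩ hmid ⟨t', ht', rfl⟩
  rintro _ ⟨t, ht, rfl⟩ hf
  exact absurd (csInf_le hSb (hsmall t ht.1 hf)) (not_le.2 ht.2)

lemma hitsSide_or_hitsVertex {i : Fin d} {s θ : ℝ} (hs : s ∈ P.openSide i)
    (hθ : θ ∈ Ioo (-(Real.pi / 2)) (Real.pi / 2)) :
    (∃ j s', P.HitsSide i s θ j s') ∨ ∃ w, P.HitsVertex i s θ w := by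
  obtain ⟨t, ht, hf, hd⟩ := P.exists_first_hit hs hθ
  rcases P.mem_frontier_cases hf with h | ⟨j, s', hs', h⟩
  · exact Or.inr ⟨_, h, t, ht, rfl, hd⟩
  · exact Or.inl ⟨j, s', hs, hθ, hs', t, ht, h, hd⟩

lemma hasDerivAt_bdry {i : Fin d} {s : ℝ} (hs : s ∈ P.openSide i) :
    HasDerivAt P.bdry (P.dir i) s := by
  have h : HasDerivAt (P.sidePoint i) (P.dir i) s := by
    unfold sidePoint
    have h1 : HasDerivAt (fun s : ℝ => ((s - P.corner i.castSucc : ℝ) : ℂ)) 1 s := by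
      exact ((hasDerivAt_id s).sub_const _).ofReal_comp
    simpa using (h1.mul_const (P.dir i)).const_add (P.bdry (P.corner i.castSucc))
  refine h.congr_of_eventuallyEq ?_
  filter_upwards [isOpen_Ioo.mem_nhds hs] with x hx
  exact P.bdry_eq_of_mem_openSide hx

lemma deriv_bdry {i : Fin d} {s : ℝ} (hs : s ∈ P.openSide i) : deriv P.bdry s = P.dir i :=
  (P.hasDerivAt_bdry hs).deriv

lemma bdry_add_velocity {i : Fin d} {s : ℝ} (hs : s ∈ P.openSide i) (θ t : ℝ) :
    P.bdry s + t * P.velocity (s, θ) = P.ray i s θ t := by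
  simp only [velocity, P.deriv_bdry hs, P.bdry_eq_of_mem_openSide hs, ray]; ring

lemma hitPoint_eq {i : Fin d} {s θ t : ℝ} (hs : s ∈ P.openSide i) (ht : 0 < t)
    (hf : P.ray i s θ t ∈ frontier P.domain) (hd : ∀ t' ∈ Ioo 0 t, P.ray i s θ t' ∈ P.domain) :
    P.hitPoint (s, θ) = P.ray i s θ t := by
  have hT : P.flightTime (s, θ) = t := by
    refine IsLeast.csInf_eq ⟨⟨ht, ?_⟩, ?_⟩
    · rw [P.bdry_add_velocity hs]; exact hf
    · rintro t' ⟨h1, h2⟩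
      rw [P.bdry_add_velocity hs] at h2
      by_contra hc
      exact P.notMem_domain_of_mem_frontier h2 (hd t' ⟨h1, not_le.1 hc⟩)
  rw [hitPoint, hT, P.bdry_add_velocity hs]

variable {P}

lemma HitsVertex.hitPoint_eq {i : Fin d} {s θ : ℝ} {w : ℂ} (h : P.HitsVertex i s θ w)
    (hs : s ∈ P.openSide i) : P.hitPoint (s, θ) = w := by
  obtain ⟨hw, t, ht, rfl, hd⟩ := h
  exact P.hitPoint_eq hs ht (P.vertices_subset_frontier hw) hd

lemma HitsSide.hitPoint_eq {i j : Fin d} {s θ s' : ℝ} (h : P.HitsSide i s θ j s') :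
    P.hitPoint (s, θ) = P.sidePoint j s' := by
  obtain ⟨hs, -, hs', t, ht, he, hd⟩ := h
  rw [← he]
  refine P.hitPoint_eq hs ht ?_ hd
  rw [he]; exact P.sidePoint_mem_frontier (Ioo_subset_Icc_self hs')

lemma HitsVertex.mem_singularSet {i : Fin d} {s θ : ℝ} {w : ℂ} (h : P.HitsVertex i s θ w)
    (hs : s ∈ P.openSide i) (hθ : θ ∈ Ioo (-(Real.pi / 2)) (Real.pi / 2)) :
    (s, θ) ∈ P.singularSet :=
  Or.inl (Or.inr ⟨P.bdry_notMem_vertices hs, hθ, by rw [h.hitPoint_eq hs]; exact h.1⟩)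

lemma HitsSide.notMem_singularSet {i j : Fin d} {s θ s' : ℝ} (h : P.HitsSide i s θ j s') :
    (s, θ) ∉ P.singularSet := by
  rintro ((h1 | h1) | h1)
  · exact P.bdry_notMem_vertices h.1 h1.1
  · have := h1.2.2
    rw [h.hitPoint_eq] at this
    exact P.sidePoint_notMem_vertices h.2.2.1 this
  · rcases h1 with h1 | h1
    · exact h.2.1.1.ne' h1
    · exact h.2.1.2.ne h1

lemma HitsSide.hitParam_eq {i j : Fin d} {s θ s' : ℝ} (h : P.HitsSide i s θ j s') :
    P.hitParam (s, θ) = s' := by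
  rw [hitParam, h.hitPoint_eq, ← P.bdry_eq_of_mem_openSide h.2.2.1]
  exact P.bdry_injOn.leftInvOn_invFunOn (P.openSide_subset_Ico j h.2.2.1)

lemma HitsSide.specularMap_eq {i j : Fin d} {s θ s' : ℝ} (h : P.HitsSide i s θ j s') :
    P.specularMap (s, θ) = (s', P.outAngle i j θ) := by
  rw [specularMap, h.hitParam_eq, P.deriv_bdry h.2.2.1, velocity, P.deriv_bdry h.1, outAngle]
  congr 2
  rw [Complex.inner]
  have : P.dir j * (starRingEnd ℂ) ((↑(Real.sin θ) + ↑(Real.cos θ) * Complex.I) * P.dir i) =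
      (↑(Real.sin θ) - ↑(Real.cos θ) * Complex.I) * P.relDir i j := by
    rw [relDir, map_mul, map_add, map_mul, Complex.conj_I, Complex.conj_ofReal,
      Complex.conj_ofReal]
    ring
  simp only [this]
  simp [-Complex.ofReal_sin, -Complex.ofReal_cos]
  ring

lemma HitsSide.billiardMap_eq {i j : Fin d} {s θ s' : ℝ} (h : P.HitsSide i s θ j s')
    (f : ℝ → ℝ) : P.billiardMap f (s, θ) = (s', f (P.outAngle i j θ)) := by
  rw [billiardMap, h.specularMap_eq]

lemma HitsSide.unique {i j k : Fin d} {s θ s' s'' : ℝ} (h : P.HitsSide i s θ j s')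
    (h' : P.HitsSide i s θ k s'') : j = k ∧ s' = s'' :=
  P.sidePoint_unique h.2.2.1 h'.2.2.1 (h.hitPoint_eq.symm.trans h'.hitPoint_eq)

/-- A flight arrives at the left of the side that it hits, and transversally. -/
lemma HitsSide.transversal {i j : Fin d} {s θ s' : ℝ} (h : P.HitsSide i s θ j s') :
    (P.relDir i j).re * Real.cos θ - (P.relDir i j).im * Real.sin θ < 0 := by
  obtain ⟨hs, hθ, hs', t, ht, he, hd⟩ := h
  obtain ⟨r, hr, hdom⟩ := P.exists_ball_mem_domain_iff hs'
  set u := min (r / 2) (t / 2)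
  have hu : 0 < u := lt_min (by linarith) (by linarith)
  have hur : u < r := (min_le_left _ _).trans_lt (by linarith)
  have hut : u < t := (min_le_right _ _).trans_lt (by linarith)
  have h1 := hd (t - u) ⟨by linarith, by linarith⟩
  rw [hdom, P.frame_ray_im_of_hit he] at h1
  · nlinarith
  · rw [← he, ray, ray]
    have h2 := P.norm_ray_sub i s θ (-u)
    rw [ray, add_sub_cancel_left] at h2
    rw [add_sub_add_left_eq_sub, ← sub_mul, ← sub_mul]
    push_cast at h2 ⊢
    rw [sub_sub_cancel_left, h2, abs_neg, abs_of_pos hu]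
    exact hur

end PolygonalTable

/-! ### Coordinates, stability and reversal of flights -/

namespace PolygonalTable

variable {d : ℕ} (P : PolygonalTable d)

variable {P}

lemma tan_mul_cos' {θ : ℝ} (hθ : θ ∈ Ioo (-(Real.pi / 2)) (Real.pi / 2)) :
    Real.tan θ * Real.cos θ = Real.sin θ :=
  Real.tan_mul_cos (Real.cos_pos_of_mem_Ioo hθ).ne'

/-- Transversality divided by cos θ. At a fixed angle the slope is ds/ds', so its sign says that
collisions reverse the order of the parameters, which is why ε turns into -ε at each collision
below. -/
lemma HitsSide.slope_neg {i j : Fin d} {s θ s' : ℝ} (h : P.HitsSide i s θ j s') :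
    (P.relDir i j).re - (P.relDir i j).im * Real.tan θ < 0 := by
  have h1 := h.transversal
  have hc := Real.cos_pos_of_mem_Ioo h.2.1
  rw [← tan_mul_cos' h.2.1] at h1
  by_contra hc'
  nlinarith [mul_nonneg (not_lt.1 hc') hc.le]

lemma HitsSide.height_pos {i j : Fin d} {s θ s' : ℝ} (h : P.HitsSide i s θ j s') :
    0 < (P.relBase i j).im + s' * (P.relDir i j).im := by
  obtain ⟨hs, hθ, hs', t, ht, he, hd⟩ := h
  rw [← P.frame_sidePoint_im, ← he, frame_ray_im]
  exact mul_pos ht (Real.cos_pos_of_mem_Ioo hθ)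

/-- The point that is hit is projected back along the flight to the line of the side i. The equation
is affine in s', and `hitCoord` is its solution. -/
lemma HitsSide.base_eq {i j : Fin d} {s θ s' : ℝ} (h : P.HitsSide i s θ j s') :
    s = (P.relBase i j).re + s' * (P.relDir i j).re -
      ((P.relBase i j).im + s' * (P.relDir i j).im) * Real.tan θ := by
  obtain ⟨hs, hθ, hs', t, ht, he, hd⟩ := h
  rw [← P.frame_sidePoint_im, ← P.frame_sidePoint_re, ← he, frame_ray_im, frame_ray_re,
    ← tan_mul_cos' hθ]
  ring

lemma HitsSide.eq_hitCoord {i j : Fin d} {s θ s' : ℝ} (h : P.HitsSide i s θ j s') :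
    s' = P.hitCoord i j s θ := by
  rw [hitCoord, eq_div_iff h.slope_neg.ne]
  linarith [h.base_eq]

lemma HitsVertex.base_eq {i : Fin d} {s θ : ℝ} {w : ℂ} (h : P.HitsVertex i s θ w)
    (hθ : θ ∈ Ioo (-(Real.pi / 2)) (Real.pi / 2)) :
    0 < (P.frame i w).im ∧ s = (P.frame i w).re - (P.frame i w).im * Real.tan θ := by
  obtain ⟨hw, t, ht, rfl, hd⟩ := h
  rw [frame_ray_im, frame_ray_re, ← tan_mul_cos' hθ]
  exact ⟨mul_pos ht (Real.cos_pos_of_mem_Ioo hθ), by ring⟩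

variable (P) in
lemma cos_outAngle {i j : Fin d} {θ : ℝ}
    (h : (P.relDir i j).re * Real.cos θ - (P.relDir i j).im * Real.sin θ < 0) :
    Real.cos (P.outAngle i j θ) =
      -((P.relDir i j).re * Real.cos θ - (P.relDir i j).im * Real.sin θ) := by
  rw [outAngle, Real.cos_arcsin, Real.sqrt_eq_iff_mul_self_eq_of_pos (by linarith)]
  have h1 := P.relDir_sq i j
  have h2 := Real.sin_sq_add_cos_sq θ
  linear_combination h1 + ((P.relDir i j).re ^ 2 + (P.relDir i j).im ^ 2) * (h2)

variable (P) in
lemma sin_outAngle (i j : Fin d) (θ : ℝ) :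
    Real.sin (P.outAngle i j θ) =
      (P.relDir i j).re * Real.sin θ + (P.relDir i j).im * Real.cos θ := by
  have h1 := P.relDir_sq i j
  have h2 := Real.sin_sq_add_cos_sq θ
  have h3 : ((P.relDir i j).re * Real.sin θ + (P.relDir i j).im * Real.cos θ) ^ 2 +
    ((P.relDir i j).re * Real.cos θ - (P.relDir i j).im * Real.sin θ) ^ 2 = 1 := by
    linear_combination h1 + ((P.relDir i j).re ^ 2 + (P.relDir i j).im ^ 2) * h2
  rw [outAngle, Real.sin_arcsin] <;> nlinarith

variable (P) in
lemma outAngle_mem {i j : Fin d} {θ : ℝ}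
    (h : (P.relDir i j).re * Real.cos θ - (P.relDir i j).im * Real.sin θ < 0) :
    P.outAngle i j θ ∈ Ioo (-(Real.pi / 2)) (Real.pi / 2) := by
  have h1 := P.cos_outAngle h
  have h3 := Real.arcsin_mem_Icc
    ((P.relDir i j).re * Real.sin θ + (P.relDir i j).im * Real.cos θ)
  rw [← outAngle] at h3
  refine ⟨lt_of_le_of_ne h3.1 fun h => ?_, lt_of_le_of_ne h3.2 fun h => ?_⟩
  · rw [← h, Real.cos_neg, Real.cos_pi_div_two] at h1; linarith
  · rw [h, Real.cos_pi_div_two] at h1; linarith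

lemma HitsSide.cos_outAngle {i j : Fin d} {s θ s' : ℝ} (h : P.HitsSide i s θ j s') :
    Real.cos (P.outAngle i j θ) =
      -((P.relDir i j).re * Real.cos θ - (P.relDir i j).im * Real.sin θ) :=
  P.cos_outAngle h.transversal

lemma HitsSide.outAngle_mem {i j : Fin d} {s θ s' : ℝ} (h : P.HitsSide i s θ j s') :
    P.outAngle i j θ ∈ Ioo (-(Real.pi / 2)) (Real.pi / 2) :=
  P.outAngle_mem h.transversal

variable (P)

/-- An intersection of lines only: no flight is assumed. Thus `hitCoord` is available when the
flight does not reach the side j, as can happen for the reference vectors below. -/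
lemma ray_eq_sidePoint_hitCoord {i j : Fin d} {s θ : ℝ}
    (hθ : θ ∈ Ioo (-(Real.pi / 2)) (Real.pi / 2))
    (hA : (P.relDir i j).re - (P.relDir i j).im * Real.tan θ ≠ 0) :
    P.ray i s θ (((P.relBase i j).im + P.hitCoord i j s θ * (P.relDir i j).im) / Real.cos θ) =
      P.sidePoint j (P.hitCoord i j s θ) := by
  have hc := (Real.cos_pos_of_mem_Ioo hθ).ne'
  have h1 : P.hitCoord i j s θ * ((P.relDir i j).re - (P.relDir i j).im * Real.tan θ) =
      s - (P.relBase i j).re + (P.relBase i j).im * Real.tan θ := by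
    rw [hitCoord, div_mul_cancel₀ _ hA]
  apply P.frame_injective i
  apply Complex.ext
  · rw [frame_ray_re, frame_sidePoint_re, ← tan_mul_cos' hθ]
    field_simp
    linarith
  · rw [frame_ray_im, frame_sidePoint_im]
    field_simp

variable {P}

lemma continuousAt_hitCoord {i j : Fin d} {x : ℝ × ℝ}
    (hθ : x.2 ∈ Ioo (-(Real.pi / 2)) (Real.pi / 2))
    (hA : (P.relDir i j).re - (P.relDir i j).im * Real.tan x.2 ≠ 0) :
    ContinuousAt (fun x : ℝ × ℝ => P.hitCoord i j x.1 x.2) x := by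
  have ht : ContinuousAt (fun x : ℝ × ℝ => Real.tan x.2) x :=
    ContinuousAt.comp (g := Real.tan)
      (Real.continuousAt_tan.2 (Real.cos_pos_of_mem_Ioo hθ).ne') continuousAt_snd
  unfold hitCoord
  exact ((continuousAt_fst.sub continuousAt_const).add (continuousAt_const.mul ht)).div
    (continuousAt_const.sub (continuousAt_const.mul ht)) hA

/-- The side that is hit is locally constant. -/
lemma HitsSide.eventually {i j : Fin d} {s θ s' : ℝ} (h : P.HitsSide i s θ j s') :
    ∀ᶠ x : ℝ × ℝ in 𝓝 (s, θ), P.HitsSide i x.1 x.2 j (P.hitCoord i j x.1 x.2) := by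
  have hA := h.slope_neg
  have hs'e := h.eq_hitCoord
  have hB := h.transversal
  obtain ⟨hs, hθ, hs', t, ht, he, hd⟩ := h
  have hc := Real.cos_pos_of_mem_Ioo hθ
  have hσ := continuousAt_hitCoord (x := (s, θ)) hθ hA.ne
  set T : ℝ × ℝ → ℝ := fun x =>
    ((P.relBase i j).im + P.hitCoord i j x.1 x.2 * (P.relDir i j).im) / Real.cos x.2 with hT
  have hTc : ContinuousAt T (s, θ) :=
    (continuousAt_const.add (hσ.mul continuousAt_const)).div (by fun_prop) hc.ne'
  have hTt : T (s, θ) = t := by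
    have h1 := P.frame_ray_im i s θ t
    rw [he, frame_sidePoint_im, hs'e] at h1
    simp only [hT]
    rw [h1]; field_simp
  obtain ⟨r₁, hr₁, hstart⟩ := P.exists_ray_mem_domain hs
  obtain ⟨r₂, hr₂, hend⟩ := P.exists_ball_mem_domain_iff hs'
  have hrc := P.continuous_ray i
  have hrc' : Continuous fun z : (ℝ × ℝ) × ℝ => P.ray i z.1.1 z.1.2 z.2 :=
    hrc.comp (by fun_prop : Continuous fun z : (ℝ × ℝ) × ℝ => (z.1.1, z.1.2, z.2))
  have evend : ∀ᶠ z : (ℝ × ℝ) × ℝ in 𝓝 ((s, θ), t),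
      ‖P.ray i z.1.1 z.1.2 z.2 - P.sidePoint j s'‖ < r₂ := by
    refine (isOpen_lt (hrc'.sub continuous_const).norm continuous_const).mem_nhds ?_
    simp [he, hr₂]
  rw [nhds_prod_eq, eventually_prod_iff] at evend
  obtain ⟨p, hp, q, hq, hpq⟩ := evend
  obtain ⟨r₃, hr₃, hqb⟩ := Metric.eventually_nhds_iff.1 hq
  -- A nearby flight is cut in three: the start is inside by the half plane at the side i, the end
  -- by the half plane at the side j, and the compact middle part by openness of the domain.
  have evmid : ∀ᶠ x : ℝ × ℝ in 𝓝 (s, θ), ∀ u ∈ Icc (r₁ / 2) (t - r₃ / 2),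
      P.ray i x.1 x.2 u ∈ P.domain := by
    refine isCompact_Icc.eventually_forall_of_forall_eventually fun u hu => ?_
    refine (hrc'.continuousAt (x := ((s, θ), u))).eventually (P.isOpen_domain.mem_nhds ?_)
    exact hd u ⟨by linarith [hu.1], by linarith [hu.2]⟩
  have ev1 : ∀ᶠ x : ℝ × ℝ in 𝓝 (s, θ), x.1 ∈ P.openSide i :=
    continuousAt_fst.eventually (isOpen_Ioo.mem_nhds hs)
  have ev2 : ∀ᶠ x : ℝ × ℝ in 𝓝 (s, θ), x.2 ∈ Ioo (-(Real.pi / 2)) (Real.pi / 2) :=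
    continuousAt_snd.eventually (isOpen_Ioo.mem_nhds hθ)
  have ev3 : ∀ᶠ x : ℝ × ℝ in 𝓝 (s, θ), P.hitCoord i j x.1 x.2 ∈ P.openSide j :=
    hσ.eventually (isOpen_Ioo.mem_nhds (by simp only [← hs'e]; exact hs'))
  have ev4 : ∀ᶠ x : ℝ × ℝ in 𝓝 (s, θ), T x ∈ Ioo 0 (t + r₃) :=
    hTc.eventually (isOpen_Ioo.mem_nhds (by rw [hTt]; exact ⟨ht, by linarith⟩))
  have ev5 : ∀ᶠ x : ℝ × ℝ in 𝓝 (s, θ), |x.1 - s| < r₁ :=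
    continuousAt_fst.eventually (p := fun y => |y - s| < r₁)
      ((isOpen_lt (by fun_prop) continuous_const).mem_nhds (by simpa using hr₁))
  have ev6 : ∀ᶠ x : ℝ × ℝ in 𝓝 (s, θ),
      (P.relDir i j).re * Real.cos x.2 - (P.relDir i j).im * Real.sin x.2 < 0 :=
    (isOpen_lt (by fun_prop) continuous_const).mem_nhds hB
  filter_upwards [hp, evmid, ev1, ev2, ev3, ev4, ev5, ev6] with x h1 h2 h3 h4 h5 h6 h7 h8
  have hc' := Real.cos_pos_of_mem_Ioo h4
  have hA' : (P.relDir i j).re - (P.relDir i j).im * Real.tan x.2 ≠ 0 := by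
    intro h0
    rw [← tan_mul_cos' h4] at h8
    have : ((P.relDir i j).re - (P.relDir i j).im * Real.tan x.2) * Real.cos x.2 < 0 := by
      linarith
    rw [h0, zero_mul] at this
    exact lt_irrefl _ this
  have hray : P.ray i x.1 x.2 (T x) = P.sidePoint j (P.hitCoord i j x.1 x.2) :=
    P.ray_eq_sidePoint_hitCoord h4 hA'
  refine ⟨h3, h4, h5, T x, h6.1, hray, fun u hu => ?_⟩
  rcases lt_or_ge u r₁ with hu1 | hu1
  · exact hstart x.1 h7 x.2 h4 u ⟨hu.1, hu1⟩
  rcases le_or_gt u (t - r₃ / 2) with hu2 | hu2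
  · exact h2 u ⟨by linarith, hu2⟩
  · have hqu : q u := hqb (by
      rw [Real.dist_eq, abs_lt]; exact ⟨by linarith, by linarith [hu.2, h6.2]⟩)
    refine (hend _ (hpq h1 hqu)).2 ?_
    rw [P.frame_ray_im_of_hit hray]
    exact mul_pos (by linarith [hu.2]) (by linarith)

/-- On a connected set of vectors none of which hits a vertex, the side that is hit is constant. -/
lemma HitsSide.of_isPreconnected {i j : Fin d} {U : Set (ℝ × ℝ)} (hU : IsPreconnected U)
    (hside : ∀ x ∈ U, x.1 ∈ P.openSide i) (hang : ∀ x ∈ U, x.2 ∈ Ioo (-(Real.pi / 2)) (Real.pi / 2))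
    (hv : ∀ x ∈ U, ∀ w, ¬ P.HitsVertex i x.1 x.2 w) {x y : ℝ × ℝ} (hx : x ∈ U) (hy : y ∈ U)
    {s' : ℝ} (h : P.HitsSide i x.1 x.2 j s') :
    P.HitsSide i y.1 y.2 j (P.hitCoord i j y.1 y.2) := by
  have hex : ∀ x ∈ U, ∃ k, P.HitsSide i x.1 x.2 k (P.hitCoord i k x.1 x.2) := by
    intro x hx
    rcases P.hitsSide_or_hitsVertex (hside x hx) (hang x hx) with ⟨k, s'', h⟩ | ⟨w, h⟩
    · exact ⟨k, by rw [← h.eq_hitCoord]; exact h⟩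
    · exact absurd h (hv x hx w)
  rw [h.eq_hitCoord] at h
  have := hU.induction₂ (fun x y => P.HitsSide i x.1 x.2 j (P.hitCoord i j x.1 x.2) ↔
    P.HitsSide i y.1 y.2 j (P.hitCoord i j y.1 y.2)) ?_ (fun _ _ _ _ _ _ h1 h2 => h1.trans h2)
      (fun _ _ _ _ h => h.symm) hx hy
  · exact this.1 h
  · intro z hz
    obtain ⟨k, hk⟩ := hex z hz
    refine Filter.Eventually.filter_mono nhdsWithin_le_nhds ?_
    filter_upwards [hk.eventually] with y hy
    constructor
    · intro h'; rw [(h'.unique hk).1]; exact hy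
    · intro h'; rw [(h'.unique hy).1]; exact hk

/-- Flights are reversible. -/
lemma HitsSide.reverse {i j : Fin d} {s θ s' : ℝ} (h : P.HitsSide i s θ j s') :
    P.HitsSide j s' (-P.outAngle i j θ) i s := by
  have h1 := P.sin_outAngle i j θ
  have h2 := h.cos_outAngle
  have h3 := h.outAngle_mem
  obtain ⟨hs, hθ, hs', t, ht, he, hd⟩ := h
  have key : ∀ u : ℝ, P.ray j s' (-P.outAngle i j θ) u = P.ray i s θ (t - u) := by
    intro u
    rw [P.ray_eq_of_hit he, ray, Real.sin_neg, Real.cos_neg, h1, h2, relDir_symm]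
    congr 2
    apply Complex.ext <;> simp [-Complex.ofReal_sin, -Complex.ofReal_cos] <;> ring
  refine ⟨hs', ⟨by linarith [h3.2], by linarith [h3.1]⟩, hs, t, ht, ?_, fun u hu => ?_⟩
  · rw [key, sub_self, ray]; simp
  · rw [key]; exact hd _ ⟨by linarith [hu.2], by linarith [hu.1]⟩

end PolygonalTable

namespace PolygonalTable

variable {d : ℕ} (P : PolygonalTable d)

end PolygonalTable

/-! ### Contracting reflection laws -/

namespace IsContractingLaw

variable {f : ℝ → ℝ}

lemma strictMonoOn (hf : IsContractingLaw f) :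
    StrictMonoOn f (Icc (-(Real.pi / 2)) (Real.pi / 2)) :=
  strictMonoOn_of_deriv_pos (convex_Icc _ _) hf.contDiffOn.continuousOn fun x hx => by
    rw [interior_Icc] at hx; exact hf.deriv_pos x hx

lemma map_mem (hf : IsContractingLaw f) {θ : ℝ} (hθ : θ ∈ Ioo (-(Real.pi / 2)) (Real.pi / 2)) :
    f θ ∈ Ioo (-(Real.pi / 2)) (Real.pi / 2) := by
  have hπ := Real.pi_pos
  have hl : -(Real.pi / 2) ∈ Icc (-(Real.pi / 2)) (Real.pi / 2) := ⟨le_rfl, by linarith⟩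
  have hr : Real.pi / 2 ∈ Icc (-(Real.pi / 2)) (Real.pi / 2) := ⟨by linarith, le_rfl⟩
  exact ⟨(hf.mapsTo hl).1.trans_lt (hf.strictMonoOn hl (Ioo_subset_Icc_self hθ) hθ.1),
    (hf.strictMonoOn (Ioo_subset_Icc_self hθ) hr hθ.2).trans_le (hf.mapsTo hr).2⟩

lemma differentiableAt (hf : IsContractingLaw f) {θ : ℝ}
    (hθ : θ ∈ Ioo (-(Real.pi / 2)) (Real.pi / 2)) : DifferentiableAt ℝ f θ :=
  differentiableAt_of_deriv_ne_zero (hf.deriv_pos θ hθ).ne'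

lemma exists_contraction (hf : IsContractingLaw f) :
    ∃ l : ℝ, 0 ≤ l ∧ l < 1 ∧ ∀ θ ∈ Ioo (-(Real.pi / 2)) (Real.pi / 2), |f θ| ≤ l * |θ| := by
  have hπ := Real.pi_pos
  set I := Icc (-(Real.pi / 2)) (Real.pi / 2) with hI
  have huniq : UniqueDiffOn ℝ I := uniqueDiffOn_Icc (by linarith)
  have hc : ContinuousOn (fun θ => |derivWithin f I θ|) I :=
    (hf.contDiffOn.continuousOn_derivWithin huniq (by norm_num)).abs
  -- Without boundedness the supremum would say nothing about the derivative; it holds because f is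
  -- C² up to the end points.
  have hb : BddAbove ((fun θ => |deriv f θ|) '' Ioo (-(Real.pi / 2)) (Real.pi / 2)) := by
    obtain ⟨C, hC⟩ := isCompact_Icc.bddAbove_image hc
    refine ⟨C, ?_⟩
    rintro _ ⟨θ, hθ, rfl⟩
    have : derivWithin f I θ = deriv f θ := derivWithin_of_mem_nhds (Icc_mem_nhds hθ.1 hθ.2)
    simp only [← this]
    exact hC ⟨θ, Ioo_subset_Icc_self hθ, rfl⟩
  have h0 : (0 : ℝ) ∈ Ioo (-(Real.pi / 2)) (Real.pi / 2) := ⟨by linarith, by linarith⟩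
  refine ⟨_, (abs_nonneg (deriv f 0)).trans (le_csSup hb ⟨0, h0, rfl⟩), hf.contracting,
    fun θ hθ => ?_⟩
  have := (convex_Ioo (-(Real.pi / 2)) (Real.pi / 2)).norm_image_sub_le_of_norm_deriv_le
    (fun x hx => hf.differentiableAt hx) (fun x hx => le_csSup hb ⟨x, hx, rfl⟩) h0 hθ
  simpa [hf.map_zero] using this

end IsContractingLaw

/-! ### Vectors that diverge from a reference vector -/

namespace PolygonalTable

variable {d : ℕ} {P : PolygonalTable d}

/-- The vectors based on the `i`-th side that diverge from the one of base parameter `s₀` and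
angle `θ₀`, on the side given by the sign `ε`. -/
def diverging (P : PolygonalTable d) (i : Fin d) (s₀ θ₀ ε : ℝ) : Set (ℝ × ℝ) :=
  {x | x.1 ∈ P.openSide i ∧ 0 ≤ ε * (x.1 - s₀) ∧ 0 ≤ ε * (x.2 - θ₀) ∧
    0 < ε * (x.1 - s₀) + ε * (x.2 - θ₀)}

lemma convex_diverging (i : Fin d) (s₀ θ₀ ε : ℝ) : Convex ℝ (P.diverging i s₀ θ₀ ε) := by
  rintro ⟨s, θ⟩ ⟨h1, h2, h3, h4⟩ ⟨s', θ'⟩ ⟨h1', h2', h3', h4'⟩ a b ha hb hab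
  simp only at h1 h2 h3 h4 h1' h2' h3' h4'
  have e1 : ε * (a * s + b * s' - s₀) = a * (ε * (s - s₀)) + b * (ε * (s' - s₀)) := by
    linear_combination ε * s₀ * hab
  have e2 : ε * (a * θ + b * θ' - θ₀) = a * (ε * (θ - θ₀)) + b * (ε * (θ' - θ₀)) := by
    linear_combination ε * θ₀ * hab
  refine ⟨convex_Ioo _ _ h1 h1' ha hb hab, ?_, ?_, ?_⟩
  · simp only [Prod.smul_mk, Prod.mk_add_mk, smul_eq_mul]
    rw [e1]; positivity
  · simp only [Prod.smul_mk, Prod.mk_add_mk, smul_eq_mul]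
    rw [e2]; positivity
  · simp only [Prod.smul_mk, Prod.mk_add_mk, smul_eq_mul]
    rw [e1, e2]
    have e3 : a * (ε * (s - s₀)) + b * (ε * (s' - s₀)) + (a * (ε * (θ - θ₀)) + b * (ε * (θ' - θ₀)))
      = a * (ε * (s - s₀) + ε * (θ - θ₀)) + b * (ε * (s' - s₀) + ε * (θ' - θ₀)) := by ring
    rw [e3]
    rcases ha.eq_or_lt with h | h
    · subst h
      have : b = 1 := by linarith
      subst this; simpa using h4'
    · exact add_pos_of_pos_of_nonneg (mul_pos h h4) (mul_nonneg hb h4'.le)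

lemma sign_mul_tan_sub {θ θ₀ ε : ℝ} (hθ : θ ∈ Ioo (-(Real.pi / 2)) (Real.pi / 2))
    (hθ₀ : θ₀ ∈ Ioo (-(Real.pi / 2)) (Real.pi / 2)) (hε : ε = 1 ∨ ε = -1) :
    (0 < ε * (θ - θ₀) → 0 < ε * (Real.tan θ - Real.tan θ₀)) ∧
    (0 ≤ ε * (θ - θ₀) → 0 ≤ ε * (Real.tan θ - Real.tan θ₀)) := by
  have h1 := Real.strictMonoOn_tan.lt_iff_lt hθ hθ₀
  have h2 := Real.strictMonoOn_tan.lt_iff_lt hθ₀ hθ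
  have h3 := Real.strictMonoOn_tan.le_iff_le hθ hθ₀
  have h4 := Real.strictMonoOn_tan.le_iff_le hθ₀ hθ
  rcases hε with rfl | rfl
  · simp only [one_mul, sub_pos, sub_nonneg]; exact ⟨h2.2, h4.2⟩
  · simp only [neg_one_mul, neg_sub, sub_pos, sub_nonneg]; exact ⟨h1.2, h3.2⟩

lemma continuousAt_tan_snd {x : ℝ × ℝ} (hθ : x.2 ∈ Ioo (-(Real.pi / 2)) (Real.pi / 2)) :
    ContinuousAt (fun x : ℝ × ℝ => Real.tan x.2) x :=
  ContinuousAt.comp (g := Real.tan)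
    (Real.continuousAt_tan.2 (Real.cos_pos_of_mem_Ioo hθ).ne') continuousAt_snd

variable (P) in
/-- Diverging vectors do not hit vertices. -/
lemma eventually_not_hitsVertex_of_diverging (i : Fin d) (s₀ : ℝ) {θ₀ ε : ℝ}
    (hθ₀ : θ₀ ∈ Ioo (-(Real.pi / 2)) (Real.pi / 2)) (hε : ε = 1 ∨ ε = -1) :
    ∀ᶠ x : ℝ × ℝ in 𝓝 (s₀, θ₀), x.2 ∈ Ioo (-(Real.pi / 2)) (Real.pi / 2) ∧
      (x ∈ P.diverging i s₀ θ₀ ε → ∀ w, ¬ P.HitsVertex i x.1 x.2 w) := by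
  have ev1 : ∀ᶠ x : ℝ × ℝ in 𝓝 (s₀, θ₀), x.2 ∈ Ioo (-(Real.pi / 2)) (Real.pi / 2) :=
    continuousAt_snd.eventually (isOpen_Ioo.mem_nhds hθ₀)
  -- The quantity is the gap between the vertex w and the reference line, measured along the base
  -- side. Being finitely many, the positive gaps are bounded below, whereas a diverging vector that
  -- hits w forces a gap that is positive and tends to zero.
  have ev2 : ∀ᶠ x : ℝ × ℝ in 𝓝 (s₀, θ₀), ∀ w ∈ P.vertices,
      0 < ε * ((P.frame i w).re - (P.frame i w).im * Real.tan θ₀ - s₀) →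
      ε * (x.1 - s₀) + (P.frame i w).im * (ε * (Real.tan x.2 - Real.tan θ₀)) <
        ε * ((P.frame i w).re - (P.frame i w).im * Real.tan θ₀ - s₀) := by
    refine (eventually_all_finite P.finite_vertices).2 fun w _ => ?_
    by_cases hg : 0 < ε * ((P.frame i w).re - (P.frame i w).im * Real.tan θ₀ - s₀)
    · have hc : ContinuousAt (fun x : ℝ × ℝ => ε * (x.1 - s₀) +
          (P.frame i w).im * (ε * (Real.tan x.2 - Real.tan θ₀))) (s₀, θ₀) :=
        (continuousAt_const.mul (continuousAt_fst.sub continuousAt_const)).add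
          (continuousAt_const.mul (continuousAt_const.mul
            ((continuousAt_tan_snd hθ₀).sub continuousAt_const)))
      filter_upwards [hc.eventually_lt_const (u := ε * ((P.frame i w).re -
        (P.frame i w).im * Real.tan θ₀ - s₀)) (by simpa using hg)] with x hx _ using hx
    · exact Eventually.of_forall fun x h => absurd h hg
  filter_upwards [ev1, ev2] with x h1 h2
  refine ⟨h1, fun hx w hw => ?_⟩
  obtain ⟨hy, he⟩ := hw.base_eq h1
  obtain ⟨-, h3, h4, h5⟩ := hx
  have h6 := sign_mul_tan_sub h1 hθ₀ hε
  have key : ε * ((P.frame i w).re - (P.frame i w).im * Real.tan θ₀ - s₀) =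
      ε * (x.1 - s₀) + (P.frame i w).im * (ε * (Real.tan x.2 - Real.tan θ₀)) := by
    rw [he]; ring
  have hpos : 0 < ε * (x.1 - s₀) + (P.frame i w).im * (ε * (Real.tan x.2 - Real.tan θ₀)) := by
    rcases h4.eq_or_lt with h | h
    · have := mul_nonneg hy.le (h6.2 h4)
      rw [← h] at h5
      linarith
    · have := mul_pos hy (h6.1 h)
      linarith
  have := h2 w hw.1 (key ▸ hpos)
  linarith

/-- Specular reflection turns the outgoing vector opposite to the incoming one. The statement is
local so that the angle stays in the range of the arcsine. -/
lemma eventually_outAngle {i j : Fin d} {θ₀ : ℝ}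
    (h : (P.relDir i j).re * Real.cos θ₀ - (P.relDir i j).im * Real.sin θ₀ < 0) :
    ∀ᶠ θ in 𝓝 θ₀, P.outAngle i j θ = P.outAngle i j θ₀ - (θ - θ₀) := by
  have hc : ContinuousAt (fun θ => P.outAngle i j θ₀ - (θ - θ₀)) θ₀ := by fun_prop
  have h0 := P.outAngle_mem h
  filter_upwards [hc.eventually (isOpen_Ioo.mem_nhds (by simpa using h0))] with θ hθ
  rw [← Real.arcsin_sin hθ.1.le hθ.2.le, Real.sin_sub, P.sin_outAngle, P.cos_outAngle h,
    outAngle]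
  congr 1
  have h1 := Real.sin_add θ₀ (θ - θ₀)
  have h2 := Real.cos_add θ₀ (θ - θ₀)
  rw [add_sub_cancel] at h1 h2
  rw [h1, h2]; ring

/-- The displacement of the point that is hit. -/
lemma hitCoord_sub {i j : Fin d} {s θ s₀ θ₀ : ℝ}
    (h : (P.relDir i j).re - (P.relDir i j).im * Real.tan θ ≠ 0)
    (h₀ : (P.relDir i j).re - (P.relDir i j).im * Real.tan θ₀ ≠ 0) :
    (P.hitCoord i j s θ - P.hitCoord i j s₀ θ₀) *
        ((P.relDir i j).re - (P.relDir i j).im * Real.tan θ₀) =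
      (s - s₀) + ((P.relBase i j).im + P.hitCoord i j s θ * (P.relDir i j).im) *
        (Real.tan θ - Real.tan θ₀) := by
  have h1 : P.hitCoord i j s θ * ((P.relDir i j).re - (P.relDir i j).im * Real.tan θ) =
      s - (P.relBase i j).re + (P.relBase i j).im * Real.tan θ := by
    rw [hitCoord, div_mul_cancel₀ _ h]
  have h2 : P.hitCoord i j s₀ θ₀ * ((P.relDir i j).re - (P.relDir i j).im * Real.tan θ₀) =
      s₀ - (P.relBase i j).re + (P.relBase i j).im * Real.tan θ₀ := by
    rw [hitCoord, div_mul_cancel₀ _ h₀]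
  linear_combination h1 - h2

lemma slope_neg_iff {i j : Fin d} {θ : ℝ} (hθ : θ ∈ Ioo (-(Real.pi / 2)) (Real.pi / 2)) :
    (P.relDir i j).re - (P.relDir i j).im * Real.tan θ < 0 ↔
      (P.relDir i j).re * Real.cos θ - (P.relDir i j).im * Real.sin θ < 0 := by
  have hc := Real.cos_pos_of_mem_Ioo hθ
  have : (P.relDir i j).re * Real.cos θ - (P.relDir i j).im * Real.sin θ =
      ((P.relDir i j).re - (P.relDir i j).im * Real.tan θ) * Real.cos θ := by
    rw [← tan_mul_cos' hθ]; ring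
  rw [this, mul_neg_iff]
  constructor
  · intro h; exact Or.inr ⟨h, hc⟩
  · rintro (h | h)
    · linarith [h.2]
    · exact h.1

variable (P) in
/-- The first collision of the vectors diverging from a given one. -/
lemma eventually_hitsSide_of_diverging (i : Fin d) (s₀ : ℝ) {θ₀ ε : ℝ}
    (hθ₀ : θ₀ ∈ Ioo (-(Real.pi / 2)) (Real.pi / 2)) (hε : ε = 1 ∨ ε = -1) :
    (∀ᶠ x : ℝ × ℝ in 𝓝 (s₀, θ₀), x ∉ P.diverging i s₀ θ₀ ε) ∨
    ∃ j, (P.relDir i j).re - (P.relDir i j).im * Real.tan θ₀ < 0 ∧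
      (∀ᶠ x : ℝ × ℝ in 𝓝 (s₀, θ₀), x ∈ P.diverging i s₀ θ₀ ε →
        P.HitsSide i x.1 x.2 j (P.hitCoord i j x.1 x.2)) ∧
      ∃ s, 0 < ε * (s - s₀) ∧ P.HitsSide i s θ₀ j (P.hitCoord i j s θ₀) := by
  have ev := P.eventually_not_hitsVertex_of_diverging i s₀ hθ₀ hε
  obtain ⟨r, hr, hball⟩ := Metric.eventually_nhds_iff_ball.1 ev
  by_cases hne : ∀ᶠ x : ℝ × ℝ in 𝓝 (s₀, θ₀), x ∉ P.diverging i s₀ θ₀ ε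
  · exact Or.inl hne
  right
  have hne' : ∃ x ∈ Metric.ball (s₀, θ₀) r, x ∈ P.diverging i s₀ θ₀ ε := by
    by_contra hc
    push Not at hc
    exact hne (Metric.eventually_nhds_iff_ball.2 ⟨r, hr, hc⟩)
  obtain ⟨⟨s, θ⟩, hxb, hx⟩ := hne'
  obtain ⟨h1, h2, h3, h4⟩ := hx
  simp only at h1 h2 h3 h4
  rw [Metric.mem_ball, Prod.dist_eq, max_lt_iff] at hxb
  -- A base point for a diverging vector parallel to the reference. Its flight provides the slope at
  -- θ₀, and the convexity of the diverging set carries its side to all the others.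
  have hs' : ∃ s', s' ∈ P.openSide i ∧ 0 < ε * (s' - s₀) ∧ |s' - s₀| < r := by
    rcases h2.eq_or_lt with h | h
    · have hss : s = s₀ := by
        rcases hε with rfl | rfl <;> linarith
      subst hss
      have ev1 : ∀ᶠ u : ℝ in 𝓝[>] 0, s + ε * u ∈ P.openSide i := by
        have hc : ContinuousAt (fun u : ℝ => s + ε * u) 0 := by fun_prop
        exact (hc.eventually (isOpen_Ioo.mem_nhds (by
          simp only [mul_zero, add_zero]; exact h1))).filter_mono nhdsWithin_le_nhds
      obtain ⟨u, hu1, hu2⟩ := (ev1.and (Ioo_mem_nhdsGT hr)).exists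
      refine ⟨_, hu1, ?_, ?_⟩
      · have : ε * (s + ε * u - s) = ε ^ 2 * u := by ring
        rw [this]
        rcases hε with rfl | rfl <;> simpa using hu2.1
      · rw [add_sub_cancel_left, abs_mul, abs_of_pos hu2.1]
        rcases hε with rfl | rfl <;> simpa using hu2.2
    · exact ⟨s, h1, h, hxb.1⟩
  obtain ⟨s', h1', h2', h3'⟩ := hs'
  have hx' : (s', θ₀) ∈ P.diverging i s₀ θ₀ ε := by
    refine ⟨h1', h2'.le, by simp, by simpa using h2'⟩
  have hx'b : (s', θ₀) ∈ Metric.ball (s₀, θ₀) r := by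
    rw [Metric.mem_ball, Prod.dist_eq, max_lt_iff]
    simp only [dist_self]
    exact ⟨h3', hr⟩
  have hside : ∃ j, P.HitsSide i s' θ₀ j (P.hitCoord i j s' θ₀) := by
    rcases P.hitsSide_or_hitsVertex h1' hθ₀ with ⟨j, s'', h⟩ | ⟨w, h⟩
    · exact ⟨j, by rw [← h.eq_hitCoord]; exact h⟩
    · exact absurd h ((hball _ hx'b).2 hx' w)
  obtain ⟨j, hj⟩ := hside
  refine ⟨j, hj.slope_neg, ?_, s', h2', hj⟩
  filter_upwards [Metric.ball_mem_nhds _ hr] with x hxr hxd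
  have hconv : IsPreconnected (P.diverging i s₀ θ₀ ε ∩ Metric.ball (s₀, θ₀) r) :=
    ((convex_diverging i s₀ θ₀ ε).inter (convex_ball _ _)).isPreconnected
  exact HitsSide.of_isPreconnected hconv (fun x hx => hx.1.1) (fun x hx => (hball x hx.2).1)
    (fun x hx => (hball x hx.2).2 hx.1) ⟨hx', hx'b⟩ ⟨hxd, hxr⟩ hj

end PolygonalTable

/-! ### Diverging vectors meet no singularities -/

namespace PolygonalTable

variable {d : ℕ} (P : PolygonalTable d)

variable {P} {f : ℝ → ℝ}

lemma singularSetIter_zero (f : ℝ → ℝ) : P.singularSetIter f 0 = ∅ := by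
  simp [singularSetIter]

lemma mem_singularSetIter {n : ℕ} {x : ℝ × ℝ} :
    x ∈ P.singularSetIter f n ↔ ∃ k < n, (P.billiardMap f)^[k] x ∈ P.singularSet := by
  simp [singularSetIter]

lemma mem_singularSetIter_succ {n : ℕ} {x : ℝ × ℝ} :
    x ∈ P.singularSetIter f (n + 1) ↔
      x ∈ P.singularSet ∨ P.billiardMap f x ∈ P.singularSetIter f n := by
  simp only [mem_singularSetIter]
  constructor
  · rintro ⟨k, hk, h⟩
    rcases k with _ | k
    · exact Or.inl h
    · exact Or.inr ⟨k, by omega, by rwa [Function.iterate_succ_apply] at h⟩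
  · rintro (h | ⟨k, hk, h⟩)
    · exact ⟨0, by omega, h⟩
    · exact ⟨k + 1, by omega, by rwa [Function.iterate_succ_apply]⟩

lemma singularSetIter_mono {m n : ℕ} (h : m ≤ n) :
    P.singularSetIter f m ⊆ P.singularSetIter f n := fun x hx => by
  rw [mem_singularSetIter] at hx ⊢
  obtain ⟨k, hk, hx⟩ := hx
  exact ⟨k, hk.trans_le h, hx⟩

lemma exists_hitsSide_of_notMem {i : Fin d} {x : ℝ × ℝ} (hs : x.1 ∈ P.openSide i)
    (hθ : x.2 ∈ Ioo (-(Real.pi / 2)) (Real.pi / 2)) (h : x ∉ P.singularSet) :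
    ∃ j s', P.HitsSide i x.1 x.2 j s' := by
  rcases P.hitsSide_or_hitsVertex hs hθ with h' | ⟨w, h'⟩
  · exact h'
  · exact absurd (h'.mem_singularSet hs hθ) h

lemma continuousAt_next (hf : IsContractingLaw f) {i j : Fin d} (s₀ : ℝ) {θ₀ : ℝ}
    (hθ₀ : θ₀ ∈ Ioo (-(Real.pi / 2)) (Real.pi / 2))
    (h : (P.relDir i j).re - (P.relDir i j).im * Real.tan θ₀ < 0) :
    ContinuousAt (fun x : ℝ × ℝ => (P.hitCoord i j x.1 x.2, f (P.outAngle i j x.2)))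
      (s₀, θ₀) := by
  refine (continuousAt_hitCoord (x := (s₀, θ₀)) hθ₀ h.ne).prodMk ?_
  have h1 := P.outAngle_mem ((slope_neg_iff hθ₀).1 h)
  refine ContinuousAt.comp (g := f) (f := fun x : ℝ × ℝ => P.outAngle i j x.2)
    (hf.differentiableAt h1).continuousAt ?_
  unfold outAngle
  exact (Real.continuous_arcsin.comp (by fun_prop)).continuousAt

/-- Images that lie on the diverging side diverge. -/
lemma eventually_next_mem_diverging (hf : IsContractingLaw f) {i j : Fin d} (s₀ : ℝ) {θ₀ ε : ℝ}
    (hθ₀ : θ₀ ∈ Ioo (-(Real.pi / 2)) (Real.pi / 2)) (hε : ε = 1 ∨ ε = -1)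
    (h : (P.relDir i j).re - (P.relDir i j).im * Real.tan θ₀ < 0) :
    ∀ᶠ x : ℝ × ℝ in 𝓝 (s₀, θ₀), ∀ s', P.HitsSide i x.1 x.2 j s' → 0 ≤ ε * (x.2 - θ₀) →
      0 ≤ -ε * (s' - P.hitCoord i j s₀ θ₀) →
      0 < ε * (x.2 - θ₀) ∨ 0 < -ε * (s' - P.hitCoord i j s₀ θ₀) →
      (s', f (P.outAngle i j x.2)) ∈
        P.diverging j (P.hitCoord i j s₀ θ₀) (f (P.outAngle i j θ₀)) (-ε) := by
  have h' := (slope_neg_iff hθ₀).1 h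
  filter_upwards [continuousAt_snd.eventually (eventually_outAngle h')] with x hx s' hs' h1 h2 h3
  have hm := hf.strictMonoOn.lt_iff_lt (Ioo_subset_Icc_self hs'.outAngle_mem)
    (Ioo_subset_Icc_self (P.outAngle_mem h'))
  have hm' := hf.strictMonoOn.lt_iff_lt (Ioo_subset_Icc_self (P.outAngle_mem h'))
    (Ioo_subset_Icc_self hs'.outAngle_mem)
  have key : (0 < ε * (x.2 - θ₀) → 0 < -ε * (f (P.outAngle i j x.2) - f (P.outAngle i j θ₀))) := by
    intro h4
    rcases hε with rfl | rfl
    · have := hm.2 (by rw [hx]; linarith)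
      linarith
    · have := hm'.2 (by rw [hx]; linarith)
      linarith
  have key0 : ε * (x.2 - θ₀) = 0 → -ε * (f (P.outAngle i j x.2) - f (P.outAngle i j θ₀)) = 0 := by
    intro h4
    have : x.2 = θ₀ := by rcases hε with rfl | rfl <;> linarith
    rw [this]; ring
  refine ⟨hs'.2.2.1, h2, ?_, ?_⟩
  · rcases h1.eq_or_lt with h4 | h4
    · exact (key0 h4.symm).ge
    · exact (key h4).le
  · simp only
    rcases h1.eq_or_lt with h4 | h4
    · rw [key0 h4.symm, add_zero]
      exact h3.resolve_left (by rw [← h4]; exact lt_irrefl _)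
    · have := key h4
      linarith

lemma HitsSide.displacement {i j : Fin d} {s θ s' s₀ θ₀ : ℝ} (h : P.HitsSide i s θ j s')
    (h₀ : (P.relDir i j).re - (P.relDir i j).im * Real.tan θ₀ < 0) :
    (s' - P.hitCoord i j s₀ θ₀) * ((P.relDir i j).re - (P.relDir i j).im * Real.tan θ₀) =
      (s - s₀) + ((P.relBase i j).im + s' * (P.relDir i j).im) *
        (Real.tan θ - Real.tan θ₀) := by
  have := hitCoord_sub (P := P) (i := i) (j := j) (s := s) (s₀ := s₀) h.slope_neg.ne h₀.ne
  rwa [← h.eq_hitCoord] at this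

/-- Diverging vectors are not separated by the singularities. -/
lemma eventually_diverging_notMem (hf : IsContractingLaw f) (n : ℕ) :
    ∀ (i : Fin d) (s₀ : ℝ) {θ₀ ε : ℝ}, θ₀ ∈ Ioo (-(Real.pi / 2)) (Real.pi / 2) →
      (ε = 1 ∨ ε = -1) →
      ∀ᶠ x : ℝ × ℝ in 𝓝 (s₀, θ₀), x ∈ P.diverging i s₀ θ₀ ε → x ∉ P.singularSetIter f n := by
  induction n with
  | zero => intros; simp [singularSetIter_zero]
  | succ n ih =>
    intro i s₀ θ₀ ε hθ₀ hε
    rcases P.eventually_hitsSide_of_diverging i s₀ hθ₀ hε with h | ⟨j, hj, h, -⟩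
    · filter_upwards [h] with x hx hx' using absurd hx' hx
    have hθ₁ := hf.map_mem (P.outAngle_mem ((slope_neg_iff hθ₀).1 hj))
    have hε' : -ε = 1 ∨ -ε = -1 := by
      rcases hε with rfl | rfl
      · right; rfl
      · left; norm_num
    have ev1 := (continuousAt_next hf s₀ hθ₀ hj).eventually
      (ih j (P.hitCoord i j s₀ θ₀) hθ₁ hε')
    have ev2 : ∀ᶠ x : ℝ × ℝ in 𝓝 (s₀, θ₀), x.2 ∈ Ioo (-(Real.pi / 2)) (Real.pi / 2) :=
      continuousAt_snd.eventually (isOpen_Ioo.mem_nhds hθ₀)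
    filter_upwards [h, ev1, ev2, eventually_next_mem_diverging hf s₀ hθ₀ hε hj]
      with x h1 h2 h3 h4 hx hxN
    have hh := h1 hx
    rw [mem_singularSetIter_succ] at hxN
    rcases hxN with hxN | hxN
    · exact hh.notMem_singularSet hxN
    · have he : P.billiardMap f x = (P.hitCoord i j x.1 x.2, f (P.outAngle i j x.2)) :=
        hh.billiardMap_eq f
      rw [he] at hxN
      refine h2 (h4 _ hh hx.2.2.1 ?_ ?_) hxN
      all_goals
        have hd := hh.displacement (s₀ := s₀) hj
        have hy := hh.height_pos
        have ht := sign_mul_tan_sub h3 hθ₀ hε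
        obtain ⟨-, hx1, hx2, hx3⟩ := hx
        -- For a diverging vector both terms of the displacement have the sign of ε and the slope is
        -- negative, so the image is displaced towards -ε; its angle turns the same way, hence the
        -- image diverges with the sign -ε.
        have key : -ε * (P.hitCoord i j x.1 x.2 - P.hitCoord i j s₀ θ₀) *
            ((P.relDir i j).re - (P.relDir i j).im * Real.tan θ₀) =
            -(ε * (x.1 - s₀) + ((P.relBase i j).im + P.hitCoord i j x.1 x.2 * (P.relDir i j).im) *
              (ε * (Real.tan x.2 - Real.tan θ₀))) := by linear_combination -ε * hd
      · by_contra hc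
        have h5 := mul_pos_of_neg_of_neg (not_le.1 hc) hj
        have h6 := mul_nonneg hy.le (ht.2 hx2)
        linarith
      · rcases hx2.eq_or_lt with h5 | h5
        · right
          by_contra hc
          have h6 := mul_nonneg_of_nonpos_of_nonpos (not_lt.1 hc) hj.le
          have h7 := mul_nonneg hy.le (ht.2 hx2)
          rw [← h5] at hx3
          linarith
        · exact Or.inl h5

/-- The vertices off the reference line have gaps bounded below, so a vector close to the reference
can only hit a vertex that lies on the reference line. -/
lemma eventually_vertex_near (i : Fin d) (s₀ : ℝ) {θ₀ : ℝ}
    (hθ₀ : θ₀ ∈ Ioo (-(Real.pi / 2)) (Real.pi / 2)) :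
    ∀ᶠ x : ℝ × ℝ in 𝓝 (s₀, θ₀), ∀ w ∈ P.vertices,
      (P.frame i w).re - (P.frame i w).im * Real.tan θ₀ - s₀ ≠ 0 →
      |x.1 - s₀| + |(P.frame i w).im| * |Real.tan x.2 - Real.tan θ₀| <
        |(P.frame i w).re - (P.frame i w).im * Real.tan θ₀ - s₀| := by
  refine (eventually_all_finite P.finite_vertices).2 fun w _ => ?_
  by_cases hg : (P.frame i w).re - (P.frame i w).im * Real.tan θ₀ - s₀ = 0
  · exact Eventually.of_forall fun x h => absurd hg h
  · have hc : ContinuousAt (fun x : ℝ × ℝ => |x.1 - s₀| +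
        |(P.frame i w).im| * |Real.tan x.2 - Real.tan θ₀|) (s₀, θ₀) :=
      (continuousAt_fst.sub continuousAt_const).abs.add
        (continuousAt_const.mul ((continuousAt_tan_snd hθ₀).sub continuousAt_const).abs)
    filter_upwards [hc.eventually_lt_const
      (u := |(P.frame i w).re - (P.frame i w).im * Real.tan θ₀ - s₀|)
      (by simpa using hg)] with x hx _ using hx

end PolygonalTable

/-! ### Vectors that hit the boundary before crossing the reference -/

namespace PolygonalTable

variable {d : ℕ} (P : PolygonalTable d)

variable {P} {f : ℝ → ℝ}

set_option maxHeartbeats 400000 in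
/-- Vectors that hit the boundary before they cross the trajectory of a reference vector hit the
same side as the parallel ones that are based farther from it. -/
lemma eventually_same_side (i : Fin d) (s₀ : ℝ) {θ₀ ε : ℝ}
    (hθ₀ : θ₀ ∈ Ioo (-(Real.pi / 2)) (Real.pi / 2)) (hε : ε = 1 ∨ ε = -1) :
    ∃ r > 0, ∀ θ, |θ - θ₀| < r → 0 < ε * (θ - θ₀) → ∀ s₁ s₂, |s₁ - s₀| < r → |s₂ - s₀| < r →
      ε * s₁ ≤ ε * s₂ → ∀ j₁ s₁' j₂ s₂', P.HitsSide i s₁ θ j₁ s₁' → P.HitsSide i s₂ θ j₂ s₂' →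
      (P.relDir i j₂).re - (P.relDir i j₂).im * Real.tan θ₀ < 0 →
      0 ≤ ε * (s₂' - P.hitCoord i j₂ s₀ θ₀) → j₁ = j₂ := by
  obtain ⟨r, hr, hball⟩ := Metric.eventually_nhds_iff_ball.1
    (P.eventually_vertex_near i s₀ hθ₀)
  refine ⟨r, hr, fun θ hθr hθε s₁ s₂ hs₁ hs₂ hs12 j₁ s₁' j₂ s₂' h₁ h₂ hm₀ hbad => ?_⟩
  have hθ := h₁.2.1
  have hκ := (sign_mul_tan_sub hθ hθ₀ hε).1 hθε
  set κ := ε * (Real.tan θ - Real.tan θ₀) with hκdef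
  have hεε : ε * ε = 1 := by rcases hε with rfl | rfl <;> norm_num
  have hnear : ∀ s, |s - s₀| < r → ∀ w ∈ P.vertices,
      (P.frame i w).re - (P.frame i w).im * Real.tan θ - s = 0 →
      (P.frame i w).re - (P.frame i w).im * Real.tan θ₀ - s₀ = 0 := by
    intro s hs w hw he
    by_contra hne
    have h3 := hball (s, θ) (by
      rw [Metric.mem_ball, Prod.dist_eq, max_lt_iff]; exact ⟨hs, hθr⟩) w hw hne
    have h4 : (P.frame i w).re - (P.frame i w).im * Real.tan θ₀ - s₀ =
        (s - s₀) + (P.frame i w).im * (Real.tan θ - Real.tan θ₀) := by linarith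
    rw [h4] at h3
    have h5 := abs_add_le (s - s₀) ((P.frame i w).im * (Real.tan θ - Real.tan θ₀))
    rw [abs_mul] at h5
    simp only at h3
    linarith
  have hbetween : ∀ s, ε * s₁ ≤ ε * s → ε * s ≤ ε * s₂ → |s - s₀| < r ∧ s ∈ P.openSide i := by
    intro s h3 h4
    have := h₁.1
    have := h₂.1
    rw [abs_lt] at *
    rcases hε with rfl | rfl
    · exact ⟨⟨by linarith [hs₁.1], by linarith [hs₂.2]⟩,
        ⟨by linarith [h₁.1.1], by linarith [h₂.1.2]⟩⟩
    · exact ⟨⟨by linarith [hs₂.1], by linarith [hs₁.2]⟩,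
        ⟨by linarith [h₂.1.1], by linarith [h₁.1.2]⟩⟩
  have hU : IsPreconnected ({s | ε * s₁ ≤ ε * s ∧ ε * s ≤ ε * s₂} ×ˢ {θ}) := by
    refine IsPreconnected.prod ?_ isPreconnected_singleton
    refine Set.OrdConnected.isPreconnected ⟨fun x hx y hy z hz => ?_⟩
    rcases hε with rfl | rfl
    · exact ⟨by linarith [hx.1, hz.1], by linarith [hy.2, hz.2]⟩
    · exact ⟨by linarith [hy.1, hz.2], by linarith [hx.2, hz.1]⟩
  by_cases hv : ∀ x ∈ {s | ε * s₁ ≤ ε * s ∧ ε * s ≤ ε * s₂} ×ˢ {θ}, ∀ w,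
      ¬ P.HitsVertex i x.1 x.2 w
  · have h3 : (s₁, θ) ∈ {s | ε * s₁ ≤ ε * s ∧ ε * s ≤ ε * s₂} ×ˢ {θ} := ⟨⟨le_rfl, hs12⟩, rfl⟩
    have h4 : (s₂, θ) ∈ {s | ε * s₁ ≤ ε * s ∧ ε * s ≤ ε * s₂} ×ˢ {θ} := ⟨⟨hs12, le_rfl⟩, rfl⟩
    have := HitsSide.of_isPreconnected hU (fun x hx => (hbetween _ hx.1.1 hx.1.2).2)
      (fun x hx => by rw [show x.2 = θ from hx.2]; exact hθ) hv h3 h4 h₁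
    exact (this.unique h₂).1
  -- Otherwise a vector based at some s between s₁ and s₂ hits a vertex w, which must lie on the
  -- reference line. The flight from s₂ ends on the side j₂ before passing that line, and the rest
  -- of the proof shows that this side obstructs the flight from s to w.
  exfalso
  push Not at hv
  obtain ⟨⟨s, θ'⟩, ⟨⟨hs1, hs2⟩, hθ'⟩, w, hw⟩ := hv
  simp only at hs1 hs2 hw
  have hθ' : θ' = θ := hθ'
  subst hθ'
  have hsi := hbetween s hs1 hs2
  have hlt : ε * s < ε * s₂ := by
    refine lt_of_le_of_ne hs2 fun h => ?_
    have : s = s₂ := by rcases hε with rfl | rfl <;> linarith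
    subst this
    exact h₂.notMem_singularSet (hw.mem_singularSet hsi.2 hθ)
  obtain ⟨hyw, hwe⟩ := hw.base_eq hθ
  have hw0 := hnear s hsi.1 w hw.1 (by linarith)
  have hyb := h₂.height_pos
  have hbe := h₂.base_eq
  have hm := h₂.slope_neg
  have hdisp := h₂.displacement (s₀ := s₀) hm₀
  set X := (P.relBase i j₂).re
  set Y := (P.relBase i j₂).im
  set A := (P.relDir i j₂).re
  set B := (P.relDir i j₂).im
  set yw := (P.frame i w).im
  set yb := Y + s₂' * B with hybdef
  have hbad' : ε * (s₂ - s₀) + yb * κ ≤ 0 := by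
    have := mul_nonpos_of_nonneg_of_nonpos hbad hm₀.le
    have e : ε * (s₂' - P.hitCoord i j₂ s₀ θ₀) * (A - B * Real.tan θ₀) =
      ε * (s₂ - s₀) + yb * κ := by
      rw [mul_assoc, hdisp, hκdef]; ring
    linarith
  have hws : ε * (s - s₀) + yw * κ = 0 := by
    have e : s - s₀ + yw * (Real.tan θ' - Real.tan θ₀) = 0 := by linarith
    have := congrArg (fun z => ε * z) e
    simp only [mul_zero] at this
    rw [← this, hκdef]; ring
  -- The parameter at which the line of the side j₂ meets the line of the vector based at s.
  set q := s₂' + (s - s₂) / (A - B * Real.tan θ') with hq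
  have hqm : (q - s₂') * (A - B * Real.tan θ') = s - s₂ := by
    rw [hq, add_sub_cancel_left, div_mul_cancel₀ _ hm.ne]
  have hqε : 0 < ε * (q - s₂') := by
    by_contra hc
    have := mul_nonneg_of_nonpos_of_nonpos (not_lt.1 hc) hm.le
    have e : ε * (q - s₂') * (A - B * Real.tan θ') = ε * s - ε * s₂ := by
      rw [mul_assoc, hqm]; ring
    linarith
  have hline : ∀ p, X + p * A - (Y + p * B) * Real.tan θ' =
      s₂ + (p - s₂') * (A - B * Real.tan θ') := by
    intro p; rw [hbe]; ring
  -- Beyond s₂' in the direction ε, the line of the side j₂ stays strictly on the near side of the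
  -- reference line.
  have hline0 : ∀ p, 0 < ε * (p - s₂') →
      ε * (X + p * A - (Y + p * B) * Real.tan θ₀ - s₀) < 0 := by
    intro p hp
    have := mul_neg_of_pos_of_neg hp hm₀
    have e : ε * (X + p * A - (Y + p * B) * Real.tan θ₀ - s₀) =
      (ε * (s₂ - s₀) + yb * κ) + ε * (p - s₂') * (A - B * Real.tan θ₀) := by
      rw [hbe, hκdef]; ring
    linarith
  -- If q is interior to the side, it is lower than w. At positive height it stops the flight before
  -- w; otherwise the side j₂ meets the base side at an interior point. If q is not interior, an end
  -- of j₂ lies between s₂' and q.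
  by_cases hqj : q ∈ P.openSide j₂
  · have hyq : Y + q * B < yw := by
      have h3 := hline0 q hqε
      have e : ε * (X + q * A - (Y + q * B) * Real.tan θ₀ - s₀) =
          ε * (s - s₀) + (Y + q * B) * κ := by
        have h4 := hline q
        rw [hqm] at h4
        have h5 : X + q * A = s + (Y + q * B) * Real.tan θ' := by linarith
        rw [h5, hκdef]; ring
      rw [e] at h3
      by_contra hc
      have h6 := mul_le_mul_of_nonneg_right (not_lt.1 hc) hκ.le
      linarith
    rcases lt_or_ge 0 (Y + q * B) with hyq0 | hyq0
    · obtain ⟨-, t, ht, hte, htd⟩ := hw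
      have hc := Real.cos_pos_of_mem_Ioo hθ
      have hyt : yw = t * Real.cos θ' := by
        simp only [yw]; rw [← hte, frame_ray_im]
      have h6 := htd ((Y + q * B) / Real.cos θ') ⟨by positivity, by
        rw [div_lt_iff₀ hc]; linarith⟩
      have h7 : P.ray i s θ' ((Y + q * B) / Real.cos θ') = P.sidePoint j₂ q := by
        apply P.frame_injective i
        have h4 := hline q
        rw [hqm] at h4
        apply Complex.ext
        · rw [frame_ray_re, frame_sidePoint_re, ← tan_mul_cos' hθ]
          have : (Y + q * B) / Real.cos θ' * (Real.tan θ' * Real.cos θ') =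
            (Y + q * B) * Real.tan θ' := by field_simp
          rw [this]; linarith
        · rw [frame_ray_im, frame_sidePoint_im]
          field_simp; rfl
      rw [h7] at h6
      exact P.notMem_domain_of_mem_frontier
        (P.sidePoint_mem_frontier (Ioo_subset_Icc_self hqj)) h6
    · set l := yb / (yb - (Y + q * B)) with hl
      have hden : 0 < yb - (Y + q * B) := by linarith
      have hl0 : 0 < l := by positivity
      have hl1 : l ≤ 1 := by rw [hl, div_le_one hden]; linarith
      have hly : l * (yb - (Y + q * B)) = yb := by rw [hl, div_mul_cancel₀ _ hden.ne']
      set p := (1 - l) * s₂' + l * q with hp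
      have hpj : p ∈ P.openSide j₂ :=
        convex_Ioo _ _ h₂.2.2.1 hqj (by linarith) hl0.le (by ring)
      have hyp : Y + p * B = 0 := by
        rw [hp]; linear_combination (-1 : ℝ) * hly + (l-1) * hybdef - l * hybdef + hybdef
      have hpim : (P.frame i (P.sidePoint j₂ p)).im = 0 := by
        rw [frame_sidePoint_im]; exact hyp
      have h8 := P.eq_sidePoint_of_im_eq_zero hpim
      have h9 : (P.frame i (P.sidePoint j₂ p)).re = s₂ + l * (s - s₂) := by
        rw [frame_sidePoint_re]
        have := hline p
        rw [hyp] at this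
        have e : (p - s₂') * (A - B * Real.tan θ') = l * (s - s₂) := by
          rw [← hqm, hp]; ring
        linarith
      rw [h9] at h8
      have h10 : s₂ + l * (s - s₂) ∈ P.openSide i := by
        have e : ε * (s₂ + l * (s - s₂)) = ε * s + (1 - l) * (ε * s₂ - ε * s) := by ring
        have e' : ε * (s₂ + l * (s - s₂)) = ε * s₂ - l * (ε * s₂ - ε * s) := by ring
        have h13 := mul_nonneg (sub_nonneg.2 hl1) (sub_nonneg.2 hs2)
        have h14 := mul_nonneg hl0.le (sub_nonneg.2 hs2)
        exact (hbetween _ (by linarith) (by linarith)).2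
      have h11 := (P.sidePoint_unique hpj h10 h8).1
      have h12 : (P.frame i (P.sidePoint j₂ s₂')).im = 0 := by
        rw [h11, P.frame_sidePoint]; simp
      rw [frame_sidePoint_im] at h12
      exact hyb.ne' h12
  -- This vertex lies on the line of a vector based between s and s₂, hence has zero gap by `hnear`,
  -- whereas `hline0` makes its gap nonzero.
  · have hcor : ∃ k : Fin (d + 1), P.sidePoint j₂ (P.corner k) = P.bdry (P.corner k) ∧
        0 < ε * (P.corner k - s₂') ∧ ε * (P.corner k - s₂') ≤ ε * (q - s₂') := by
      have h3 := h₂.2.2.1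
      have h4 : P.sidePoint j₂ (P.corner j₂.castSucc) = P.bdry (P.corner j₂.castSucc) := by
        simp [sidePoint]
      rcases hε with rfl | rfl
      · refine ⟨j₂.succ, P.sidePoint_corner_succ j₂, by linarith [h3.2], ?_⟩
        by_contra hc
        exact hqj ⟨by linarith [h3.1], by linarith⟩
      · refine ⟨j₂.castSucc, h4, by linarith [h3.1], ?_⟩
        by_contra hc
        exact hqj ⟨by linarith, by linarith [h3.2]⟩
    obtain ⟨k, hk, hk1, hk2⟩ := hcor
    set c := P.corner k
    set p := s₂ + (c - s₂') * (A - B * Real.tan θ') with hp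
    have hp1 : ε * p ≤ ε * s₂ := by
      have := mul_neg_of_pos_of_neg hk1 hm
      have e : ε * p = ε * s₂ + ε * (c - s₂') * (A - B * Real.tan θ') := by rw [hp]; ring
      linarith
    have hp2 : ε * s ≤ ε * p := by
      have h3 := mul_le_mul_of_nonpos_right hk2 hm.le
      have h4 : ε * (q - s₂') * (A - B * Real.tan θ') = ε * (s - s₂) := by
        rw [mul_assoc, hqm]
      have e : ε * p = ε * s₂ + ε * (c - s₂') * (A - B * Real.tan θ') := by rw [hp]; ring
      linarith
    have h3 := hnear p (hbetween p (hs1.trans hp2) hp1).1 (P.bdry c) ⟨k, rfl⟩ (by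
      rw [← hk, frame_sidePoint_re, frame_sidePoint_im]
      linarith [hline c])
    rw [← hk, frame_sidePoint_re, frame_sidePoint_im] at h3
    have h4 := hline0 c hk1
    rw [h3, mul_zero] at h4
    exact lt_irrefl _ h4

end PolygonalTable

/-! ### Counting nongrazing singularities at each time -/

namespace PolygonalTable

variable {d : ℕ} (P : PolygonalTable d)

variable {f : ℝ → ℝ}

/-- The vectors whose first `n` collisions make an angle with the boundary that is bounded away
from zero, the cosine of the angle with the normal being at least `η`. -/
def nonGrazing (f : ℝ → ℝ) (η : ℝ) : ℕ → Set (ℝ × ℝ)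
  | 0 => univ
  | n + 1 => {x | η ≤ Real.cos (P.specularMap x).2 ∧ P.billiardMap f x ∈ nonGrazing f η n}

/-- The vectors that become singular exactly after `m` collisions, none of them grazing. -/
def firstSingular (f : ℝ → ℝ) (η : ℝ) (m : ℕ) : Set (ℝ × ℝ) :=
  {x | x ∉ P.singularSetIter f m ∧ (P.billiardMap f)^[m] x ∈ P.singularSet ∧
    x ∈ P.nonGrazing f η m}

variable {P}

lemma mem_firstSingular_succ {η : ℝ} {m : ℕ} {x : ℝ × ℝ} :
    x ∈ P.firstSingular f η (m + 1) ↔ x ∉ P.singularSet ∧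
      η ≤ Real.cos (P.specularMap x).2 ∧ P.billiardMap f x ∈ P.firstSingular f η m := by
  simp only [firstSingular, mem_ofPred_eq, mem_singularSetIter_succ, nonGrazing,
    Function.iterate_succ_apply, not_or]
  tauto

lemma firstSingular_zero {η : ℝ} : P.firstSingular f η 0 = P.singularSet := by
  ext x; simp [firstSingular, singularSetIter_zero, nonGrazing]

lemma firstSingular_subset {η : ℝ} {m : ℕ} :
    P.firstSingular f η m ⊆ P.singularSetIter f (m + 1) := fun x hx =>
  mem_singularSetIter.2 ⟨m, by omega, hx.2.1⟩

lemma exists_hitsVertex_of_mem {i : Fin d} {s θ : ℝ} (hs : s ∈ P.openSide i)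
    (hθ : θ ∈ Ioo (-(Real.pi / 2)) (Real.pi / 2)) (h : (s, θ) ∈ P.singularSet) :
    ∃ w, P.HitsVertex i s θ w := by
  rcases P.hitsSide_or_hitsVertex hs hθ with ⟨j, s', h'⟩ | h'
  · exact absurd h h'.notMem_singularSet
  · exact h'

lemma encard_vertices_le : P.vertices.encard ≤ d := by
  have : P.vertices ⊆ range fun k : Fin d => P.bdry (P.corner k.castSucc) := by
    intro q hq
    obtain ⟨k, rfl⟩ := P.exists_eq_corner_of_mem_vertices hq
    exact ⟨k, rfl⟩
  refine (encard_le_encard this).trans ?_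
  rw [← image_univ]
  refine (encard_image_le _ _).trans ?_
  simp

/-- At a fixed angle a vertex is hit from at most one point of the side: its projection along the
flight direction. -/
lemma encard_singularSet_le (i : Fin d) {θ : ℝ} (hθ : θ ∈ Ioo (-(Real.pi / 2)) (Real.pi / 2)) :
    {s | s ∈ P.openSide i ∧ (s, θ) ∈ P.singularSet}.encard ≤ d := by
  have : {s | s ∈ P.openSide i ∧ (s, θ) ∈ P.singularSet} ⊆
      (fun w => (P.frame i w).re - (P.frame i w).im * Real.tan θ) '' P.vertices := by
    rintro s ⟨hs, h⟩
    obtain ⟨w, hw⟩ := exists_hitsVertex_of_mem hs hθ h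
    exact ⟨w, hw.1, (hw.base_eq hθ).2.symm⟩
  exact (encard_le_encard this).trans ((encard_image_le _ _).trans encard_vertices_le)

lemma injOn_hitCoord {i j : Fin d} {θ : ℝ} {S : Set ℝ}
    (hS : ∀ s ∈ S, P.HitsSide i s θ j (P.hitCoord i j s θ)) :
    InjOn (fun s => P.hitCoord i j s θ) S := by
  intro s hs t ht h
  simp only at h
  rw [(hS s hs).base_eq, (hS t ht).base_eq, h]

/-- Near every vector, the horizontal segments meet a bounded number of vectors that become
singular exactly after `m` collisions, none of them grazing. -/
lemma exists_nhds_encard_firstSingular_le (hf : IsContractingLaw f) {η : ℝ} (hη : 0 < η) (m : ℕ) :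
    ∀ (i : Fin d) (s₀ : ℝ) {θ₀ : ℝ}, θ₀ ∈ Ioo (-(Real.pi / 2)) (Real.pi / 2) →
      ∃ U ∈ 𝓝 (s₀, θ₀), ∀ θ,
        {s | s ∈ P.openSide i ∧ (s, θ) ∈ U ∧ (s, θ) ∈ P.firstSingular f η m}.encard ≤ d := by
  induction m with
  | zero =>
    intro i s₀ θ₀ hθ₀
    refine ⟨{x | x.2 ∈ Ioo (-(Real.pi / 2)) (Real.pi / 2)},
      continuousAt_snd.eventually (isOpen_Ioo.mem_nhds hθ₀), fun θ => ?_⟩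
    by_cases hθ : θ ∈ Ioo (-(Real.pi / 2)) (Real.pi / 2)
    · refine (encard_le_encard ?_).trans (P.encard_singularSet_le i hθ)
      rintro s ⟨h1, -, h2⟩
      rw [firstSingular_zero] at h2
      exact ⟨h1, h2⟩
    · refine le_of_eq_of_le (encard_eq_zero.2 (eq_empty_iff_forall_notMem.2 ?_)) (by simp)
      rintro s ⟨-, h, -⟩
      exact hθ h
  | succ m ih =>
    intro i s₀ θ₀ hθ₀
    have hd1 : (1 : ℕ∞) ≤ d := by
      have := i.2
      exact_mod_cast (show 1 ≤ d by omega)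
    have h1 : (1 : ℝ) = 1 ∨ (1 : ℝ) = -1 := Or.inl rfl
    have h2 : (-1 : ℝ) = 1 ∨ (-1 : ℝ) = -1 := Or.inr rfl
    have evd1 := eventually_diverging_notMem (P := P) hf (m + 2) i s₀ hθ₀ h1
    have evd2 := eventually_diverging_notMem (P := P) hf (m + 2) i s₀ hθ₀ h2
    obtain ⟨r₁, hr₁, hss₁⟩ := eventually_same_side (P := P) i s₀ hθ₀ h1
    obtain ⟨r₂, hr₂, hss₂⟩ := eventually_same_side (P := P) i s₀ hθ₀ h2
    -- The induction hypothesis is used at the image of the reference on the line of each side j,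
    -- whether or not the reference reaches that side.
    choose! U hU hUc using fun j => ih j (P.hitCoord i j s₀ θ₀) (θ₀ := f (P.outAngle i j θ₀))
    have evr : ∀ᶠ x : ℝ × ℝ in 𝓝 (s₀, θ₀), x ∈ Metric.ball (s₀, θ₀) (min r₁ r₂) :=
      Metric.ball_mem_nhds _ (lt_min hr₁ hr₂)
    have evθ : ∀ᶠ x : ℝ × ℝ in 𝓝 (s₀, θ₀), x.2 ∈ Ioo (-(Real.pi / 2)) (Real.pi / 2) :=
      continuousAt_snd.eventually (isOpen_Ioo.mem_nhds hθ₀)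
    -- If the reference is transversal to the line j in the right sense, nearby images are near its
    -- image, and those that have crossed it diverge and are not singular. Otherwise the limit
    -- cosine is at most 0 < η, so these collisions are grazing and do not count.
    have evj : ∀ᶠ x : ℝ × ℝ in 𝓝 (s₀, θ₀), ∀ j,
        ((P.relDir i j).re - (P.relDir i j).im * Real.tan θ₀ < 0 →
          (P.hitCoord i j x.1 x.2, f (P.outAngle i j x.2)) ∈ U j ∧
          ∀ ε : ℝ, ε = 1 ∨ ε = -1 → ∀ s', P.HitsSide i x.1 x.2 j s' → 0 < ε * (x.2 - θ₀) →
            0 ≤ -ε * (s' - P.hitCoord i j s₀ θ₀) →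
              (s', f (P.outAngle i j x.2)) ∉ P.singularSetIter f (m + 1)) ∧
        (¬ (P.relDir i j).re - (P.relDir i j).im * Real.tan θ₀ < 0 →
          ∀ s', P.HitsSide i x.1 x.2 j s' → Real.cos (P.outAngle i j x.2) < η) := by
      refine eventually_all.2 fun j => ?_
      by_cases hj : (P.relDir i j).re - (P.relDir i j).im * Real.tan θ₀ < 0
      · have hj' := (slope_neg_iff hθ₀).1 hj
        have hθ₁ := hf.map_mem (P.outAngle_mem hj')
        have hc := continuousAt_next hf s₀ hθ₀ hj
        have ev1 := hc.eventually (p := fun y => y ∈ U j) (hU j hθ₁)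
        have ev2 := hc.eventually (eventually_diverging_notMem (P := P) hf (m + 1) j
          (P.hitCoord i j s₀ θ₀) hθ₁ h1)
        have ev3 := hc.eventually (eventually_diverging_notMem (P := P) hf (m + 1) j
          (P.hitCoord i j s₀ θ₀) hθ₁ h2)
        have ev4 := eventually_next_mem_diverging hf s₀ hθ₀ h1 hj
        have ev5 := eventually_next_mem_diverging hf s₀ hθ₀ h2 hj
        filter_upwards [ev1, ev2, ev3, ev4, ev5] with x hx1 hx2 hx3 hx4 hx5
        refine ⟨fun _ => ⟨hx1, ?_⟩, fun h => absurd hj h⟩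
        intro ε hε s' hs' ha hb
        have hs'e := hs'.eq_hitCoord
        rcases hε with rfl | rfl
        · have := hx4 s' hs' ha.le hb (Or.inl ha)
          rw [hs'e] at this ⊢
          exact hx3 this
        · have := hx5 s' hs' ha.le hb (Or.inl ha)
          rw [hs'e] at this ⊢
          rw [neg_neg] at this
          exact hx2 this
      · have hj' := mt (slope_neg_iff hθ₀).2 hj
        have hc : ContinuousAt (fun x : ℝ × ℝ => -((P.relDir i j).re * Real.cos x.2 -
          (P.relDir i j).im * Real.sin x.2)) (s₀, θ₀) := by fun_prop
        filter_upwards [hc.eventually_lt_const (u := η) (by simp only; linarith)] with x hx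
        refine ⟨fun h => absurd h hj, fun _ s' hs' => ?_⟩
        rw [hs'.cos_outAngle]; exact hx
    refine ⟨_, evd1.and (evd2.and (evr.and (evθ.and evj))), fun θ => ?_⟩
    set Q := {s | s ∈ P.openSide i ∧ (s, θ) ∈ {x : ℝ × ℝ | _} ∧
      (s, θ) ∈ P.firstSingular f η (m + 1)} with hQ
    have hQd : ∀ ε : ℝ, ε = 1 ∨ ε = -1 → ∀ s ∈ Q, (s, θ) ∉ P.diverging i s₀ θ₀ ε := by
      rintro ε hε s ⟨-, ⟨hs1, hs2, -⟩, hs3⟩ hd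
      have := firstSingular_subset hs3
      rcases hε with rfl | rfl
      · exact hs1 hd this
      · exact hs2 hd this
    -- Parallel vectors diverge from the reference on either side, so only s₀ itself can be
    -- singular.
    by_cases hθe : θ = θ₀
    · have : Q ⊆ {s₀} := by
        intro s hs
        by_contra hne
        have hne : s ≠ s₀ := hne
        rcases lt_or_gt_of_ne hne with h | h
        · exact hQd (-1) h2 s hs ⟨hs.1, by simp only; linarith, by simp [hθe], by
            simp only [hθe]; linarith⟩
        · exact hQd 1 h1 s hs ⟨hs.1, by simp only; linarith, by simp [hθe], by
            simp only [hθe]; linarith⟩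
      exact (encard_le_encard this).trans (by simpa using hd1)
    obtain ⟨ε, hε, hεθ⟩ : ∃ ε : ℝ, (ε = 1 ∨ ε = -1) ∧ 0 < ε * (θ - θ₀) := by
      rcases lt_or_gt_of_ne hθe with h | h
      · exact ⟨-1, h2, by linarith⟩
      · exact ⟨1, h1, by linarith⟩
    have hQh : ∀ s ∈ Q, ∃ j, P.HitsSide i s θ j (P.hitCoord i j s θ) ∧
        (P.relDir i j).re - (P.relDir i j).im * Real.tan θ₀ < 0 ∧
        0 ≤ ε * (P.hitCoord i j s θ - P.hitCoord i j s₀ θ₀) ∧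
        (P.hitCoord i j s θ, f (P.outAngle i j θ)) ∈ U j ∧
        (P.hitCoord i j s θ, f (P.outAngle i j θ)) ∈ P.firstSingular f η m := by
      rintro s ⟨hs1, ⟨-, -, -, hs2, hs3⟩, hs4⟩
      rw [mem_firstSingular_succ] at hs4
      obtain ⟨hs5, hs6, hs7⟩ := hs4
      obtain ⟨j, s', hj⟩ := exists_hitsSide_of_notMem hs1 hs2 hs5
      have hj' := hj.eq_hitCoord
      simp only at hj hj'
      subst hj'
      rw [hj.specularMap_eq] at hs6
      rw [hj.billiardMap_eq] at hs7
      have hslope : (P.relDir i j).re - (P.relDir i j).im * Real.tan θ₀ < 0 := by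
        by_contra hc
        have := (hs3 j).2 hc _ hj
        simp only at hs6 this
        linarith
      refine ⟨j, hj, hslope, ?_, ((hs3 j).1 hslope).1, hs7⟩
      by_contra hc
      refine ((hs3 j).1 hslope).2 ε hε _ hj hεθ ?_ (firstSingular_subset hs7)
      linarith [not_le.1 hc]
    have hQr : ∀ s ∈ Q, |s - s₀| < min r₁ r₂ ∧ |θ - θ₀| < min r₁ r₂ := by
      rintro s ⟨-, ⟨-, -, hs, -⟩, -⟩
      rw [Metric.mem_ball, Prod.dist_eq, max_lt_iff] at hs
      exact hs
    -- All vectors of Q hit before crossing the reference, hence on one common side j. The bound d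
    -- therefore does not grow with m: `hitCoord` injects Q into the set counted for j alone.
    have hsame : ∀ s ∈ Q, ∀ t ∈ Q, ∀ j k s' t', P.HitsSide i s θ j s' → P.HitsSide i t θ k t' →
        j = k := by
      have key : ∀ s ∈ Q, ∀ t ∈ Q, ε * s ≤ ε * t → ∀ j k s' t', P.HitsSide i s θ j s' →
          P.HitsSide i t θ k t' → j = k := by
        intro s hs t ht hst j k s' t' hj hk
        obtain ⟨k', hk', hk1, hk2, -⟩ := hQh t ht
        obtain ⟨rfl, rfl⟩ := hk.unique hk'
        rcases hε with rfl | rfl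
        · exact hss₁ θ ((hQr s hs).2.trans_le (min_le_left _ _)) hεθ s t
            ((hQr s hs).1.trans_le (min_le_left _ _)) ((hQr t ht).1.trans_le (min_le_left _ _))
            hst _ _ _ _ hj hk hk1 hk2
        · exact hss₂ θ ((hQr s hs).2.trans_le (min_le_right _ _)) hεθ s t
            ((hQr s hs).1.trans_le (min_le_right _ _)) ((hQr t ht).1.trans_le (min_le_right _ _))
            hst _ _ _ _ hj hk hk1 hk2
      intro s hs t ht j k s' t' hj hk
      rcases le_total (ε * s) (ε * t) with h | h
      · exact key s hs t ht h j k s' t' hj hk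
      · exact (key t ht s hs h k j t' s' hk hj).symm
    rcases Q.eq_empty_or_nonempty with hQe | ⟨t, ht⟩
    · rw [hQe]; simp
    obtain ⟨j, hj, hslope, -⟩ := hQh t ht
    have hall : ∀ s ∈ Q, P.HitsSide i s θ j (P.hitCoord i j s θ) ∧
        (P.hitCoord i j s θ, f (P.outAngle i j θ)) ∈ U j ∧
        (P.hitCoord i j s θ, f (P.outAngle i j θ)) ∈ P.firstSingular f η m := by
      intro s hs
      obtain ⟨k, hk, -, -, h3, h4⟩ := hQh s hs
      obtain rfl := hsame s hs t ht _ _ _ _ hk hj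
      exact ⟨hk, h3, h4⟩
    have hθ₁ := hf.map_mem (P.outAngle_mem ((slope_neg_iff hθ₀).1 hslope))
    refine le_trans ?_ (hUc j hθ₁ (f (P.outAngle i j θ)))
    rw [← (injOn_hitCoord fun s hs => (hall s hs).1).encard_image]
    refine encard_le_encard ?_
    rintro _ ⟨s, hs, rfl⟩
    exact ⟨(hall s hs).1.2.2.1, (hall s hs).2⟩

/-- A crude bound, uniform on all horizontal segments. -/
lemma encard_firstSingular_le (hf : IsContractingLaw f) {η : ℝ} (m : ℕ) :
    ∀ (i : Fin d) {θ : ℝ}, θ ∈ Ioo (-(Real.pi / 2)) (Real.pi / 2) →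
      {s | s ∈ P.openSide i ∧ (s, θ) ∈ P.firstSingular f η m}.encard ≤ (d ^ (m + 1) : ℕ) := by
  induction m with
  | zero =>
    intro i θ hθ
    rw [firstSingular_zero, zero_add, pow_one]
    exact encard_singularSet_le i hθ
  | succ m ih =>
    intro i θ hθ
    set S : Fin d → Set ℝ := fun j => {s | P.HitsSide i s θ j (P.hitCoord i j s θ) ∧
      (P.hitCoord i j s θ, f (P.outAngle i j θ)) ∈ P.firstSingular f η m} with hS
    have hsub : {s | s ∈ P.openSide i ∧ (s, θ) ∈ P.firstSingular f η (m + 1)} ⊆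
        ⋃ j ∈ (Finset.univ : Finset (Fin d)), S j := by
      rintro s ⟨hs, h⟩
      rw [mem_firstSingular_succ] at h
      obtain ⟨j, s', hj⟩ := exists_hitsSide_of_notMem (x := (s, θ)) hs hθ h.1
      have hj' := hj.eq_hitCoord
      simp only at hj hj'
      subst hj'
      rw [hj.billiardMap_eq] at h
      simp only [mem_iUnion]
      exact ⟨j, Finset.mem_univ _, hj, h.2.2⟩
    have hle : ∀ j, (S j).encard ≤ (d ^ (m + 1) : ℕ) := by
      intro j
      rcases (S j).eq_empty_or_nonempty with he | ⟨s, hs⟩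
      · rw [he]; simp
      refine le_trans ?_ (ih j (θ := f (P.outAngle i j θ)) (hf.map_mem hs.1.outAngle_mem))
      rw [← (injOn_hitCoord fun s (hs : s ∈ S j) => hs.1).encard_image]
      refine encard_le_encard ?_
      rintro _ ⟨s, hs, rfl⟩
      exact ⟨hs.1.2.2.1, hs.2⟩
    refine (encard_le_encard hsub).trans ((Finset.set_encard_biUnion_le _ _).trans ?_)
    refine (Finset.sum_le_card_nsmul _ _ _ fun j _ => hle j).trans ?_
    rw [Finset.card_univ, Fintype.card_fin, pow_succ' d (m + 1)]
    simp

end PolygonalTable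

/-! ### Consecutive nearly orthogonal collisions -/

namespace PolygonalTable

variable {d : ℕ} (P : PolygonalTable d)

variable {P} {f : ℝ → ℝ}

lemma zero_mem_angle : (0 : ℝ) ∈ Ioo (-(Real.pi / 2)) (Real.pi / 2) := by
  have := Real.pi_pos
  exact ⟨by linarith, by linarith⟩

/-- No orthogonal flight joins parallel sides. -/
lemma NoParallelSidesFacing.relDir_ne (hP : P.NoParallelSidesFacing) {i j : Fin d} {s s' : ℝ}
    (h : P.HitsSide i s 0 j s') : P.relDir i j ≠ -1 := by
  intro hr
  obtain ⟨hs, -, hs', t, ht, he, hd⟩ := h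
  have hdir : P.dir j = -P.dir i := by
    have : P.dir i * P.relDir i j = P.dir j := by
      rw [relDir, ← mul_assoc, mul_comm (P.dir i), P.conj_dir_mul_dir, one_mul]
    rw [← this, hr]; ring
  have hray : ∀ u, P.ray i s 0 u = P.sidePoint i s + u * Complex.I * P.dir i := by
    intro u; simp [ray]
  have hba : P.sidePoint j s' - P.sidePoint i s = t * Complex.I * P.dir i := by
    rw [← he, hray]; ring
  have hin : inner ℝ (P.sidePoint j s' - P.sidePoint i s) (P.dir i) = 0 := by
    have h1 : P.dir i * (starRingEnd ℂ) (t * Complex.I * P.dir i) = -(t * Complex.I) := by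
      have := P.conj_dir_mul_dir i
      rw [map_mul, map_mul, Complex.conj_I, Complex.conj_ofReal]
      linear_combination (-(t * Complex.I)) * this
    rw [hba, Complex.inner, h1]
    simp
  have := hP i j (P.sidePoint i s) ⟨s, Ioo_subset_Icc_self hs, P.bdry_eq_of_mem_openSide hs⟩
    (P.sidePoint j s') ⟨s', Ioo_subset_Icc_self hs', P.bdry_eq_of_mem_openSide hs'⟩ ?_ ?_ hin ?_
  · exact P.sidePoint_notMem_vertices hs this.1
  · intro h
    rw [← h, sub_self] at hba
    have hn := congrArg norm hba
    simp [P.norm_dir] at hn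
    linarith [abs_of_pos ht]
  · rw [openSegment_eq_image]
    rintro _ ⟨u, hu, rfl⟩
    have h1 := hd (u * t) ⟨mul_pos hu.1 ht, by nlinarith [hu.2]⟩
    rw [hray] at h1
    convert h1 using 1
    have h2 : P.sidePoint j s' = P.sidePoint i s + t * Complex.I * P.dir i := by
      rw [← hba]; ring
    simp only [h2, Complex.real_smul]
    push_cast; ring
  · rw [hdir, inner_neg_right, hin, neg_zero]

/-- Vectors diverging from an orthogonal one hit the same side as some orthogonal vector, and to
that flight the hypothesis on parallel sides applies. -/
lemma eventually_relDir_ne_of_diverging (hP : P.NoParallelSidesFacing) (i : Fin d) (s₀ : ℝ)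
    {ε : ℝ} (hε : ε = 1 ∨ ε = -1) :
    ∀ᶠ x : ℝ × ℝ in 𝓝 (s₀, 0), x ∈ P.diverging i s₀ 0 ε → ∀ j s', P.HitsSide i x.1 x.2 j s' →
      P.relDir i j ≠ -1 := by
  rcases P.eventually_hitsSide_of_diverging i s₀ zero_mem_angle hε with h | ⟨j, -, h, s, -, hs⟩
  · filter_upwards [h] with x hx hx' using absurd hx' hx
  · filter_upwards [h] with x hx hx' k s' hk
    rw [← ((hx hx').unique hk).1]
    exact hP.relDir_ne hs

/-- There are no two consecutive nearly orthogonal flights between parallel sides. -/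
lemma eventually_not_parallel (hf : IsContractingLaw f) (hP : P.NoParallelSidesFacing)
    (i : Fin d) (s₀ : ℝ) :
    ∀ᶠ x : ℝ × ℝ in 𝓝 (s₀, 0), ∀ j s' k s'', P.HitsSide i x.1 x.2 j s' →
      P.HitsSide j s' (f (P.outAngle i j x.2)) k s'' → P.relDir i j = -1 →
      P.relDir j k ≠ -1 := by
  have h1 : (1 : ℝ) = 1 ∨ (1 : ℝ) = -1 := Or.inl rfl
  have h2 : (-1 : ℝ) = 1 ∨ (-1 : ℝ) = -1 := Or.inr rfl
  have evi : ∀ᶠ x : ℝ × ℝ in 𝓝 (s₀, 0), ∀ ε : ℝ, (ε = 1 ∨ ε = -1) →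
      x ∈ P.diverging i s₀ 0 ε → ∀ j s', P.HitsSide i x.1 x.2 j s' → P.relDir i j ≠ -1 := by
    filter_upwards [eventually_relDir_ne_of_diverging hP i s₀ h1,
      eventually_relDir_ne_of_diverging hP i s₀ h2] with x hx1 hx2 ε hε
    rcases hε with rfl | rfl
    exacts [hx1, hx2]
  have evj : ∀ᶠ x : ℝ × ℝ in 𝓝 (s₀, 0), ∀ j, P.relDir i j = -1 →
      ∀ ε : ℝ, (ε = 1 ∨ ε = -1) → 0 < ε * x.2 → ∀ s' k s'', P.HitsSide i x.1 x.2 j s' →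
        P.HitsSide j s' (f (P.outAngle i j x.2)) k s'' → P.relDir j k ≠ -1 := by
    refine eventually_all.2 fun j => ?_
    by_cases hr : P.relDir i j = -1
    swap
    · exact Eventually.of_forall fun x h => absurd h hr
    have hslope : (P.relDir i j).re - (P.relDir i j).im * Real.tan 0 < 0 := by
      rw [hr]; simp
    have hout0 : P.outAngle i j 0 = 0 := by simp [outAngle, hr]
    have hc : Tendsto (fun x : ℝ × ℝ => (P.hitCoord i j x.1 x.2, f (P.outAngle i j x.2)))
        (𝓝 (s₀, 0)) (𝓝 (P.hitCoord i j s₀ 0, 0)) := by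
      have := (continuousAt_next hf s₀ zero_mem_angle hslope).tendsto
      simp only [hout0, hf.map_zero] at this
      exact this
    have evo : ∀ᶠ x : ℝ × ℝ in 𝓝 (s₀, 0),
        P.outAngle i j x.2 = P.outAngle i j 0 - (x.2 - 0) := by
      have h0 := eventually_outAngle ((slope_neg_iff zero_mem_angle).1 hslope)
      exact (continuousAt_snd (p := (s₀, (0 : ℝ)))).tendsto.eventually h0
    have hc' : Tendsto (fun x : ℝ × ℝ => (P.hitCoord i j x.1 x.2, x.2))
        (𝓝 (s₀, 0)) (𝓝 (P.hitCoord i j s₀ 0, 0)) :=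
      ((continuousAt_hitCoord (x := (s₀, 0)) zero_mem_angle hslope.ne).prodMk
        continuousAt_snd).tendsto
    have hfw : ∀ ε : ℝ, (ε = 1 ∨ ε = -1) → ∀ᶠ x : ℝ × ℝ in 𝓝 (s₀, 0), 0 < ε * x.2 →
        ∀ s' k s'', P.HitsSide i x.1 x.2 j s' →
        P.HitsSide j s' (f (P.outAngle i j x.2)) k s'' → P.relDir j k ≠ -1 := by
      intro ε hε
      have hε' : -ε = 1 ∨ -ε = -1 := by
        rcases hε with rfl | rfl
        · right; rfl
        · left; norm_num
      have ev1 := hc.eventually (eventually_relDir_ne_of_diverging hP j (P.hitCoord i j s₀ 0) hε')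
      have ev2 := hc'.eventually (eventually_relDir_ne_of_diverging hP j (P.hitCoord i j s₀ 0) hε)
      filter_upwards [ev1, ev2, eventually_next_mem_diverging hf s₀ zero_mem_angle hε hslope,
        evo] with x hx1 hx2 hx3 hx4 hpos s' k s'' hs' hs''
      rw [hout0] at hx3 hx4
      rw [hf.map_zero] at hx3
      have hse := hs'.eq_hitCoord
      -- If the flight has reached or crossed the orthogonal line, its image diverges and the next
      -- side is not parallel. If not, the reversed flight, of angle `x.2`, diverges from that line
      -- and so cannot end on a parallel side, though it ends on i.
      rcases le_or_gt 0 (-ε * (s' - P.hitCoord i j s₀ 0)) with h | h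
      · have hm := hx3 s' hs' (by rw [sub_zero]; exact hpos.le) h
          (Or.inl (by rw [sub_zero]; exact hpos))
        rw [hse] at hm hs''
        exact hx1 hm k s'' hs''
      · have hrev := hs'.reverse
        rw [hx4, sub_zero, zero_sub, neg_neg] at hrev
        refine absurd ?_ (hx2 ?_ i x.1 (by rw [← hse]; exact hrev))
        · rw [relDir_symm, hr]; simp
        · rw [← hse]
          exact ⟨hrev.1, by linarith, by simpa using hpos.le, by simp only [sub_zero]; linarith⟩
    filter_upwards [hfw 1 h1, hfw (-1) h2] with x hx1 hx2 _ ε hε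
    rcases hε with rfl | rfl
    exacts [hx1, hx2]
  filter_upwards [evi, evj] with x hxi hxj j s' k s'' hs' hs'' hr
  rcases eq_or_ne x.2 0 with h | h
  · rw [h] at hs'
    exact absurd hr (hP.relDir_ne hs')
  · rcases lt_or_gt_of_ne h with h | h
    · exact hxj j hr (-1) h2 (by linarith) s' k s'' hs' hs''
    · exact hxj j hr 1 h1 (by linarith) s' k s'' hs' hs''

/-- The angle between the two sides is determined by the two angles of the flight. As `relDir` takes
finitely many values, two small angles force it to be -1. -/
lemma HitsSide.relDir_re {i j : Fin d} {s θ s' : ℝ} (h : P.HitsSide i s θ j s') :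
    (P.relDir i j).re = -Real.cos (θ + P.outAngle i j θ) := by
  rw [Real.cos_add, P.sin_outAngle, h.cos_outAngle]
  linear_combination (-(P.relDir i j).re) * Real.sin_sq_add_cos_sq θ

/-- Among any three consecutive collisions one is uniformly far from being orthogonal. -/
lemma exists_uniform_angle (hf : IsContractingLaw f) (hP : P.NoParallelSidesFacing) :
    ∃ κ > 0, ∀ i s θ j s' k s'', P.HitsSide i s θ j s' →
      P.HitsSide j s' (f (P.outAngle i j θ)) k s'' → |θ| < κ → |P.outAngle i j θ| < κ →
      κ ≤ |P.outAngle j k (f (P.outAngle i j θ))| := by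
  obtain ⟨l, hl0, hl1, hl⟩ := hf.exists_contraction
  have ev1 : ∀ᶠ θ : ℝ in 𝓝 0, ∀ s ∈ Icc (0 : ℝ) 1, ∀ i j s' k s'', P.HitsSide i s θ j s' →
      P.HitsSide j s' (f (P.outAngle i j θ)) k s'' → P.relDir i j = -1 →
      P.relDir j k ≠ -1 := by
    -- Compactness of the boundary makes the local statements uniform in the base point.
    refine isCompact_Icc.eventually_forall_of_forall_eventually fun s₀ _ => ?_
    have hsw : Tendsto (Prod.swap : ℝ × ℝ → ℝ × ℝ) (𝓝 (0, s₀)) (𝓝 (s₀, 0)) :=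
      continuous_swap.tendsto (0, s₀)
    exact hsw.eventually (eventually_all.2 fun i => eventually_not_parallel hf hP i s₀)
  have ev2 : ∀ᶠ u : ℝ in 𝓝 0, ∀ i j, P.relDir i j ≠ -1 → -Real.cos u < (P.relDir i j).re := by
    refine eventually_all.2 fun i => eventually_all.2 fun j => ?_
    by_cases hr : P.relDir i j = -1
    · exact Eventually.of_forall fun x h => absurd hr h
    · have hsq := P.relDir_sq i j
      have hA : -1 < (P.relDir i j).re := by
        by_contra hc
        have h1 : (P.relDir i j).re = -1 := by nlinarith [sq_nonneg (P.relDir i j).im]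
        have h2 : (P.relDir i j).im = 0 := by
          rw [h1] at hsq
          have : (P.relDir i j).im ^ 2 = 0 := by linarith
          exact pow_eq_zero_iff (two_ne_zero) |>.1 this
        exact hr (Complex.ext (by simpa using h1) (by simpa using h2))
      have hc : ContinuousAt (fun u => -Real.cos u) 0 := by fun_prop
      filter_upwards [hc.eventually_lt_const (u := (P.relDir i j).re) (by simpa using hA)]
        with u hu _ using hu
  obtain ⟨r₁, hr₁, h₁⟩ := Metric.eventually_nhds_iff.1 ev1
  obtain ⟨r₂, hr₂, h₂⟩ := Metric.eventually_nhds_iff.1 ev2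
  refine ⟨min r₁ (r₂ / 2), lt_min hr₁ (by linarith), ?_⟩
  intro i s θ j s' k s'' hs' hs'' hθ hθ1
  by_contra hθ2
  rw [not_le] at hθ2
  have e : ∀ a b : ℝ, |a| < min r₁ (r₂ / 2) → |b| < min r₁ (r₂ / 2) → dist (a + b) 0 < r₂ := by
    intro a b ha hb
    rw [Real.dist_eq, sub_zero]
    have := abs_add_le a b
    linarith [ha.trans_le (min_le_right _ _), hb.trans_le (min_le_right _ _)]
  have hfo : |f (P.outAngle i j θ)| < min r₁ (r₂ / 2) := by
    refine lt_of_le_of_lt (hl _ hs'.outAngle_mem) (lt_of_le_of_lt ?_ hθ1)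
    exact mul_le_of_le_one_left (abs_nonneg _) hl1.le
  have hij : P.relDir i j = -1 := by
    by_contra hc
    have := h₂ (e _ _ hθ hθ1) i j hc
    rw [hs'.relDir_re] at this
    exact lt_irrefl _ this
  have hjk : P.relDir j k = -1 := by
    by_contra hc
    have := h₂ (e _ _ hfo hθ2) j k hc
    rw [hs''.relDir_re] at this
    exact lt_irrefl _ this
  have hs01 := P.openSide_subset i hs'.1
  exact h₁ (by rw [Real.dist_eq, sub_zero]; exact hθ.trans_le (min_le_left _ _)) s
    (Ioo_subset_Icc_self hs01) i j s' k s'' hs' hs'' hij hjk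

end PolygonalTable

/-! ### Growth of the horizontal expansion -/

namespace PolygonalTable

variable {d : ℕ} (P : PolygonalTable d)

variable {f : ℝ → ℝ}

/-- The expansion coefficient of the `n`-th iterate divided by the cosine of the initial angle. -/
def growth (f : ℝ → ℝ) : ℕ → ℝ × ℝ → ℝ
  | 0, x => (Real.cos x.2)⁻¹
  | n + 1, x => Real.cos (f (P.specularMap x).2) / Real.cos (P.specularMap x).2 *
      growth f n (P.billiardMap f x)

/-- The vectors based at an interior point of a side. -/
def regular : Set (ℝ × ℝ) :=
  {x | (∃ i, x.1 ∈ P.openSide i) ∧ x.2 ∈ Ioo (-(Real.pi / 2)) (Real.pi / 2)}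

variable {P}

lemma HitsSide.next_mem_regular (hf : IsContractingLaw f) {i j : Fin d} {s θ s' : ℝ}
    (h : P.HitsSide i s θ j s') : (s', f (P.outAngle i j θ)) ∈ P.regular :=
  ⟨⟨j, h.2.2.1⟩, hf.map_mem h.outAngle_mem⟩

lemma exists_hitsSide_of_regular {x : ℝ × ℝ} (hx : x ∈ P.regular) (h : x ∉ P.singularSet) :
    ∃ i j s', P.HitsSide i x.1 x.2 j s' := by
  obtain ⟨⟨i, hi⟩, hθ⟩ := hx
  exact ⟨i, exists_hitsSide_of_notMem hi hθ h⟩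

lemma billiardMap_mem_regular (hf : IsContractingLaw f) {x : ℝ × ℝ} (hx : x ∈ P.regular)
    (h : x ∉ P.singularSet) : P.billiardMap f x ∈ P.regular := by
  obtain ⟨i, j, s', hj⟩ := exists_hitsSide_of_regular hx h
  rw [show P.billiardMap f x = _ from hj.billiardMap_eq f]
  exact hj.next_mem_regular hf

lemma specularMap_snd_mem {x : ℝ × ℝ} (hx : x ∈ P.regular) (h : x ∉ P.singularSet) :
    (P.specularMap x).2 ∈ Ioo (-(Real.pi / 2)) (Real.pi / 2) := by
  obtain ⟨i, j, s', hj⟩ := exists_hitsSide_of_regular hx h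
  rw [show P.specularMap x = _ from hj.specularMap_eq]
  exact hj.outAngle_mem

lemma one_le_cos_div_cos (hf : IsContractingLaw f) {θ : ℝ}
    (hθ : θ ∈ Ioo (-(Real.pi / 2)) (Real.pi / 2)) : 1 ≤ Real.cos (f θ) / Real.cos θ := by
  obtain ⟨l, hl0, hl1, hl⟩ := hf.exists_contraction
  rw [one_le_div (Real.cos_pos_of_mem_Ioo hθ), ← Real.cos_abs θ, ← Real.cos_abs (f θ)]
  have h1 : |θ| < Real.pi / 2 := abs_lt.2 hθ
  refine Real.cos_le_cos_of_nonneg_of_le_pi (abs_nonneg _) (by linarith [Real.pi_pos]) ?_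
  exact (hl θ hθ).trans (mul_le_of_le_one_left (abs_nonneg _) hl1.le)

lemma one_le_growth (hf : IsContractingLaw f) (n : ℕ) : ∀ x ∈ P.regular,
    x ∉ P.singularSetIter f n → 1 ≤ P.growth f n x := by
  induction n with
  | zero =>
    intro x hx _
    exact (one_le_inv₀ (Real.cos_pos_of_mem_Ioo hx.2)).2 (Real.cos_le_one _)
  | succ n ih =>
    intro x hx h
    rw [mem_singularSetIter_succ, not_or] at h
    exact one_le_mul_of_one_le_of_one_le (one_le_cos_div_cos hf (specularMap_snd_mem hx h.1))
      (ih _ (billiardMap_mem_regular hf hx h.1) h.2)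

lemma growth_le_growth_succ (hf : IsContractingLaw f) {n : ℕ} {x : ℝ × ℝ} (hx : x ∈ P.regular)
    (h : x ∉ P.singularSetIter f (n + 1)) {c : ℝ}
    (h' : c ≤ Real.cos (f (P.specularMap x).2) / Real.cos (P.specularMap x).2) :
    c * P.growth f n (P.billiardMap f x) ≤ P.growth f (n + 1) x := by
  rw [mem_singularSetIter_succ, not_or] at h
  have := one_le_growth hf n _ (billiardMap_mem_regular hf hx h.1) h.2
  exact mul_le_mul_of_nonneg_right h' (by linarith)

/-- A single grazing collision suffices: its denominator is below η, while the numerator is at least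
c = cos(lπ/2) because f keeps angles away from ±π/2. The other factors are at least 1. The constant
c does not depend on η or n. -/
lemma exists_growth_of_grazing (hf : IsContractingLaw f) :
    ∃ c > 0, ∀ η > 0, ∀ n, ∀ x ∈ P.regular, x ∉ P.singularSetIter f n →
      x ∉ P.nonGrazing f η n → c / η ≤ P.growth f n x := by
  obtain ⟨l, hl0, hl1, hl⟩ := hf.exists_contraction
  have hπ := Real.pi_pos
  have hlπ : l * (Real.pi / 2) < Real.pi / 2 := by nlinarith
  refine ⟨Real.cos (l * (Real.pi / 2)), Real.cos_pos_of_mem_Ioo ⟨?_, hlπ⟩, fun η hη n => ?_⟩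
  · have : 0 ≤ l * (Real.pi / 2) := by positivity
    linarith
  induction n with
  | zero => intro x _ _ h; exact absurd (mem_univ x) h
  | succ n ih =>
    intro x hx h hng
    have hN := h
    rw [mem_singularSetIter_succ, not_or] at h
    have hθ := specularMap_snd_mem hx h.1
    have hreg := billiardMap_mem_regular hf hx h.1
    by_cases hg : η ≤ Real.cos (P.specularMap x).2
    · have h1 : P.billiardMap f x ∉ P.nonGrazing f η n := fun h2 => hng ⟨hg, h2⟩
      have := growth_le_growth_succ hf hx hN (one_le_cos_div_cos hf hθ)
      rw [one_mul] at this
      exact (ih _ hreg h.2 h1).trans this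
    · rw [not_le] at hg
      have hcos := Real.cos_pos_of_mem_Ioo hθ
      have h1 : Real.cos (l * (Real.pi / 2)) ≤ Real.cos (f (P.specularMap x).2) := by
        rw [← Real.cos_abs (f _)]
        have h2 : |(P.specularMap x).2| < Real.pi / 2 := abs_lt.2 hθ
        refine Real.cos_le_cos_of_nonneg_of_le_pi (abs_nonneg _) (by linarith) ?_
        exact (hl _ hθ).trans (mul_le_mul_of_nonneg_left h2.le hl0)
      have hc0 : 0 ≤ Real.cos (l * (Real.pi / 2)) := by
        refine Real.cos_nonneg_of_mem_Icc ⟨?_, hlπ.le⟩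
        have : 0 ≤ l * (Real.pi / 2) := by positivity
        linarith
      have h3 : Real.cos (l * (Real.pi / 2)) / η ≤
          Real.cos (f (P.specularMap x).2) / Real.cos (P.specularMap x).2 :=
        div_le_div₀ (hc0.trans h1) h1 hcos hg.le
      have h4 := growth_le_growth_succ hf hx hN h3
      have h5 := one_le_growth hf n _ hreg h.2
      refine le_trans ?_ h4
      exact le_mul_of_one_le_right (by positivity) h5

lemma exists_expansion_rate (hf : IsContractingLaw f) {κ : ℝ} (hκ : 0 < κ) :
    ∃ σ > 1, ∀ θ ∈ Ioo (-(Real.pi / 2)) (Real.pi / 2), κ ≤ |θ| →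
      σ ≤ Real.cos (f θ) / Real.cos θ := by
  obtain ⟨l, hl0, hl1, hl⟩ := hf.exists_contraction
  have hπ := Real.pi_pos
  by_cases hκπ : Real.pi / 2 ≤ κ
  · exact ⟨2, by norm_num, fun θ hθ h => absurd (abs_lt.2 hθ) (not_lt.2 (hκπ.trans h))⟩
  rw [not_le] at hκπ
  have hlx : ∀ x ∈ Icc κ (Real.pi / 2), 0 < Real.cos (l * x) := by
    intro x hx
    have h1 : 0 < x := hκ.trans_le hx.1
    have h2 : 0 ≤ l * x := by positivity
    have h3 : l * x < x := by nlinarith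
    exact Real.cos_pos_of_mem_Ioo ⟨by linarith, by linarith [hx.2]⟩
  -- The maximum of this ratio on [κ, π/2] is below 1 because l < 1; its inverse is the rate.
  have hcont : ContinuousOn (fun x => Real.cos x / Real.cos (l * x)) (Icc κ (Real.pi / 2)) :=
    ContinuousOn.div (by fun_prop) (by fun_prop) fun x hx => (hlx x hx).ne'
  obtain ⟨x₀, hx₀, hmax⟩ := isCompact_Icc.exists_isMaxOn ⟨κ, le_rfl, hκπ.le⟩ hcont
  set μ := Real.cos x₀ / Real.cos (l * x₀) with hμ
  have hμ1 : μ < 1 := by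
    rw [hμ, div_lt_one (hlx x₀ hx₀)]
    have h1 : 0 < x₀ := hκ.trans_le hx₀.1
    exact Real.cos_lt_cos_of_nonneg_of_le_pi (by positivity) (by linarith [hx₀.2]) (by nlinarith)
  have hμ0 : 0 < μ := by
    refine lt_of_lt_of_le ?_ (hmax (⟨le_rfl, hκπ.le⟩ : κ ∈ Icc κ (Real.pi / 2)))
    exact div_pos (Real.cos_pos_of_mem_Ioo ⟨by linarith, hκπ⟩) (hlx κ ⟨le_rfl, hκπ.le⟩)
  refine ⟨μ⁻¹, (one_lt_inv₀ hμ0).2 hμ1, fun θ hθ h => ?_⟩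
  have hθ' : |θ| < Real.pi / 2 := abs_lt.2 hθ
  have hm : |θ| ∈ Icc κ (Real.pi / 2) := ⟨h, hθ'.le⟩
  have h1 : Real.cos |θ| / Real.cos (l * |θ|) ≤ μ := hmax hm
  have h2 : Real.cos (l * |θ|) ≤ Real.cos (f θ) := by
    rw [← Real.cos_abs (f θ)]
    have h3 : l * |θ| ≤ |θ| := mul_le_of_le_one_left (abs_nonneg _) hl1.le
    exact Real.cos_le_cos_of_nonneg_of_le_pi (abs_nonneg _) (by linarith) (hl θ hθ)
  have hc := Real.cos_pos_of_mem_Ioo hθ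
  rw [div_le_iff₀ (hlx _ hm), Real.cos_abs] at h1
  rw [le_div_iff₀ hc, inv_mul_le_iff₀ hμ0]
  exact h1.trans (mul_le_mul_of_nonneg_left h2 hμ0.le)

/-- Exponential growth of the expansion coefficients. -/
lemma exists_pow_le_growth (hf : IsContractingLaw f) (hP : P.NoParallelSidesFacing) :
    ∃ σ > 1, ∀ n, ∀ x ∈ P.regular, x ∉ P.singularSetIter f n →
      σ ^ (n / 3) ≤ P.growth f n x := by
  obtain ⟨κ, hκ, hang⟩ := exists_uniform_angle hf hP
  obtain ⟨σ, hσ, hexp⟩ := exists_expansion_rate hf hκ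
  obtain ⟨l, hl0, hl1, hl⟩ := hf.exists_contraction
  have hσ0 : 0 ≤ σ := by linarith
  refine ⟨σ, hσ, fun n => ?_⟩
  induction n using Nat.strong_induction_on with
  | _ n ih =>
  intro x hx hN
  rcases lt_or_ge n 3 with h3 | h3
  · rw [Nat.div_eq_of_lt h3, pow_zero]
    exact one_le_growth hf n x hx hN
  obtain ⟨m, rfl⟩ : ∃ m, n = m + 3 := ⟨n - 3, by omega⟩
  have hN1 := hN
  rw [mem_singularSetIter_succ, not_or] at hN1
  obtain ⟨hx1, hN2⟩ := hN1
  have hr1 := billiardMap_mem_regular hf hx hx1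
  have hN2' := hN2
  rw [mem_singularSetIter_succ, not_or] at hN2'
  obtain ⟨hx2, hN3⟩ := hN2'
  have hr2 := billiardMap_mem_regular hf hr1 hx2
  have hN3' := hN3
  rw [mem_singularSetIter_succ, not_or] at hN3'
  obtain ⟨hx3, hN4⟩ := hN3'
  have hr3 := billiardMap_mem_regular hf hr2 hx3
  have hθ1 := specularMap_snd_mem hx hx1
  have hθ2 := specularMap_snd_mem hr1 hx2
  have hθ3 := specularMap_snd_mem hr2 hx3
  have hρ1 := one_le_cos_div_cos hf hθ1
  have hρ2 := one_le_cos_div_cos hf hθ2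
  have hρ3 := one_le_cos_div_cos hf hθ3
  have hIH := ih m (by omega) _ hr3 hN4
  -- The uniform angle is applied to the flights that follow the first collision: the angle at which
  -- the first of them starts is the contraction by f of a specular angle smaller than κ.
  have hcase : κ ≤ |(P.specularMap x).2| ∨ κ ≤ |(P.specularMap (P.billiardMap f x)).2| ∨
      κ ≤ |(P.specularMap (P.billiardMap f (P.billiardMap f x))).2| := by
    by_contra hc
    push Not at hc
    obtain ⟨c1, c2, c3⟩ := hc
    obtain ⟨i, j, s, hj⟩ := exists_hitsSide_of_regular hx hx1
    have e1 : P.billiardMap f x = _ := hj.billiardMap_eq f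
    have e1' : P.specularMap x = _ := hj.specularMap_eq
    rw [e1'] at c1
    obtain ⟨j', k, t, hk⟩ := exists_hitsSide_of_regular hr1 hx2
    obtain rfl : j = j' := by
      have := hk.1
      rw [e1] at this
      exact P.openSide_unique hj.2.2.1 this
    rw [e1] at hk
    have e2 : P.billiardMap f (s, f (P.outAngle i j x.2)) = _ := hk.billiardMap_eq f
    rw [e1, show P.specularMap (s, f (P.outAngle i j x.2)) = _ from hk.specularMap_eq] at c2
    obtain ⟨k', m', u, hm⟩ := exists_hitsSide_of_regular hr2 hx3
    rw [e1, e2] at hm c3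
    obtain rfl : k = k' := P.openSide_unique hk.2.2.1 hm.1
    rw [show P.specularMap (t, f (P.outAngle j k (f (P.outAngle i j x.2)))) = _ from
      hm.specularMap_eq] at c3
    have c1' : |f (P.outAngle i j x.2)| < κ :=
      lt_of_le_of_lt ((hl _ hj.outAngle_mem).trans
        (mul_le_of_le_one_left (abs_nonneg _) hl1.le)) c1
    have hle := hang j s _ k t m' u hk hm c1' c2
    exact absurd c3 (not_lt.2 hle)
  rw [Nat.add_div_right _ (by norm_num), pow_succ']
  have hm1 := one_le_growth hf m _ hr3 hN4
  have g3 := growth_le_growth_succ hf hr2 hN3 hρ3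
  have g2 := growth_le_growth_succ hf hr1 hN2 hρ2
  have g1 := growth_le_growth_succ hf hx hN hρ1
  rw [one_mul] at g1 g2 g3
  have hmul := mul_le_mul_of_nonneg_left hIH hσ0
  rcases hcase with hc | hc | hc
  · have g1' := growth_le_growth_succ hf hx hN (hexp _ hθ1 hc)
    have := mul_le_mul_of_nonneg_left (g3.trans g2) hσ0
    exact hmul.trans (this.trans g1')
  · have g2' := growth_le_growth_succ hf hr1 hN2 (hexp _ hθ2 hc)
    have := mul_le_mul_of_nonneg_left g3 hσ0
    exact hmul.trans (this.trans (g2'.trans g1))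
  · have g3' := growth_le_growth_succ hf hr2 hN3 (hexp _ hθ3 hc)
    exact hmul.trans (g3'.trans (g2.trans g1))

lemma HitsSide.eventuallyEq_billiardMap {i j : Fin d} {s θ s' : ℝ} (h : P.HitsSide i s θ j s')
    (f : ℝ → ℝ) : P.billiardMap f =ᶠ[𝓝 (s, θ)]
      fun x => (P.hitCoord i j x.1 x.2, f (P.outAngle i j x.2)) := by
  filter_upwards [h.eventually] with x hx
  exact hx.billiardMap_eq f

lemma HitsSide.differentiableAt_billiardMap (hf : IsContractingLaw f) {i j : Fin d} {s θ s' : ℝ}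
    (h : P.HitsSide i s θ j s') : DifferentiableAt ℝ (P.billiardMap f) (s, θ) := by
  refine DifferentiableAt.congr_of_eventuallyEq ?_ (h.eventuallyEq_billiardMap f)
  have hcos := (Real.cos_pos_of_mem_Ioo h.2.1).ne'
  refine DifferentiableAt.prodMk ?_ ?_
  · have ht : DifferentiableAt ℝ (fun x : ℝ × ℝ => Real.tan x.2) (s, θ) :=
      DifferentiableAt.comp (g := Real.tan) (s, θ) (Real.differentiableAt_tan.2 hcos)
        differentiableAt_snd
    have hnum : DifferentiableAt ℝ (fun x : ℝ × ℝ => x.1 - (P.relBase i j).re +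
        (P.relBase i j).im * Real.tan x.2) (s, θ) :=
      (differentiableAt_fst.sub_const _).add (ht.const_mul _)
    have hden : DifferentiableAt ℝ (fun x : ℝ × ℝ => (P.relDir i j).re -
        (P.relDir i j).im * Real.tan x.2) (s, θ) := (ht.const_mul _).const_sub _
    simp only [hitCoord, div_eq_mul_inv]
    exact hnum.fun_mul (hden.fun_inv h.slope_neg.ne)
  · have ho : DifferentiableAt ℝ (fun x : ℝ × ℝ => P.outAngle i j x.2) (s, θ) := by
      have h1 := h.outAngle_mem
      have h2 := P.sin_outAngle i j θ
      unfold outAngle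
      refine DifferentiableAt.comp (g := Real.arcsin) (s, θ)
        (Real.differentiableAt_arcsin.2 ⟨?_, ?_⟩) (by fun_prop)
      all_goals
        simp only
        rw [← h2]
        have h3 := Real.sin_sq_add_cos_sq (P.outAngle i j θ)
        have h4 := Real.cos_pos_of_mem_Ioo h1
        intro h5
        rw [h5] at h3
        nlinarith
    exact DifferentiableAt.comp (g := f) (s, θ) (hf.differentiableAt h.outAngle_mem) ho

lemma HitsSide.fderiv_billiardMap (hf : IsContractingLaw f) {i j : Fin d} {s θ s' : ℝ}
    (h : P.HitsSide i s θ j s') : fderiv ℝ (P.billiardMap f) (s, θ) (1, 0) =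
      (((P.relDir i j).re - (P.relDir i j).im * Real.tan θ)⁻¹, 0) := by
  have h1 := (h.differentiableAt_billiardMap hf).hasFDerivAt
  have h2 : HasDerivAt (fun t : ℝ => (t, θ)) ((1 : ℝ), (0 : ℝ)) s :=
    (hasDerivAt_id s).prodMk (hasDerivAt_const s θ)
  have h3 := h1.comp_hasDerivAt (f := fun t : ℝ => (t, θ)) s h2
  have h4 : HasDerivAt (fun t : ℝ => (P.hitCoord i j t θ, f (P.outAngle i j θ)))
      (((P.relDir i j).re - (P.relDir i j).im * Real.tan θ)⁻¹, 0) s := by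
    refine HasDerivAt.prodMk ?_ (hasDerivAt_const s _)
    unfold hitCoord
    simpa [div_eq_mul_inv] using (((hasDerivAt_id s).sub_const (P.relBase i j).re).add_const
      ((P.relBase i j).im * Real.tan θ)).div_const
        ((P.relDir i j).re - (P.relDir i j).im * Real.tan θ)
  have h5 : P.billiardMap f ∘ (fun t : ℝ => (t, θ)) =ᶠ[𝓝 s]
      fun t : ℝ => (P.hitCoord i j t θ, f (P.outAngle i j θ)) :=
    h2.continuousAt.eventually (h.eventuallyEq_billiardMap f)
  exact h3.unique (h4.congr_of_eventuallyEq h5)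

/-- The horizontal direction is preserved, so the chain rule multiplies scalars. Each flight
stretches by the ratio of the cosines at its two ends, and `growth` regroups these by collision. -/
lemma fderiv_iterate_billiardMap (hf : IsContractingLaw f) (n : ℕ) : ∀ x ∈ P.regular,
    x ∉ P.singularSetIter f n → DifferentiableAt ℝ (P.billiardMap f)^[n] x ∧
      ∃ a : ℝ, fderiv ℝ (P.billiardMap f)^[n] x (1, 0) = (a, 0) ∧
        |a| = Real.cos x.2 * P.growth f n x := by
  induction n with
  | zero =>
    intro x hx _
    refine ⟨differentiableAt_id, 1, by simp, ?_⟩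
    rw [growth, mul_inv_cancel₀ (Real.cos_pos_of_mem_Ioo hx.2).ne', abs_one]
  | succ n ih =>
    intro x hx h
    rw [mem_singularSetIter_succ, not_or] at h
    obtain ⟨hd, a, ha, ha'⟩ := ih _ (billiardMap_mem_regular hf hx h.1) h.2
    obtain ⟨i, j, s', hj⟩ := exists_hitsSide_of_regular hx h.1
    have h1 : DifferentiableAt ℝ (P.billiardMap f) x := hj.differentiableAt_billiardMap hf
    have h2 : fderiv ℝ (P.billiardMap f) x (1, 0) = _ := hj.fderiv_billiardMap hf
    rw [Function.iterate_succ]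
    refine ⟨hd.comp x h1, ((P.relDir i j).re - (P.relDir i j).im * Real.tan x.2)⁻¹ * a, ?_, ?_⟩
    · rw [fderiv_comp x hd h1, ContinuousLinearMap.comp_apply, h2]
      have : ((((P.relDir i j).re - (P.relDir i j).im * Real.tan x.2)⁻¹, 0) : ℝ × ℝ) =
          ((P.relDir i j).re - (P.relDir i j).im * Real.tan x.2)⁻¹ • ((1 : ℝ), (0 : ℝ)) := by
        simp
      rw [this, map_smul, ha]
      simp
    · have e1 : P.specularMap x = _ := hj.specularMap_eq
      have e2 : P.billiardMap f x = _ := hj.billiardMap_eq f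
      have hc := (Real.cos_pos_of_mem_Ioo hx.2).ne'
      have hc' := (Real.cos_pos_of_mem_Ioo hj.outAngle_mem).ne'
      have hs := hj.slope_neg
      rw [abs_mul, ha', growth, e1, e2, abs_inv, abs_of_neg hs]
      have e3 : Real.cos (P.outAngle i j x.2) =
          -((P.relDir i j).re - (P.relDir i j).im * Real.tan x.2) * Real.cos x.2 := by
        rw [hj.cos_outAngle, ← tan_mul_cos' hx.2]; ring
      rw [e3]
      have hs' : -((P.relDir i j).re - (P.relDir i j).im * Real.tan x.2) ≠ 0 := by linarith
      field_simp

lemma expansion_eq (hf : IsContractingLaw f) {n : ℕ} {x : ℝ × ℝ} (hx : x ∈ P.regular)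
    (h : x ∉ P.singularSetIter f n) :
    P.expansion f n x = ENNReal.ofReal (Real.cos x.2 * P.growth f n x) := by
  obtain ⟨-, a, ha, ha'⟩ := fderiv_iterate_billiardMap hf n x hx h
  rw [expansion, ha, ← ha', ← ofReal_norm, WithLp.prod_norm_eq_of_L2]
  simp [Real.sqrt_sq_eq_abs]

end PolygonalTable

/-! ### Periodicity, and segments that are not cut -/

namespace PolygonalTable

variable {d : ℕ} (P : PolygonalTable d)

variable {P} {f : ℝ → ℝ}

lemma bdry_add_intCast (s : ℝ) (k : ℤ) : P.bdry (s + k) = P.bdry s := by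
  rw [← P.bdry_fract, Int.fract_add_intCast, P.bdry_fract]

lemma deriv_bdry_add_intCast (s : ℝ) (k : ℤ) : deriv P.bdry (s + k) = deriv P.bdry s := by
  rw [← deriv_comp_add_const, funext fun s => P.bdry_add_intCast s k]

lemma specularMap_add_intCast (x : ℝ × ℝ) (k : ℤ) :
    P.specularMap (x.1 + k, x.2) = P.specularMap x := by
  simp only [specularMap, hitParam, hitPoint, flightTime, velocity, bdry_add_intCast,
    deriv_bdry_add_intCast]

lemma billiardMap_add_intCast (x : ℝ × ℝ) (k : ℤ) :
    P.billiardMap f (x.1 + k, x.2) = P.billiardMap f x := by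
  simp only [billiardMap, specularMap_add_intCast]

lemma add_intCast_mem_singularSet {x : ℝ × ℝ} (k : ℤ) :
    (x.1 + k, x.2) ∈ P.singularSet ↔ x ∈ P.singularSet := by
  simp only [singularSet, vertexSet, hitVertexSet, phaseBoundary, hitPoint, flightTime, velocity,
    bdry_add_intCast, deriv_bdry_add_intCast, mem_union, mem_ofPred_eq]

lemma add_intCast_mem_singularSetIter {n : ℕ} {x : ℝ × ℝ} (k : ℤ) :
    (x.1 + k, x.2) ∈ P.singularSetIter f n ↔ x ∈ P.singularSetIter f n := by
  rcases n with _ | n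
  · simp [singularSetIter_zero]
  · rw [mem_singularSetIter_succ, mem_singularSetIter_succ, add_intCast_mem_singularSet,
      billiardMap_add_intCast]

lemma add_intCast_mem_nonGrazing {η : ℝ} {n : ℕ} {x : ℝ × ℝ} (k : ℤ) :
    (x.1 + k, x.2) ∈ P.nonGrazing f η n ↔ x ∈ P.nonGrazing f η n := by
  rcases n with _ | n
  · simp [nonGrazing]
  · simp only [nonGrazing, mem_ofPred_eq, billiardMap_add_intCast, specularMap_add_intCast]

lemma add_intCast_mem_firstSingular {η : ℝ} {n : ℕ} {x : ℝ × ℝ} (k : ℤ) :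
    (x.1 + k, x.2) ∈ P.firstSingular f η n ↔ x ∈ P.firstSingular f η n := by
  rcases n with _ | n
  · simp only [firstSingular_zero, add_intCast_mem_singularSet]
  · simp only [mem_firstSingular_succ, add_intCast_mem_singularSet, billiardMap_add_intCast,
      specularMap_add_intCast]

/-- The first application of the map absorbs the translation; the zeroth iterate, the identity, is
not periodic as a map of the plane. -/
lemma expansion_add_intCast {n : ℕ} (hn : n ≠ 0) (x : ℝ × ℝ) (k : ℤ) :
    P.expansion f n (x.1 + k, x.2) = P.expansion f n x := by
  obtain ⟨n, rfl⟩ := Nat.exists_eq_succ_of_ne_zero hn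
  have h : (fun y : ℝ × ℝ => (P.billiardMap f)^[n.succ] (y + ((k : ℝ), (0 : ℝ)))) =
      (P.billiardMap f)^[n.succ] := by
    funext y
    rw [Function.iterate_succ_apply, Function.iterate_succ_apply, ← billiardMap_add_intCast y k]
    congr 2
    ext <;> simp
  have h2 : ((x.1 + k, x.2) : ℝ × ℝ) = x + ((k : ℝ), (0 : ℝ)) := by ext <;> simp
  rw [expansion, expansion, h2, ← fderiv_comp_add_right, h]

lemma exists_sub_floor_mem_openSide {s θ : ℝ} (hθ : θ ∈ Ioo (-(Real.pi / 2)) (Real.pi / 2))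
    (h : (s, θ) ∉ P.singularSet) : ∃ i, s - ⌊s⌋ ∈ P.openSide i := by
  obtain ⟨i, hi⟩ := P.exists_mem_Ico (s := Int.fract s) ⟨Int.fract_nonneg s, Int.fract_lt_one s⟩
  refine ⟨i, lt_of_le_of_ne hi.1 fun he => h ?_, hi.2⟩
  refine Or.inl (Or.inl ⟨?_, hθ⟩)
  rw [← P.bdry_fract]
  exact ⟨i.castSucc, congrArg P.bdry he⟩

lemma sub_floor_mem_regular {x : ℝ × ℝ} (hθ : x.2 ∈ Ioo (-(Real.pi / 2)) (Real.pi / 2))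
    (h : x ∉ P.singularSet) : (x.1 - ⌊x.1⌋, x.2) ∈ P.regular :=
  ⟨exists_sub_floor_mem_openSide hθ h, hθ⟩

lemma sub_mem_openSide_of_ordConnected {K : Set ℝ} (hK : K.OrdConnected) {θ : ℝ}
    (hθ : θ ∈ Ioo (-(Real.pi / 2)) (Real.pi / 2)) (h : ∀ s ∈ K, (s, θ) ∉ P.singularSet)
    {i : Fin d} {k : ℤ} {a b : ℝ} (ha : a ∈ K) (hai : a - k ∈ P.openSide i) (hb : b ∈ K) :
    b - k ∈ P.openSide i := by
  have hc : ∀ c : Fin (d + 1), P.corner c + k ∉ K := fun c hc =>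
    h _ hc (Or.inl (Or.inl ⟨by rw [bdry_add_intCast]; exact ⟨c, rfl⟩, hθ⟩))
  obtain ⟨h1, h2⟩ := hai
  refine ⟨?_, ?_⟩
  · by_contra h3
    exact hc i.castSucc (hK.out hb ha ⟨by linarith, by linarith⟩)
  · by_contra h3
    exact hc i.succ (hK.out ha hb ⟨by linarith, by linarith⟩)

/-- Vectors of a horizontal segment that is not cut have the same angles of collision. -/
lemma nonGrazing_of_isPreconnected (hf : IsContractingLaw f) {η : ℝ} (m : ℕ) :
    ∀ {K : Set ℝ} {θ : ℝ}, IsPreconnected K → θ ∈ Ioo (-(Real.pi / 2)) (Real.pi / 2) →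
      (∀ s ∈ K, (s, θ) ∉ P.singularSetIter f m) → ∀ a ∈ K, ∀ b ∈ K,
        (a, θ) ∈ P.nonGrazing f η m → (b, θ) ∈ P.nonGrazing f η m := by
  induction m with
  | zero => intro K θ _ _ _ a _ b _ _; trivial
  | succ m ih =>
    intro K θ hK hθ h a ha b hb hng
    have h0 : ∀ s ∈ K, (s, θ) ∉ P.singularSet := fun s hs h' =>
      h s hs (mem_singularSetIter_succ.2 (Or.inl h'))
    obtain ⟨i, hi⟩ := exists_sub_floor_mem_openSide hθ (h0 a ha)
    set k := ⌊a⌋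
    have hside : ∀ s ∈ K, s - k ∈ P.openSide i := fun s hs =>
      sub_mem_openSide_of_ordConnected hK.ordConnected hθ h0 ha hi hs
    have hshift : ∀ s : ℝ, ((s, θ) : ℝ × ℝ) = ((s - k, θ).1 + k, (s - k, θ).2) := by
      intro s; simp
    have h0' : ∀ s ∈ K, (s - k, θ) ∉ P.singularSet := fun s hs h' => by
      refine h0 s hs ?_
      rw [hshift s, add_intCast_mem_singularSet]
      exact h'
    obtain ⟨j, s', hj⟩ := exists_hitsSide_of_notMem (x := (a - k, θ)) hi hθ (h0' a ha)
    have hU : IsPreconnected ((fun s : ℝ => ((s - k, θ) : ℝ × ℝ)) '' K) :=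
      hK.image _ (by fun_prop)
    have hall : ∀ s ∈ K, P.HitsSide i (s - k) θ j (P.hitCoord i j (s - k) θ) := by
      intro s hs
      refine HitsSide.of_isPreconnected hU ?_ ?_ ?_ (mem_image_of_mem _ ha) (mem_image_of_mem _ hs)
        hj
      · rintro _ ⟨t, ht, rfl⟩; exact hside t ht
      · rintro _ ⟨t, ht, rfl⟩; exact hθ
      · rintro _ ⟨t, ht, rfl⟩ w hw
        exact h0' t ht (hw.mem_singularSet (hside t ht) hθ)
    have hmap : ∀ s ∈ K, P.billiardMap f (s, θ) =
        (P.hitCoord i j (s - k) θ, f (P.outAngle i j θ)) := by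
      intro s hs
      rw [hshift s, billiardMap_add_intCast, (hall s hs).billiardMap_eq]
    have hspec : ∀ s ∈ K, (P.specularMap (s, θ)).2 = P.outAngle i j θ := by
      intro s hs
      rw [hshift s, specularMap_add_intCast, (hall s hs).specularMap_eq]
    obtain ⟨hg, hng'⟩ := hng
    rw [hspec a ha] at hg
    refine ⟨by rw [hspec b hb]; exact hg, ?_⟩
    rw [hmap a ha] at hng'
    rw [hmap b hb]
    refine ih (K := (fun s => P.hitCoord i j (s - k) θ) '' K) (hK.image _ ?_)
      (hf.map_mem (hall a ha).outAngle_mem) ?_ _ (mem_image_of_mem _ ha) _ (mem_image_of_mem _ hb)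
      hng'
    · unfold hitCoord
      exact Continuous.continuousOn (by fun_prop)
    · rintro _ ⟨s, hs, rfl⟩ h'
      refine h s hs (mem_singularSetIter_succ.2 (Or.inr ?_))
      rw [hmap s hs]
      exact h'

lemma nonGrazing_anti {η : ℝ} {m n : ℕ} (h : m ≤ n) :
    P.nonGrazing f η n ⊆ P.nonGrazing f η m := by
  refine antitone_nat_of_succ_le (f := P.nonGrazing f η) (fun n => ?_) h
  induction n with
  | zero => exact subset_univ _
  | succ n ih => exact fun x hx => ⟨hx.1, ih hx.2⟩

lemma exists_mem_firstSingular {n : ℕ} {x : ℝ × ℝ} (h : x ∈ P.singularSetIter f n) :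
    ∃ m < n, x ∉ P.singularSetIter f m ∧ (P.billiardMap f)^[m] x ∈ P.singularSet := by
  classical
  rw [mem_singularSetIter] at h
  have h' : ∃ k, (P.billiardMap f)^[k] x ∈ P.singularSet := h.imp fun k hk => hk.2
  obtain ⟨k, hk, hx⟩ := h
  refine ⟨Nat.find h', (Nat.find_min' h' hx).trans_lt hk, fun h1 => ?_, Nat.find_spec h'⟩
  obtain ⟨l, hl, hx'⟩ := mem_singularSetIter.1 h1
  exact Nat.find_min h' hl hx'

/-- With η = -1 the nongrazing condition is void, so `firstSingular` then counts all the
singularities. -/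
lemma mem_nonGrazing_of_neg (m : ℕ) : ∀ x, x ∈ P.nonGrazing f (-1) m := by
  induction m with
  | zero => exact fun x => trivial
  | succ m ih => exact fun x => ⟨Real.neg_one_le_cos _, ih _⟩

/-- Periodic sets are counted side by side. -/
lemma encard_segment_le {S : Set (ℝ × ℝ)}
    (hS : ∀ (x : ℝ × ℝ) (k : ℤ), (x.1 + k, x.2) ∈ S ↔ x ∈ S) {B : ℕ} {a b θ : ℝ} (hab : b - a ≤ 1)
    (h : ∀ (i : Fin d) (k : Fin 2), {s : ℝ | s ∈ P.openSide i ∧ s + ⌊a⌋ + (k : ℕ) ∈ Ioo a b ∧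
      (s, θ) ∈ S}.encard ≤ B) :
    {s | s ∈ Ioo a b ∧ (s, θ) ∈ S}.encard ≤ (2 * d * (B + 1) : ℕ) := by
  -- A segment of length at most 1 meets at most two unit periods. The corner adjoined to each open
  -- side accounts for the summand 1 in B + 1.
  set T : Fin d × Fin 2 → Set ℝ := fun p => (fun s : ℝ => s + ⌊a⌋ + ((p.2 : ℕ) : ℝ)) ''
    ({s : ℝ | s ∈ P.openSide p.1 ∧ s + ⌊a⌋ + ((p.2 : ℕ) : ℝ) ∈ Ioo a b ∧ (s, θ) ∈ S} ∪
      {P.corner p.1.castSucc}) with hT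
  have hsub : {s | s ∈ Ioo a b ∧ (s, θ) ∈ S} ⊆ ⋃ p ∈ (Finset.univ : Finset (Fin d × Fin 2)), T p := by
    rintro s ⟨hs, hsS⟩
    obtain ⟨i, hi⟩ := P.exists_mem_Ico (s := Int.fract s) ⟨Int.fract_nonneg s, Int.fract_lt_one s⟩
    have hk : ∃ k : Fin 2, (⌊s⌋ : ℝ) = ⌊a⌋ + ((k : ℕ) : ℝ) := by
      have h1 : ⌊a⌋ ≤ ⌊s⌋ := Int.floor_mono hs.1.le
      have h2 : ⌊s⌋ < ⌊a⌋ + 2 := by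
        rw [Int.floor_lt]; push_cast; linarith [hs.2, Int.lt_floor_add_one a]
      rcases (by omega : ⌊s⌋ = ⌊a⌋ ∨ ⌊s⌋ = ⌊a⌋ + 1) with h3 | h3
      · exact ⟨0, by simp [h3]⟩
      · exact ⟨1, by simp [h3]⟩
    obtain ⟨k, hk⟩ := hk
    have he : s = Int.fract s + ⌊a⌋ + ((k : ℕ) : ℝ) := by
      rw [add_assoc, ← hk, Int.fract_add_floor]
    simp only [mem_iUnion]
    refine ⟨(i, k), Finset.mem_univ _, Int.fract s, ?_, he.symm⟩
    rcases eq_or_lt_of_le hi.1 with h4 | h4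
    · exact Or.inr h4.symm
    · refine Or.inl ⟨⟨h4, hi.2⟩, ?_, ?_⟩
      · simp only
        rw [← he]; exact hs
      · rw [← hS _ ⌊s⌋]
        simpa using hsS
  have hle : ∀ p, (T p).encard ≤ (B + 1 : ℕ) := by
    intro p
    refine (encard_image_le _ _).trans ((encard_union_le _ _).trans ?_)
    rw [encard_singleton]
    push_cast
    exact add_le_add_left (h p.1 p.2) 1
  refine (encard_le_encard hsub).trans ((Finset.set_encard_biUnion_le _ _).trans ?_)
  refine (Finset.sum_le_card_nsmul _ _ _ fun p _ => hle p).trans ?_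
  rw [Finset.card_univ, Fintype.card_prod, Fintype.card_fin, Fintype.card_fin, nsmul_eq_mul,
    mul_comm d 2]
  norm_cast

end PolygonalTable

/-! ### Counting components and summing the inverse expansions -/

namespace PolygonalTable

variable {d : ℕ} (P : PolygonalTable d)

variable {P} {f : ℝ → ℝ}

/-- On short horizontal segments the number of nongrazing singularities is controlled by the
number of sides. -/
lemma exists_forall_encard_firstSingular_le (hf : IsContractingLaw f) {η : ℝ} (hη : 0 < η)
    (n : ℕ) {ϑ : ℝ} (hϑ : ϑ < Real.pi / 2) :
    ∃ δ > 0, ∀ a b θ : ℝ, b - a ≤ δ → |θ| ≤ ϑ → ∀ m < n, ∀ (i : Fin d) (k : Fin 2),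
      {s : ℝ | s ∈ P.openSide i ∧ s + ⌊a⌋ + (k : ℕ) ∈ Ioo a b ∧
        (s, θ) ∈ P.firstSingular f η m}.encard ≤ d := by
  have hU : ∀ (m : ℕ) (i : Fin d) (x : ℝ × ℝ), ∃ U : Set (ℝ × ℝ),
      x.2 ∈ Ioo (-(Real.pi / 2)) (Real.pi / 2) → U ∈ 𝓝 x ∧ ∀ θ,
        {s | s ∈ P.openSide i ∧ (s, θ) ∈ U ∧ (s, θ) ∈ P.firstSingular f η m}.encard ≤ d := by
    intro m i x
    by_cases hx : x.2 ∈ Ioo (-(Real.pi / 2)) (Real.pi / 2)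
    · obtain ⟨U, h⟩ := exists_nhds_encard_firstSingular_le (P := P) hf hη m i x.1 hx
      exact ⟨U, fun _ => h⟩
    · exact ⟨univ, fun h => absurd h hx⟩
  choose U hU using hU
  -- A short segment that starts in [0, 1) may run past 1, where its points are read after
  -- subtracting k = 1. Finitely many conditions are imposed, so W y is a neighborhood and a
  -- Lebesgue number gives δ.
  set W : ℝ × ℝ → Set (ℝ × ℝ) := fun y => {x | ∀ m ∈ Finset.range n, ∀ (i : Fin d) (k : Fin 2),
    (x.1 - (k : ℕ), x.2) ∈ U m i (y.1 - (k : ℕ), y.2)} with hW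
  have hang : ∀ θ, |θ| ≤ ϑ → θ ∈ Ioo (-(Real.pi / 2)) (Real.pi / 2) := fun θ h =>
    abs_lt.1 (h.trans_lt hϑ)
  have hWn : ∀ y ∈ Icc (0 : ℝ) 1 ×ˢ Icc (-ϑ) ϑ, W y ∈ 𝓝 y := by
    rintro ⟨s, θ⟩ ⟨-, hθ⟩
    have hθ' := hang θ (abs_le.2 hθ)
    refine (Filter.eventually_all_finset _).2 fun m _ => Filter.eventually_all.2 fun i =>
      Filter.eventually_all.2 fun k => ?_
    have hc : ContinuousAt (fun x : ℝ × ℝ => (x.1 - ((k : ℕ) : ℝ), x.2)) (s, θ) := by fun_prop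
    exact hc.eventually (hU m i (s - (k : ℕ), θ) hθ').1
  obtain ⟨δ, hδ, hleb⟩ := Metric.uniformity_basis_dist.lebesgue_number_lemma_nhds'
    (U := fun y _ => W y) (isCompact_Icc.prod isCompact_Icc) hWn
  refine ⟨δ, hδ, fun a b θ hab hθ m hm i k => ?_⟩
  obtain ⟨y, hy⟩ := hleb (Int.fract a, θ)
    ⟨⟨Int.fract_nonneg a, (Int.fract_lt_one a).le⟩, abs_le.1 hθ⟩
  refine (encard_le_encard ?_).trans
    ((hU m i ((y : ℝ × ℝ).1 - (k : ℕ), (y : ℝ × ℝ).2) (hang _ (abs_le.2 y.2.2))).2 θ)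
  rintro s ⟨hs, hsk, hsN⟩
  refine ⟨hs, ?_, hsN⟩
  have h1 : ((s + (k : ℕ), θ) : ℝ × ℝ) ∈ W y := by
    refine hy ?_
    have h2 : dist ((Int.fract a, θ) : ℝ × ℝ) (s + (k : ℕ), θ) < δ := by
      rw [Prod.dist_eq, dist_self, max_lt_iff, Real.dist_eq, abs_lt]
      have := Int.fract_add_floor a
      obtain ⟨h3, h4⟩ := hsk
      exact ⟨⟨by linarith, by linarith⟩, hδ⟩
    exact h2
  have h2 := h1 m (Finset.mem_range.2 hm) i k
  simpa using h2

/-- Connected components of a horizontal segment cut by finitely many points are counted by the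
cuts at their right ends. -/
lemma encard_components_le {N : Set (ℝ × ℝ)} {a b θ : ℝ} {T : Set (Set (ℝ × ℝ))}
    (hT : T ⊆ componentsOf (Ioo a b ×ˢ {θ} \ N)) (hfin : {s | s ∈ Ioo a b ∧ (s, θ) ∈ N}.Finite)
    {Z : Set ℝ} (hZ : ∀ γ ∈ T, ∃ x, (x, θ) ∈ γ ∧ ∀ r, r ∈ Ioo x b → (r, θ) ∈ N →
      (∀ s ∈ Ico x r, (s, θ) ∉ N) → r ∈ Z) : T.encard ≤ Z.encard + 1 := by
  classical
  choose! x hxγ hx using hZ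
  have hmem : ∀ γ ∈ T, γ = connectedComponentIn (Ioo a b ×ˢ {θ} \ N) (x γ, θ) ∧
      (x γ, θ) ∈ Ioo a b ×ˢ {θ} \ N := by
    intro γ hγ
    obtain ⟨p, hp, rfl⟩ := hT hγ
    exact ⟨connectedComponentIn_eq (hxγ _ hγ), connectedComponentIn_subset _ _ (hxγ _ hγ)⟩
  have hle : ∀ γ ∈ T, ∀ γ' ∈ T, x γ ≤ x γ' → (∀ s ∈ Ioo (x γ) (x γ'), (s, θ) ∉ N) → γ = γ' := by
    intro γ hγ γ' hγ' h hs
    obtain ⟨h1, h2⟩ := hmem γ hγ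
    obtain ⟨h3, h4⟩ := hmem γ' hγ'
    have hpre : IsPreconnected (Icc (x γ) (x γ') ×ˢ ({θ} : Set ℝ)) :=
      isPreconnected_Icc.prod isPreconnected_singleton
    have hsub : Icc (x γ) (x γ') ×ˢ ({θ} : Set ℝ) ⊆ Ioo a b ×ˢ {θ} \ N := by
      rintro ⟨s, t⟩ ⟨hs1, ht⟩
      obtain rfl : t = θ := ht
      refine ⟨⟨⟨h2.1.1.1.trans_le hs1.1, hs1.2.trans_lt h4.1.1.2⟩, rfl⟩, ?_⟩
      rcases eq_or_lt_of_le hs1.1 with h5 | h5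
      · simp only at h5; rw [← h5]; exact h2.2
      rcases eq_or_lt_of_le hs1.2 with h6 | h6
      · simp only at h6; rw [h6]; exact h4.2
      exact hs s ⟨h5, h6⟩
    have h5 := hpre.subset_connectedComponentIn (x := (x γ, θ)) ⟨⟨le_rfl, h⟩, rfl⟩ hsub
      (⟨⟨h, le_rfl⟩, rfl⟩ : (x γ', θ) ∈ Icc (x γ) (x γ') ×ˢ ({θ} : Set ℝ))
    rw [h1, connectedComponentIn_eq h5, ← h3]
  have heq : ∀ γ ∈ T, ∀ γ' ∈ T, (∀ s, s ∈ Ioo (x γ) (x γ') ∨ s ∈ Ioo (x γ') (x γ) →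
      (s, θ) ∉ N) → γ = γ' := by
    intro γ hγ γ' hγ' hs
    rcases le_total (x γ) (x γ') with h | h
    · exact hle γ hγ γ' hγ' h fun s h' => hs s (Or.inl h')
    · exact (hle γ' hγ' γ hγ h fun s h' => hs s (Or.inr h')).symm
  set R : Set (ℝ × ℝ) → Set ℝ := fun γ => {r | r ∈ Ioo (x γ) b ∧ (r, θ) ∈ N} with hR
  have hsubR : ∀ γ ∈ T, R γ ⊆ {s | s ∈ Ioo a b ∧ (s, θ) ∈ N} := fun γ hγ r hr =>
    ⟨⟨(hmem γ hγ).2.1.1.1.trans hr.1.1, hr.1.2⟩, hr.2⟩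
  have hsplit : T ⊆ {γ | γ ∈ T ∧ (R γ).Nonempty} ∪ {γ | γ ∈ T ∧ ¬ (R γ).Nonempty} := by
    intro γ hγ
    by_cases h : (R γ).Nonempty
    · exact Or.inl ⟨hγ, h⟩
    · exact Or.inr ⟨hγ, h⟩
  refine (encard_le_encard hsplit).trans ((encard_union_le _ _).trans (add_le_add ?_ ?_))
  · have hmin : ∀ γ, γ ∈ T ∧ (R γ).Nonempty → ∃ r, r ∈ R γ ∧ ∀ s ∈ R γ, r ≤ s := by
      rintro γ ⟨hγ, h⟩
      obtain ⟨r, hr, h'⟩ := Set.exists_min_image (R γ) id (hfin.subset (hsubR γ hγ)) h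
      exact ⟨r, hr, h'⟩
    -- The first cut to the right of the chosen point of a component. It determines the component;
    -- those with no cut on their right coincide, which accounts for the summand 1.
    choose! g hg hgmin using hmin
    refine encard_le_encard_of_injOn (f := g) ?_ ?_
    · intro γ hγ
      have h1 := hg γ hγ
      refine hx γ hγ.1 _ h1.1 h1.2 fun s hs hN => ?_
      rcases eq_or_lt_of_le hs.1 with h5 | h5
      · rw [← h5] at hN
        exact (hmem γ hγ.1).2.2 hN
      · exact absurd (hgmin γ hγ s ⟨⟨h5, hs.2.trans h1.1.2⟩, hN⟩) (not_le.2 hs.2)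
    · intro γ hγ γ' hγ' he
      have h1 := hg γ hγ
      have h2 := hg γ' hγ'
      refine heq γ hγ.1 γ' hγ'.1 ?_
      rintro s (hs | hs) hN
      · have h3 := hgmin γ hγ s ⟨⟨hs.1, hs.2.trans (h2.1.1.trans h2.1.2)⟩, hN⟩
        rw [he] at h3
        exact absurd (h2.1.1.trans_le h3) (not_lt.2 hs.2.le)
      · have h3 := hgmin γ' hγ' s ⟨⟨hs.1, hs.2.trans (h1.1.1.trans h1.1.2)⟩, hN⟩
        rw [← he] at h3
        exact absurd (h1.1.1.trans_le h3) (not_lt.2 hs.2.le)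
  · refine encard_le_one_iff.2 fun γ γ' hγ hγ' => heq γ hγ.1 γ' hγ'.1 ?_
    rintro s (hs | hs) hN
    · exact hγ.2 ⟨s, ⟨hs.1, hs.2.trans (hmem γ' hγ'.1).2.1.1.2⟩, hN⟩
    · exact hγ'.2 ⟨s, ⟨hs.1, hs.2.trans (hmem γ hγ.1).2.1.1.2⟩, hN⟩

lemma encard_iUnion_lt_le {n : ℕ} {S : ℕ → Set (ℝ × ℝ)} {B : ℕ → ℕ} {I : Set ℝ} {θ : ℝ}
    (h : ∀ m < n, {s | s ∈ I ∧ (s, θ) ∈ S m}.encard ≤ B m) :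
    {s | s ∈ I ∧ ∃ m < n, (s, θ) ∈ S m}.encard ≤ (∑ m ∈ Finset.range n, B m : ℕ) := by
  have hsub : {s | s ∈ I ∧ ∃ m < n, (s, θ) ∈ S m} ⊆
      ⋃ m ∈ Finset.range n, {s | s ∈ I ∧ (s, θ) ∈ S m} := by
    rintro s ⟨hs, m, hm, hsm⟩
    simp only [mem_iUnion]
    exact ⟨m, Finset.mem_range.2 hm, hs, hsm⟩
  refine (encard_le_encard hsub).trans ((Finset.set_encard_biUnion_le _ _).trans ?_)
  push_cast
  exact Finset.sum_le_sum fun m hm => h m (Finset.mem_range.1 hm)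

/-- Linear in n, to be beaten by the exponential growth. The price is that δ depends on n and η. -/
lemma exists_encard_nonGrazing_le (hf : IsContractingLaw f) {η : ℝ} (hη : 0 < η)
    (n : ℕ) {ϑ : ℝ} (hϑ : ϑ < Real.pi / 2) :
    ∃ δ > 0, ∀ a b θ : ℝ, b - a ≤ δ → |θ| ≤ ϑ →
      {s | s ∈ Ioo a b ∧ ∃ m < n, (s, θ) ∈ P.firstSingular f η m}.encard ≤
        (n * (2 * d * (d + 1)) : ℕ) := by
  obtain ⟨δ, hδ, h⟩ := exists_forall_encard_firstSingular_le (P := P) hf hη n hϑ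
  refine ⟨min δ 1, lt_min hδ one_pos, fun a b θ hab hθ => ?_⟩
  refine (encard_iUnion_lt_le (B := fun _ => 2 * d * (d + 1)) fun m hm => ?_).trans (by simp)
  exact encard_segment_le (fun x k => add_intCast_mem_firstSingular k)
    (hab.trans (min_le_right _ _)) (h a b θ (hab.trans (min_le_left _ _)) hθ m hm)

/-- Exponential in n, but valid on all segments of length at most 1 and independent of η. It also
provides the finiteness needed to speak of the next cut. -/
lemma encard_singularSetIter_le (hf : IsContractingLaw f) (n : ℕ) {a b θ : ℝ} (hab : b - a ≤ 1)
    (hθ : θ ∈ Ioo (-(Real.pi / 2)) (Real.pi / 2)) :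
    {s | s ∈ Ioo a b ∧ (s, θ) ∈ P.singularSetIter f n}.encard ≤
      (∑ m ∈ Finset.range n, 2 * d * (d ^ (m + 1) + 1) : ℕ) := by
  refine le_trans (encard_le_encard ?_) (encard_iUnion_lt_le (θ := θ) (S := P.firstSingular f (-1))
    fun m hm => encard_segment_le (P := P) (fun x k => add_intCast_mem_firstSingular k) hab
      (B := d ^ (m + 1)) fun i k => ?_)
  · rintro s ⟨hs, h⟩
    obtain ⟨m, hm, h1, h2⟩ := exists_mem_firstSingular h
    exact ⟨hs, m, hm, h1, h2, mem_nonGrazing_of_neg m _⟩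
  · refine (encard_le_encard ?_).trans (encard_firstSingular_le (P := P) hf (η := -1) m i hθ)
    exact fun s hs => ⟨hs.1, hs.2.2⟩

/-- The components that contain a nongrazing vector are bounded by nongrazing singularities. -/
lemma encard_nonGrazing_components_le (hf : IsContractingLaw f) {η : ℝ} {n k : ℕ} {a b θ : ℝ}
    (hθ : θ ∈ Ioo (-(Real.pi / 2)) (Real.pi / 2))
    (hfin : {s | s ∈ Ioo a b ∧ (s, θ) ∈ P.singularSetIter f n}.Finite)
    (hk : {s | s ∈ Ioo a b ∧ ∃ m < n, (s, θ) ∈ P.firstSingular f η m}.encard ≤ k) :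
    {γ | γ ∈ componentsOf (Ioo a b ×ˢ {θ} \ P.singularSetIter f n) ∧
      ∃ x ∈ γ, x ∈ P.nonGrazing f η n}.encard ≤ k + 1 := by
  refine (encard_components_le (fun γ hγ => hγ.1) hfin ?_).trans (add_le_add_left hk 1)
  rintro γ ⟨⟨p, hp, rfl⟩, ⟨x, t⟩, hx, hng⟩
  have hx' := connectedComponentIn_subset _ _ hx
  obtain rfl : t = θ := hx'.1.2
  refine ⟨x, hx, fun r hr hrN hfree => ⟨⟨hx'.1.1.1.trans hr.1, hr.2⟩, ?_⟩⟩
  obtain ⟨m, hm, h1, h2⟩ := exists_mem_firstSingular hrN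
  refine ⟨m, hm, h1, h2, ?_⟩
  -- The segment from x to the cut r is not cut before time m, so r inherits the first m collision
  -- angles of the nongrazing vector x.
  refine nonGrazing_of_isPreconnected hf m (K := Icc x r) isPreconnected_Icc hθ (fun s hs => ?_)
    x ⟨le_rfl, hr.1.le⟩ r ⟨hr.1.le, le_rfl⟩ (nonGrazing_anti hm.le hng)
  rcases eq_or_lt_of_le hs.2 with h3 | h3
  · rw [h3]; exact h1
  · exact fun h4 => hfree s ⟨hs.1, h3⟩ (singularSetIter_mono hm.le h4)

lemma tsum_inv_leastExpansion_le {n : ℕ} {D : Set (Set (ℝ × ℝ))} {E : ENNReal} {k : ℕ∞}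
    (hE : ∀ γ ∈ D, ∀ x ∈ γ, E ≤ P.expansion f n x) (hk : D.encard ≤ k) :
    ∑' γ : D, (P.leastExpansion f n γ)⁻¹ ≤ k * E⁻¹ := by
  have h1 : ∑' γ : D, (P.leastExpansion f n γ)⁻¹ ≤ ∑' _ : D, E⁻¹ :=
    ENNReal.tsum_le_tsum fun γ => ENNReal.inv_le_inv.2 (le_iInf₂ (hE γ γ.2))
  refine h1.trans ?_
  rw [ENNReal.tsum_set_const]
  gcongr

lemma sub_floor_notMem {n : ℕ} {x : ℝ × ℝ} (hx : x ∉ P.singularSetIter f n) :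
    (x.1 - ⌊x.1⌋, x.2) ∉ P.singularSetIter f n := fun h => hx <| by
  simpa using (add_intCast_mem_singularSetIter (x := (x.1 - ⌊x.1⌋, x.2)) ⌊x.1⌋).2 h

lemma sub_floor_notMem_nonGrazing {η : ℝ} {n : ℕ} {x : ℝ × ℝ} (hx : x ∉ P.nonGrazing f η n) :
    (x.1 - ⌊x.1⌋, x.2) ∉ P.nonGrazing f η n := fun h => hx <| by
  simpa using (add_intCast_mem_nonGrazing (x := (x.1 - ⌊x.1⌋, x.2)) ⌊x.1⌋).2 h

lemma notMem_singularSet_of_notMem {n : ℕ} (hn : n ≠ 0) {x : ℝ × ℝ}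
    (hx : x ∉ P.singularSetIter f n) : x ∉ P.singularSet := fun h =>
  hx (mem_singularSetIter.2 ⟨0, Nat.pos_of_ne_zero hn, h⟩)

lemma ofReal_le_expansion (hf : IsContractingLaw f) {n : ℕ} (hn : n ≠ 0) {ϑ : ℝ}
    (hϑ : ϑ < Real.pi / 2) {x : ℝ × ℝ} (hθ : |x.2| ≤ ϑ) (hx : x ∉ P.singularSetIter f n) {G : ℝ}
    (hG : 0 ≤ G) (h : G ≤ P.growth f n (x.1 - ⌊x.1⌋, x.2)) :
    ENNReal.ofReal (Real.cos ϑ * G) ≤ P.expansion f n x := by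
  have hθ' : x.2 ∈ Ioo (-(Real.pi / 2)) (Real.pi / 2) := abs_lt.1 (hθ.trans_lt hϑ)
  have h1 := expansion_eq hf (sub_floor_mem_regular hθ' (notMem_singularSet_of_notMem hn hx))
    (sub_floor_notMem hx)
  have h2 := expansion_add_intCast (P := P) (f := f) hn (x.1 - ⌊x.1⌋, x.2) ⌊x.1⌋
  simp only [sub_add_cancel] at h2
  rw [h2, h1]
  refine ENNReal.ofReal_le_ofReal (mul_le_mul ?_ h hG (Real.cos_pos_of_mem_Ioo hθ').le)
  rw [← Real.cos_abs x.2]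
  exact Real.cos_le_cos_of_nonneg_of_le_pi (abs_nonneg _) (by linarith [Real.pi_pos]) hθ

/-- The expansion on short horizontal segments. -/
lemma exists_tsum_inv_leastExpansion_le (hf : IsContractingLaw f) {ϑ σ c η : ℝ}
    (hϑ : ϑ < Real.pi / 2) (hσ : 1 < σ) (hc : 0 < c) (hη : 0 < η) {n : ℕ} (hn : n ≠ 0)
    (hgrow : ∀ x ∈ P.regular, x ∉ P.singularSetIter f n → σ ^ (n / 3) ≤ P.growth f n x)
    (hgraz : ∀ x ∈ P.regular, x ∉ P.singularSetIter f n → x ∉ P.nonGrazing f η n →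
      c / η ≤ P.growth f n x) :
    ∃ δ₀ > 0, ∀ δ ≤ δ₀, ∀ Γ ∈ hCurves ϑ δ,
      ∑' γ : componentsOf (Γ \ P.singularSetIter f n), (P.leastExpansion f n γ)⁻¹ ≤
        ((n * (2 * d * (d + 1)) + 1 : ℕ) : ENNReal) *
            (ENNReal.ofReal (Real.cos ϑ * σ ^ (n / 3)))⁻¹ +
          ((∑ m ∈ Finset.range n, 2 * d * (d ^ (m + 1) + 1) + 1 : ℕ) : ENNReal) *
            (ENNReal.ofReal (Real.cos ϑ * (c / η)))⁻¹ := by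
  obtain ⟨δ₀, hδ₀, hcount⟩ := exists_encard_nonGrazing_le (P := P) hf hη n hϑ
  refine ⟨min δ₀ 1, lt_min hδ₀ one_pos, ?_⟩
  rintro δ hδ _ ⟨a, b, θ, hab, hlen, hθ, rfl⟩
  have hθ' : θ ∈ Ioo (-(Real.pi / 2)) (Real.pi / 2) := abs_lt.1 (hθ.trans_lt hϑ)
  have hall := encard_singularSetIter_le (P := P) hf n
    (hlen.trans (hδ.trans (min_le_right _ _))) hθ'
  have hfin := finite_of_encard_le_coe hall
  set D := componentsOf (Ioo a b ×ˢ {θ} \ P.singularSetIter f n) with hD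
  set T := {γ | γ ∈ D ∧ ∃ x ∈ γ, x ∈ P.nonGrazing f η n} with hT
  have hTle : T.encard ≤ ((n * (2 * d * (d + 1)) + 1 : ℕ) : ℕ∞) :=
    (encard_nonGrazing_components_le hf hθ' hfin
      (hcount a b θ (hlen.trans (hδ.trans (min_le_left _ _))) hθ)).trans (by push_cast; rfl)
  have hDle : (D \ T).encard ≤ ((∑ m ∈ Finset.range n, 2 * d * (d ^ (m + 1) + 1) + 1 : ℕ) : ℕ∞) := by
    refine (encard_components_le (N := P.singularSetIter f n) (a := a) (b := b) (θ := θ)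
      (Z := {s | s ∈ Ioo a b ∧ (s, θ) ∈ P.singularSetIter f n}) sdiff_subset hfin ?_).trans
        ((add_le_add_left hall 1).trans (by push_cast; rfl))
    rintro γ ⟨⟨⟨x, t⟩, hx, rfl⟩, -⟩
    obtain rfl : t = θ := hx.1.2
    exact ⟨x, mem_connectedComponentIn hx, fun r hr hrN _ => ⟨⟨hx.1.1.1.trans hr.1, hr.2⟩, hrN⟩⟩
  have hsub : ∀ γ ∈ D, ∀ x ∈ γ, |x.2| ≤ ϑ ∧ x ∉ P.singularSetIter f n ∧
      (x.1 - ⌊x.1⌋, x.2) ∈ P.regular := by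
    rintro _ ⟨p, hp, rfl⟩ x hx
    obtain ⟨⟨-, hx2⟩, hx'⟩ := connectedComponentIn_subset _ _ hx
    have hx2' : x.2 = θ := hx2
    exact ⟨hx2' ▸ hθ, hx', sub_floor_mem_regular (hx2' ▸ hθ') (notMem_singularSet_of_notMem hn hx')⟩
  rw [show D = T ∪ D \ T from (union_sdiff_cancel fun γ hγ => hγ.1).symm]
  refine (ENNReal.tsum_union_le (fun γ => (P.leastExpansion f n γ)⁻¹) _ _).trans (add_le_add ?_ ?_)
  · refine (tsum_inv_leastExpansion_le (fun γ hγ x hx => ?_) hTle).trans_eq (by norm_cast)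
    obtain ⟨h1, h2, h3⟩ := hsub γ hγ.1 x hx
    exact ofReal_le_expansion hf hn hϑ h1 h2 (by positivity) (hgrow _ h3 (sub_floor_notMem h2))
  · refine (tsum_inv_leastExpansion_le (fun γ hγ x hx => ?_) hDle).trans_eq (by norm_cast)
    obtain ⟨h1, h2, h3⟩ := hsub γ hγ.1 x hx
    refine ofReal_le_expansion hf hn hϑ h1 h2 (by positivity) (hgraz _ h3 (sub_floor_notMem h2) ?_)
    exact sub_floor_notMem_nonGrazing fun h4 => hγ.2 ⟨hγ.1, x, hx, h4⟩

/-- With q = n / 3 one has n ≤ 3q + 3, which bounds the quotient by an affine function of q over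
σ^q. -/
lemma eventually_mul_div_pow_lt {σ : ℝ} (hσ : 1 < σ) (K : ℕ) {C : ℝ} (hC : 0 < C) :
    ∀ᶠ n : ℕ in atTop, ((n * K + 1 : ℕ) : ℝ) / (C * σ ^ (n / 3)) < 1 / 2 := by
  have h0 := tendsto_pow_const_div_const_pow_of_one_lt 0 hσ
  have h1 := tendsto_pow_const_div_const_pow_of_one_lt 1 hσ
  have h2 : Tendsto (fun q : ℕ => 3 * K / C * ((q : ℝ) ^ 1 / σ ^ q) +
      (3 * K + 1) / C * ((q : ℝ) ^ 0 / σ ^ q)) atTop (𝓝 0) := by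
    simpa using (h1.const_mul (3 * K / C)).add (h0.const_mul ((3 * K + 1) / C))
  have h3 : Tendsto (fun n : ℕ => n / 3) atTop atTop :=
    Nat.tendsto_div_const_atTop (by norm_num)
  filter_upwards [h3.eventually (h2.eventually (gt_mem_nhds (by norm_num : (0 : ℝ) < 1 / 2)))]
    with n hn
  refine lt_of_le_of_lt ?_ hn
  have hs : 0 < σ ^ (n / 3) := by positivity
  have h4 : (n : ℝ) ≤ 3 * ((n / 3 : ℕ) : ℝ) + 3 := by
    have : n ≤ 3 * (n / 3) + 3 := by omega
    exact_mod_cast this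
  have h5 : 3 * K / C * (((n / 3 : ℕ) : ℝ) ^ 1 / σ ^ (n / 3)) +
      (3 * K + 1) / C * (((n / 3 : ℕ) : ℝ) ^ 0 / σ ^ (n / 3)) =
      ((3 * ((n / 3 : ℕ) : ℝ) + 3) * K + 1) / (C * σ ^ (n / 3)) := by
    field_simp
    ring
  rw [h5]
  push_cast
  gcongr

end PolygonalTable

end

theorem mainTheorem3 {d : ℕ} (P : PolygonalTable d) (f : ℝ → ℝ) (hf : IsContractingLaw f)
    (hP : P.NoParallelSidesFacing) (ϑ : ℝ) (hϑ : ϑ < Real.pi / 2) :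
    ∃ n₀ : ℕ, ∀ n ≥ n₀, P.stepExpansion f ϑ n < 1 := by
  obtain ⟨σ, hσ, hgrow⟩ := PolygonalTable.exists_pow_le_growth hf hP
  obtain ⟨c, hc, hgraz⟩ := PolygonalTable.exists_growth_of_grazing (P := P) hf
  by_cases hϑ0 : 0 ≤ ϑ
  swap
  -- For ϑ < 0 there are no segments and the supremum is 0.
  · refine ⟨0, fun n _ => lt_of_le_of_lt ?_ one_pos⟩
    refine (liminf_le_liminf (v := fun _ => 0) (Eventually.of_forall fun δ => ?_)).trans
      (liminf_const _).le
    refine iSup₂_le ?_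
    rintro _ ⟨a, b, θ, -, -, hθ, rfl⟩
    exact absurd ((abs_nonneg θ).trans hθ) hϑ0
  have hC : 0 < Real.cos ϑ := Real.cos_pos_of_mem_Ioo ⟨by linarith [Real.pi_pos], hϑ⟩
  obtain ⟨n₀, hn₀⟩ := eventually_atTop.1
    ((PolygonalTable.eventually_mul_div_pow_lt hσ (2 * d * (d + 1)) hC).and (eventually_ge_atTop 1))
  refine ⟨n₀, fun n hn => ?_⟩
  obtain ⟨hlt, hn1⟩ := hn₀ n hn
  set K₁ := n * (2 * d * (d + 1)) + 1
  set K₂ := ∑ m ∈ Finset.range n, 2 * d * (d ^ (m + 1) + 1) + 1 with hK₂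
  have hK₂0 : (0 : ℝ) < K₂ := by rw [hK₂]; positivity
  -- Chosen so that the K₂ possible grazing pieces contribute 1/2 in the bound; there is no
  -- circularity, since K₂ depends only on n and d.
  set η : ℝ := Real.cos ϑ * c / (2 * K₂) with hη
  have hη0 : 0 < η := by positivity
  obtain ⟨δ₀, hδ₀, hle⟩ := PolygonalTable.exists_tsum_inv_leastExpansion_le hf hϑ hσ hc hη0
    (by omega : n ≠ 0) (hgrow n) (hgraz η hη0 n)
  have hσ0 : 0 < Real.cos ϑ * σ ^ (n / 3) := by positivity
  have hcη : 0 < Real.cos ϑ * (c / η) := by positivity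
  refine lt_of_le_of_lt (b := ENNReal.ofReal (K₁ / (Real.cos ϑ * σ ^ (n / 3)) + 1 / 2)) ?_ ?_
  · refine (liminf_le_liminf (v := fun _ => ENNReal.ofReal
      (K₁ / (Real.cos ϑ * σ ^ (n / 3)) + 1 / 2)) ?_).trans (liminf_const _).le
    filter_upwards [Ioc_mem_nhdsGT hδ₀] with δ hδ
    refine iSup₂_le fun Γ hΓ => (hle δ hδ.2 Γ hΓ).trans_eq ?_
    have h1 : (K₂ : ℝ) / (Real.cos ϑ * (c / η)) = 1 / 2 := by
      rw [hη]; field_simp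
    rw [← h1, ENNReal.ofReal_add (by positivity) (by positivity), ENNReal.ofReal_div_of_pos hσ0,
      ENNReal.ofReal_div_of_pos hcη, ENNReal.ofReal_natCast, ENNReal.ofReal_natCast,
      div_eq_mul_inv (K₁ : ENNReal), div_eq_mul_inv (K₂ : ENNReal)]
  · rw [ENNReal.ofReal_lt_one]
    linarith
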